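/- Fix integers $k,r,m\ge 1$ and $h_0\ge1$, and let $p,q,T\to\infty$ jointly, along an arbitrary sequence $(p_n,q_n,T_n)$. For each $n$ let $$Y_t=AX_t+RF_tC'+E_t\in\mathbb R^{p\times q},\qquad t=1,\dots,T,$$ where $A\in\mathbb R^{p\times m}$, $R\in\mathbb R^{p\times k}$, $C\in\mathbb R^{q\times r}$ are deterministic and $X_t$ ($m\times q$, observed), $F_t$ ($k\times r$) and $E_t$ ($p\times q$) are random; all of these, and the probability space, may depend on $n$, while constants and $\asymp$ below are uniform in $n$. Assume that $\mathbb E F_t=0$; that $\mathrm{vec}(E_t)$ is white noise (mean zero, covariance matrix $\Sigma_e$ independent of $t$, no serial correlation), uncorrelated with $\mathrm{vec}(F_s)$ for all $s,t$ and with $\mathrm{vec}(X_t)$ for every $t$; and that $\mathrm{vec}(F_t)$ and $\mathrm{vec}(X_t)$ are uncorrelated for every $t$. **Estimators.** Let $\widehat A=(\frac1T\sum_tY_tX_t')(\frac1T\sum_tX_tX_t')^{-1}$, $W_t=RF_tC'+E_t$ and $\widehat W_t=Y_t-\widehat AX_t$. For a matrix process $V_t$ with columns $v_{t,i}$ put $\mathsf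 M(V)=\sum_{h=1}^{h_0}\sum_{i,j}\Omega_{ij}(h)\Omega_{ij}(h)'$ with $\Omega_{ij}(h)=\frac1{T-h}\sum_{t=1}^{T-h}\mathrm{Cov}(v_{t,i},v_{t+h,j})$, and let $\widehat{\mathsf M}(V)$ be the same expression with $v_{t,i}v_{t+h,j}'$ in place of $\mathrm{Cov}(v_{t,i},v_{t+h,j})$. Let $M_1=\mathsf M(W)$, $M_2=\mathsf M(W')$, $\widehat M_1=\widehat{\mathsf M}(\widehat W)$, $\widehat M_2=\widehat{\mathsf M}(\widehat W')$. The columns of $Q_1$ (of $\widehat Q_1$) are orthonormal eigenvectors of $M_1$ (of $\widehat M_1$) for its $k$ largest eigenvalues, in decreasing order; those of $Q_2$ (of $\widehat Q_2$) are orthonormal eigenvectors of $M_2$ (of $\widehat M_2$) for its $r$ largest eigenvalues, in decreasing order. **Conditions.** Write $\Sigma_f(h)=\frac1{T-h}\sum_{t=1}^{T-h}\mathrm{Cov}(\mathrm{vec}F_t,\mathrm{vec}F_{t+h})$; $\sigma_j$ and $\lambda_j$ denote the $j$-th largest singular value and eigenvalue. 1. For some $\gamma>2$ the $\alpha$-mixing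 coefficients $\alpha(l)$ of $(\mathrm{vec}Y_t,\mathrm{vec}X_t,\mathrm{vec}F_t)_{t\in\mathbb Z}$ satisfy $\sum_{l\ge1}\alpha(l)^{1-2/\gamma}\le B$, with $B$ independent of $n$. 2. The absolute moments of order $2\gamma$ of all entries of $F_t,X_t,E_t$, $1\le t\le T$, are at most a constant. 3. There is $1\le h\le h_0$ such that, with $k^*=\max(k,r)$, $\mathrm{rank}\,\Sigma_f(h)\ge k^*$ for large $n$ and $\|\Sigma_f(h)\|_2\asymp1\asymp\sigma_{k^*}(\Sigma_f(h))$, and, for large $n$, $\frac1{T-h}\sum_{t=1}^{T-h}\mathrm{Cov}(F_{t,i\cdot},F_{t+h,i\cdot})\ne0$ and $\frac1{T-h}\sum_{t=1}^{T-h}\mathrm{Cov}(F_{t,\cdot j},F_{t+h,\cdot j})\neq0$ for every row index $i$ and column index $j$. Moreover the lagged autocovariances of $F_t$ have full row rank and full column rank uniformly: for some $c>0$ and all large $n$, $\lambda_k(\mathsf M(F))\ge c$ and $\lambda_r(\mathsf M(F'))\ge c$. 4. $P_t=\mathbb E(X_tX_t')$, $1\le t\le T$, is positive definite, and $\frac1T\sum_{t=1}^TP_t-P\to0$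 for positive definite matrices $P=P_n$ with $\lambda_{\min}(P)\asymp q$. 5. The entries of $\Sigma_e$ are bounded. 6. For constants $\delta_1,\delta_2\in[0,1]$: $\|R\|_2^2\asymp p^{1-\delta_1}\asymp\sigma_k(R)^2$ and $\|C\|_2^2\asymp q^{1-\delta_2}\asymp\sigma_r(C)^2$. 7. For large $n$ the $k$ largest eigenvalues of $M_1$ are positive and distinct, and so are the $r$ largest eigenvalues of $M_2$. **Theorem 5.** Under these conditions, if $p^{\delta_1}q^{\delta_2}T^{-1/2}=o(1)$, then $$\mathcal D(\widehat Q_i,Q_i)=O_p\bigl(p^{\delta_1}q^{\delta_2}T^{-1/2}\bigr),\qquad i=1,2,$$ where $\mathcal D(O_1,O_2)=\bigl(1-\tfrac1{\max(q_1,q_2)}\mathrm{Tr}(O_1O_1'O_2O_2')\bigr)^{1/2}$ for matrices $O_1,O_2$ with $q_1$ and $q_2$ orthonormal columns. -/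

import Mathlib

open MeasureTheory ProbabilityTheory Filter Topology Asymptotics Matrix

noncomputable section

namespace MatFactor

/-! ### Linear algebra -/

/-- The eigenvalues of a real symmetric matrix in decreasing order, numbered from `0` and repeated
with multiplicity (`0` from the size of the matrix on, and for non-symmetric matrices). -/
def nthEig {ι : Type*} [Fintype ι] [DecidableEq ι] (M : Matrix ι ι ℝ) (j : ℕ) : ℝ :=
  open Classical in
  if h : M.IsHermitian ∧ j < Fintype.card ι then h.1.eigenvalues₀ ⟨j, h.2⟩ else 0

/-- The singular values of a matrix in decreasing order, numbered from `0`. -/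
def singVal {ι κ : Type*} [Fintype ι] [Fintype κ] [DecidableEq κ] (M : Matrix ι κ ℝ) (j : ℕ) :
    ℝ :=
  (Matrix.toEuclideanLin M).singularValues j

open scoped Matrix.Norms.L2Operator in
/-- The spectral norm. -/
def specNorm {ι κ : Type*} [Fintype ι] [Fintype κ] [DecidableEq κ] (M : Matrix ι κ ℝ) : ℝ := ‖M‖

/-- The columns of `Q` are orthonormal, and the `j`-th one is an eigenvector of `M` for the `j`-th
largest eigenvalue of `M`. -/
def IsLeadingEigenvectors {a k : ℕ} (M : Matrix (Fin a) (Fin a) ℝ) (Q : Matrix (Fin a) (Fin k) ℝ) :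
    Prop :=
  Qᵀ * Q = 1 ∧ ∀ j : Fin k, M *ᵥ (fun i => Q i j) = nthEig M j • (fun i => Q i j)

/-- `M` has `k` distinct positive eigenvalues: the `k` largest ones are positive and pairwise
distinct. -/
def HasDistinctPosEig {a : ℕ} (M : Matrix (Fin a) (Fin a) ℝ) (k : ℕ) : Prop :=
  (∀ j < k, 0 < nthEig M j) ∧ ∀ i j, i < j → j < k → nthEig M j < nthEig M i

/-- The distance of the column spaces of two matrices with orthonormal columns. -/
def subspaceDist {a q₁ q₂ : ℕ} (O₁ : Matrix (Fin a) (Fin q₁) ℝ) (O₂ : Matrix (Fin a) (Fin q₂) ℝ) :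
    ℝ :=
  √(1 - 1 / ((max q₁ q₂ : ℕ) : ℝ) * (O₁ * O₁ᵀ * (O₂ * O₂ᵀ)).trace)

/-! ### Probability -/

/-- `Z n = O_p(a n)`. The probability is read as an outer measure, so that `Z n` need not be
measurable. -/
def IsBigOInProb {Ω : ℕ → Type*} [∀ n, MeasurableSpace (Ω n)] (μ : ∀ n, Measure (Ω n))
    (Z : ∀ n, Ω n → ℝ) (a : ℕ → ℝ) : Prop :=
  ∀ ε : ℝ, 0 < ε → ∃ B : ℝ, ∀ᶠ n in atTop, μ n {ω | B * a n < |Z n ω|} ≤ ENNReal.ofReal ε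

/-- The `α`-mixing coefficient at lag `l` of a process on `ℤ` for which `𝓖 t` is the `σ`-field
generated by the observation at time `t`. -/
def alphaMixing {Ω : Type*} [MeasurableSpace Ω] (μ : Measure Ω) (𝓖 : ℤ → MeasurableSpace Ω)
    (l : ℕ) : ℝ :=
  sSup {x : ℝ | ∃ (i : ℤ) (A B : Set Ω),
    MeasurableSet[⨆ t ∈ Set.Iic i, 𝓖 t] A ∧ MeasurableSet[⨆ t ∈ Set.Ici (i + (l : ℤ)), 𝓖 t] B ∧
      x = |μ.real A * μ.real B - μ.real (A ∩ B)|}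

/-- `(T - h)⁻¹ ∑_{t=1}^{T-h} Cov(U_t, V_{t+h})` for vector-valued processes `U` and `V`. -/
def avgLagCov {Ω α β : Type*} [MeasurableSpace Ω] (μ : Measure Ω) (T h : ℕ)
    (U : ℤ → Ω → α → ℝ) (V : ℤ → Ω → β → ℝ) : Matrix α β ℝ :=
  Matrix.of fun a b => ((T : ℝ) - (h : ℝ))⁻¹ *
    ∑ t ∈ Finset.Icc (1 : ℤ) ((T : ℤ) - (h : ℤ)),
      cov[fun ω => U t ω a, fun ω => V (t + (h : ℤ)) ω b; μ]

/-- `(T - h)⁻¹ ∑_{t=1}^{T-h} u_t v_{t+h}'` for sequences of vectors `u` and `v`. -/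
def avgLagProd {α β : Type*} (T h : ℕ) (u : ℤ → α → ℝ) (v : ℤ → β → ℝ) : Matrix α β ℝ :=
  Matrix.of fun a b => ((T : ℝ) - (h : ℝ))⁻¹ *
    ∑ t ∈ Finset.Icc (1 : ℤ) ((T : ℤ) - (h : ℤ)), u t a * v (t + (h : ℤ)) b

/-- `∑_{h=1}^{h₀} ∑_i ∑_j Ω_{ij}(h) Ω_{ij}(h)'`, where `Ω_{ij}(h)` is the averaged lag-`h`
covariance of the columns `i` and `j` of the matrix process `W`. -/
def popM {Ω : Type*} [MeasurableSpace Ω] (μ : Measure Ω) {a b : ℕ} (T h₀ : ℕ)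
    (W : ℤ → Ω → Matrix (Fin a) (Fin b) ℝ) : Matrix (Fin a) (Fin a) ℝ :=
  ∑ h ∈ Finset.Icc 1 h₀, ∑ i : Fin b, ∑ j : Fin b,
    avgLagCov μ T h (fun t ω x => W t ω x i) (fun t ω x => W t ω x j) *
      (avgLagCov μ T h (fun t ω x => W t ω x i) (fun t ω x => W t ω x j))ᵀ

/-- The sample version of `popM`. -/
def sampleM {a b : ℕ} (T h₀ : ℕ) (w : ℤ → Matrix (Fin a) (Fin b) ℝ) :
    Matrix (Fin a) (Fin a) ℝ :=
  ∑ h ∈ Finset.Icc 1 h₀, ∑ i : Fin b, ∑ j : Fin b,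
    avgLagProd T h (fun t x => w t x i) (fun t x => w t x j) *
      (avgLagProd T h (fun t x => w t x i) (fun t x => w t x j))ᵀ

/-- Both matrices are symmetric, so that `nthEig` is never the default value at them. -/
theorem popM_isHermitian {Ω : Type*} [MeasurableSpace Ω] (μ : Measure Ω) {a b : ℕ} (T h₀ : ℕ)
    (W : ℤ → Ω → Matrix (Fin a) (Fin b) ℝ) : (popM μ T h₀ W).IsHermitian := by
  simp [popM, Matrix.IsHermitian, Matrix.conjTranspose_eq_transpose_of_trivial,
    Matrix.transpose_sum, Matrix.transpose_mul]

theorem sampleM_isHermitian {a b : ℕ} (T h₀ : ℕ) (w : ℤ → Matrix (Fin a) (Fin b) ℝ) :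
    (sampleM T h₀ w).IsHermitian := by
  simp [sampleM, Matrix.IsHermitian, Matrix.conjTranspose_eq_transpose_of_trivial,
    Matrix.transpose_sum, Matrix.transpose_mul]

/-! ### The model and the estimators -/

/-- The data of the model `Y_t = A X_t + R F_t C' + E_t`, `t = 1, …, T`: the dimensions, the
probability, the deterministic coefficients, and the random processes (extended to all of `ℤ`). -/
structure Model (k r m : ℕ) (Ω : Type*) [MeasurableSpace Ω] where
  p : ℕ
  q : ℕ
  T : ℕ
  μ : Measure Ω
  isProb : IsProbabilityMeasure μ
  A : Matrix (Fin p) (Fin m) ℝ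
  R : Matrix (Fin p) (Fin k) ℝ
  C : Matrix (Fin q) (Fin r) ℝ
  X : ℤ → Ω → Matrix (Fin m) (Fin q) ℝ
  F : ℤ → Ω → Matrix (Fin k) (Fin r) ℝ
  E : ℤ → Ω → Matrix (Fin p) (Fin q) ℝ
  measurable_X : ∀ t i j, Measurable fun ω => X t ω i j
  measurable_F : ∀ t i j, Measurable fun ω => F t ω i j
  measurable_E : ∀ t i j, Measurable fun ω => E t ω i j

namespace Model

variable {k r m : ℕ} {Ω : Type*} [MeasurableSpace Ω] (S : Model k r m Ω)

/-- `W_t = R F_t C' + E_t`. -/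
def W (t : ℤ) (ω : Ω) : Matrix (Fin S.p) (Fin S.q) ℝ := S.R * S.F t ω * S.Cᵀ + S.E t ω

/-- The observations. -/
def Y (t : ℤ) (ω : Ω) : Matrix (Fin S.p) (Fin S.q) ℝ :=
  S.A * S.X t ω + S.R * S.F t ω * S.Cᵀ + S.E t ω

/-- The times `1, …, T`. -/
def times : Finset ℤ := Finset.Icc (1 : ℤ) (S.T : ℤ)

/-- The least squares estimator of `A`. -/
def Ahat (ω : Ω) : Matrix (Fin S.p) (Fin m) ℝ :=
  ((S.T : ℝ)⁻¹ • ∑ t ∈ S.times, S.Y t ω * (S.X t ω)ᵀ) *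
    ((S.T : ℝ)⁻¹ • ∑ t ∈ S.times, S.X t ω * (S.X t ω)ᵀ)⁻¹

/-- `Ŵ_t = Y_t - Â X_t`. -/
def What (ω : Ω) (t : ℤ) : Matrix (Fin S.p) (Fin S.q) ℝ := S.Y t ω - S.Ahat ω * S.X t ω

/-- The matrices `M₁` and `M₂`, and their estimators. -/
def M₁ (h₀ : ℕ) : Matrix (Fin S.p) (Fin S.p) ℝ := popM S.μ S.T h₀ S.W

def M₂ (h₀ : ℕ) : Matrix (Fin S.q) (Fin S.q) ℝ := popM S.μ S.T h₀ fun t ω => (S.W t ω)ᵀ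

def M₁hat (h₀ : ℕ) (ω : Ω) : Matrix (Fin S.p) (Fin S.p) ℝ := sampleM S.T h₀ (S.What ω)

def M₂hat (h₀ : ℕ) (ω : Ω) : Matrix (Fin S.q) (Fin S.q) ℝ :=
  sampleM S.T h₀ fun t => (S.What ω t)ᵀ

/-- The `σ`-field generated by `(vec Y_t, vec X_t, vec F_t)`. -/
abbrev obsSigma (t : ℤ) : MeasurableSpace Ω :=
  (⨆ i, ⨆ j, MeasurableSpace.comap (fun ω => S.Y t ω i j) inferInstance) ⊔
    (⨆ i, ⨆ j, MeasurableSpace.comap (fun ω => S.X t ω i j) inferInstance) ⊔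
      (⨆ i, ⨆ j, MeasurableSpace.comap (fun ω => S.F t ω i j) inferInstance)

/-- `Σ_f(h) = (T - h)⁻¹ ∑_{t=1}^{T-h} Cov(vec F_t, vec F_{t+h})`. -/
def Sigmaf (h : ℕ) : Matrix (Fin k × Fin r) (Fin k × Fin r) ℝ :=
  avgLagCov S.μ S.T h (fun t ω x => S.F t ω x.1 x.2) (fun t ω x => S.F t ω x.1 x.2)

/-- The entries of `Σ_e = Var(vec E_t)`. -/
def errCov (t : ℤ) (a b : Fin S.p × Fin S.q) : ℝ :=
  cov[fun ω => S.E t ω a.1 a.2, fun ω => S.E t ω b.1 b.2; S.μ]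

/-- `P_t = E(X_t X_t')`. -/
def P (t : ℤ) : Matrix (Fin m) (Fin m) ℝ :=
  Matrix.of fun l l' => ∫ ω, (S.X t ω * (S.X t ω)ᵀ) l l' ∂S.μ

/-- The standing assumptions of the model: the factors have mean zero and are uncorrelated with the
regressors of the same time; the errors are white noise, uncorrelated with the factors (at all
leads and lags) and with the regressors of the same time. -/
structure Standing : Prop where
  mean_F : ∀ t ∈ S.times, ∀ i j, ∫ ω, S.F t ω i j ∂S.μ = 0
  mean_E : ∀ t ∈ S.times, ∀ i j, ∫ ω, S.E t ω i j ∂S.μ = 0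
  var_E : ∀ s ∈ S.times, ∀ t ∈ S.times, ∀ a b, S.errCov s a b = S.errCov t a b
  white_E : ∀ s ∈ S.times, ∀ t ∈ S.times, s ≠ t → ∀ i j i' j',
    cov[fun ω => S.E s ω i j, fun ω => S.E t ω i' j'; S.μ] = 0
  cov_E_F : ∀ s ∈ S.times, ∀ t ∈ S.times, ∀ i j i' j',
    cov[fun ω => S.E s ω i j, fun ω => S.F t ω i' j'; S.μ] = 0
  cov_E_X : ∀ t ∈ S.times, ∀ i j i' j',
    cov[fun ω => S.E t ω i j, fun ω => S.X t ω i' j'; S.μ] = 0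
  cov_F_X : ∀ t ∈ S.times, ∀ i j i' j',
    cov[fun ω => S.F t ω i j, fun ω => S.X t ω i' j'; S.μ] = 0

end Model

/-! ### The conditions, for a sequence of models with fixed `k`, `r`, `m` -/

section Conditions

variable {k r m : ℕ} {Ω : ℕ → Type*} [∀ n, MeasurableSpace (Ω n)]
  (S : ∀ n, Model k r m (Ω n))

/-- Summable mixing coefficients, uniformly along the sequence. -/
def Condition1 (γ : ℝ) : Prop :=
  2 < γ ∧ ∃ B : ℝ, ∀ n,
    Summable (fun l : ℕ => alphaMixing (S n).μ (S n).obsSigma (l + 1) ^ (1 - 2 / γ)) ∧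
      ∑' l : ℕ, alphaMixing (S n).μ (S n).obsSigma (l + 1) ^ (1 - 2 / γ) ≤ B

/-- `E |z|^s ≤ B`. -/
def MomentLe {Ω' : Type*} [MeasurableSpace Ω'] (μ : Measure Ω') (z : Ω' → ℝ) (s B : ℝ) : Prop :=
  Integrable (fun ω => |z ω| ^ s) μ ∧ ∫ ω, |z ω| ^ s ∂μ ≤ B

/-- Uniformly bounded moments of order `2γ`. -/
def Condition2 (γ : ℝ) : Prop :=
  ∃ B : ℝ, ∀ n, ∀ t ∈ (S n).times,
    (∀ i j, MomentLe (S n).μ (fun ω => (S n).F t ω i j) (2 * γ) B) ∧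
    (∀ l g, MomentLe (S n).μ (fun ω => (S n).X t ω l g) (2 * γ) B) ∧
    (∀ u g, MomentLe (S n).μ (fun ω => (S n).E t ω u g) (2 * γ) B)

/-- Serial dependence of the factors. The last two clauses say that the lagged autocovariances of
`F_t` have full row rank and full column rank uniformly: they bound
`∑_{h ≤ h₀} ‖(T - h)⁻¹ ∑_t Cov(F_t'v, vec F_{t+h})‖²` (Frobenius norm) from below over all unit vectors `v ∈ ℝ^k`, and
likewise for `F_t v` and unit vectors `v ∈ ℝ^r`. -/
def Condition3 (h₀ : ℕ) : Prop :=
  (∃ h : ℕ, 1 ≤ h ∧ h ≤ h₀ ∧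
    (∀ᶠ n in atTop, max k r ≤ ((S n).Sigmaf h).rank) ∧
    (fun n => specNorm ((S n).Sigmaf h)) =Θ[atTop] (fun _ => (1 : ℝ)) ∧
    (fun n => singVal ((S n).Sigmaf h) (max k r - 1)) =Θ[atTop] (fun _ => (1 : ℝ)) ∧
    (∀ᶠ n in atTop, ∀ i : Fin k, avgLagCov (S n).μ (S n).T h
      (fun t ω (x : Fin r) => (S n).F t ω i x) (fun t ω (x : Fin r) => (S n).F t ω i x) ≠ 0) ∧
    (∀ᶠ n in atTop, ∀ j : Fin r, avgLagCov (S n).μ (S n).T h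
      (fun t ω (x : Fin k) => (S n).F t ω x j) (fun t ω (x : Fin k) => (S n).F t ω x j) ≠ 0)) ∧
  ∃ c : ℝ, 0 < c ∧ ∀ᶠ n in atTop,
    c ≤ nthEig (popM (S n).μ (S n).T h₀ (S n).F) (k - 1) ∧
      c ≤ nthEig (popM (S n).μ (S n).T h₀ fun t ω => ((S n).F t ω)ᵀ) (r - 1)

/-- Second moments of the regressors. -/
def Condition4 : Prop :=
  (∀ n, ∀ t ∈ (S n).times, ((S n).P t).PosDef) ∧
  ∃ P : ℕ → Matrix (Fin m) (Fin m) ℝ, (∀ n, (P n).PosDef) ∧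
    (∀ l l', Tendsto (fun n => (((S n).T : ℝ)⁻¹ • ∑ t ∈ (S n).times, (S n).P t) l l' - P n l l')
      atTop (𝓝 0)) ∧
    (fun n => nthEig (P n) (m - 1)) =Θ[atTop] (fun n => ((S n).q : ℝ))

/-- Bounded error covariances. -/
def Condition5 : Prop :=
  ∃ B : ℝ, ∀ n, ∀ t ∈ (S n).times, ∀ a b, |(S n).errCov t a b| ≤ B

/-- Strength of the row factors and of the column factors. -/
def Condition6 (δ₁ δ₂ : ℝ) : Prop :=
  0 ≤ δ₁ ∧ δ₁ ≤ 1 ∧ 0 ≤ δ₂ ∧ δ₂ ≤ 1 ∧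
    (fun n => specNorm (S n).R ^ 2) =Θ[atTop] (fun n => ((S n).p : ℝ) ^ (1 - δ₁)) ∧
    (fun n => singVal (S n).R (k - 1) ^ 2) =Θ[atTop] (fun n => ((S n).p : ℝ) ^ (1 - δ₁)) ∧
    (fun n => specNorm (S n).C ^ 2) =Θ[atTop] (fun n => ((S n).q : ℝ) ^ (1 - δ₂)) ∧
    (fun n => singVal (S n).C (r - 1) ^ 2) =Θ[atTop] (fun n => ((S n).q : ℝ) ^ (1 - δ₂))

/-- `M₁` and `M₂` have `k` and `r` distinct positive eigenvalues. -/
def Condition7 (h₀ : ℕ) : Prop :=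
  ∀ᶠ n in atTop, HasDistinctPosEig ((S n).M₁ h₀) k ∧ HasDistinctPosEig ((S n).M₂ h₀) r

end Conditions

end MatFactor

end

/-! Put x = p^(1-δ₁) q^(1-δ₂) and η = p^δ₁ q^δ₂ T^(-1/2), so that xη = pq T^(-1/2).

At positive lags the white noise drops out of every covariance of `W`. Each block Ω_ij(h) is
therefore R(·)R', the range of M₁ lies in that of R, and on the range of R the form of M₁ is at
least a multiple s of x² (`popM_of_loadedCov`). As k eigenvalues of M₁ are positive, Q₁ spans the
range of R, so the gap that matters is the one between these eigenvalues and 0. A Davis–Kahan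
argument bounds the distance by 2‖M̂₁ - M₁‖/s in Frobenius norm (`subspaceDist_le_of_eigenvectors`).

M₁ is a sum of products ΩΩ'. If b² and a² are the total squared Frobenius norms of the Ω and of
their errors, then ‖M̂₁ - M₁‖ ≤ a² + 2ab. Summed over all blocks and lags, these totals are squared
Frobenius norms of the lagged autocovariance matrices of vec W and of their errors. Cutting these
matrices by pairs of rows instead of pairs of columns gives the same totals, so one estimate serves
M₁ and M₂. Only factors contribute to b, so b = O(x). The (pq)² entries have mean squared errors of
order 1/T on average, so a = O_p(pq T^(-1/2)) = O_p(xη). Dividing by s yields the rate η.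

The entrywise errors come from Davydov's covariance inequality (`abs_integral_mul_sub_le_rpow`, by
truncation) and summability of the mixing coefficients. Replacing W by residuals costs no more: ‖Â -
A‖² = O_p(p/T), and Cauchy–Schwarz turns this into an error (pq)²/T in the lagged products.

All randomness is collected in one nonnegative variable `totalErr` with bounded mean. On the event
that it is at most K the bounds are deterministic (`subspaceDist_le_of_totalErr_le`), and Markov's
inequality controls the complement. -/

noncomputable section

namespace MatFactor

/-! ### Eigenvalues and quadratic forms -/

section Spectral

variable {E : Type*} [NormedAddCommGroup E] [InnerProductSpace ℝ E] [FiniteDimensional ℝ E]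

theorem inner_map_self_eq_sum_eigenvalues {n : ℕ} {T : E →ₗ[ℝ] E} (hT : T.IsSymmetric)
    (hn : Module.finrank ℝ E = n) (x : E) :
    inner ℝ x (T x) = ∑ i, hT.eigenvalues hn i * inner ℝ (hT.eigenvectorBasis hn i) x ^ 2 := by
  rw [← (hT.eigenvectorBasis hn).sum_inner_mul_inner x (T x)]
  refine Finset.sum_congr rfl fun i _ => ?_
  rw [← hT, hT.apply_eigenvectorBasis, real_inner_comm]
  simp only [RCLike.ofReal_real_eq_id, id, real_inner_smul_left]
  ring

theorem le_inner_map_self_of_le_eigenvalues {n : ℕ} {T : E →ₗ[ℝ] E} (hT : T.IsSymmetric)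
    (hn : Module.finrank ℝ E = n) {c : ℝ} (hc : ∀ i, c ≤ hT.eigenvalues hn i) (x : E) :
    c * ‖x‖ ^ 2 ≤ inner ℝ x (T x) := by
  rw [inner_map_self_eq_sum_eigenvalues hT hn,
    ← (hT.eigenvectorBasis hn).sum_sq_norm_inner_right x, Finset.mul_sum]
  refine Finset.sum_le_sum fun i _ => ?_
  rw [Real.norm_eq_abs, sq_abs]
  exact mul_le_mul_of_nonneg_right (hc i) (sq_nonneg _)

/-- Courant–Fischer by counting dimensions: the range of `L` has dimension k > j, so it contains a
nonzero vector orthogonal to the first j eigenvectors, and there the form is at most the j-th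
eigenvalue times the squared norm. -/
theorem le_eigenvalues_of_le_inner {n k : ℕ} {T : E →ₗ[ℝ] E} (hT : T.IsSymmetric)
    (hn : Module.finrank ℝ E = n) (L : (Fin k → ℝ) →ₗ[ℝ] E) (hL : Function.Injective L) {s : ℝ}
    (hs : ∀ z, s * ‖L z‖ ^ 2 ≤ inner ℝ (L z) (T (L z))) (j : Fin n) (hj : (j : ℕ) < k) :
    s ≤ hT.eigenvalues hn j := by
  let b := hT.eigenvectorBasis hn
  let φ : (Fin k → ℝ) →ₗ[ℝ] (Fin j → ℝ) :=
    LinearMap.pi fun i => (innerSL ℝ (b (Fin.castLE j.2.le i))).toLinearMap ∘ₗ L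
  have hker : LinearMap.ker φ ≠ ⊥ := LinearMap.ker_ne_bot_of_finrank_lt (by simpa using hj)
  obtain ⟨z, hz, hz0⟩ := (Submodule.ne_bot_iff _).1 hker
  have hLz : 0 < ‖L z‖ ^ 2 := by
    have : L z ≠ 0 := fun h => hz0 (hL (by simpa using h))
    positivity
  have horth : ∀ i : Fin n, i < j → inner ℝ (b i) (L z) = 0 := fun i hi =>
    congrFun (LinearMap.mem_ker.1 hz) ⟨i, hi⟩
  refine le_of_mul_le_mul_right ((hs z).trans ?_) hLz
  rw [inner_map_self_eq_sum_eigenvalues hT hn, ← b.sum_sq_norm_inner_right (L z), Finset.mul_sum]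
  refine Finset.sum_le_sum fun i _ => ?_
  rw [Real.norm_eq_abs, sq_abs]
  rcases lt_or_ge i j with hi | hi
  · have := horth i hi
    simp only [b] at this ⊢
    simp [this]
  · exact mul_le_mul_of_nonneg_right (hT.eigenvalues_antitone hn hi) (sq_nonneg _)

end Spectral

theorem inner_toLp {ι : Type*} [Fintype ι] (x y : ι → ℝ) :
    inner ℝ (WithLp.toLp 2 x) (WithLp.toLp 2 y) = x ⬝ᵥ y := by
  simp [EuclideanSpace.inner_eq_star_dotProduct, dotProduct_comm]

theorem norm_toLp_sq {ι : Type*} [Fintype ι] (x : ι → ℝ) :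
    ‖WithLp.toLp 2 x‖ ^ 2 = x ⬝ᵥ x := by
  rw [← inner_toLp, real_inner_self_eq_norm_sq]

theorem toEuclideanLin_apply_toLp {ι κ : Type*} [Fintype ι] [Fintype κ] [DecidableEq κ]
    (M : Matrix ι κ ℝ) (x : κ → ℝ) :
    Matrix.toEuclideanLin M (WithLp.toLp 2 x) = WithLp.toLp 2 (M *ᵥ x) := by
  simp [Matrix.toLpLin_toLp]

theorem nthEig_eq {a : ℕ} {M : Matrix (Fin a) (Fin a) ℝ} (hM : M.IsHermitian) {j : ℕ}
    (hj : j < Fintype.card (Fin a)) :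
    nthEig M j = (Matrix.isSymmetric_toEuclideanLin_iff.mpr hM).eigenvalues
      finrank_euclideanSpace ⟨j, hj⟩ := by
  rw [nthEig, dif_pos ⟨hM, hj⟩]; rfl

/-- A lower bound for a quadratic form on a `k`-dimensional space bounds the `k` largest
eigenvalues. -/
theorem le_nthEig {a k : ℕ} {M : Matrix (Fin a) (Fin a) ℝ} (hM : M.IsHermitian)
    {Q : Matrix (Fin a) (Fin k) ℝ} (hQ : Qᵀ * Q = 1) (hk : k ≤ a) {s : ℝ}
    (hs : ∀ z, s * ((Q *ᵥ z) ⬝ᵥ (Q *ᵥ z)) ≤ (Q *ᵥ z) ⬝ᵥ (M *ᵥ (Q *ᵥ z))) {j : ℕ} (hj : j < k) :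
    s ≤ nthEig M j := by
  have hj' : j < Fintype.card (Fin a) := by simpa using hj.trans_le hk
  rw [nthEig_eq hM hj']
  refine le_eigenvalues_of_le_inner _ _
    ((WithLp.linearEquiv 2 ℝ (Fin a → ℝ)).symm.toLinearMap ∘ₗ Q.mulVecLin) ?_ ?_ ⟨j, hj'⟩ hj
  · intro x y hxy
    have hxy' : Q *ᵥ x = Q *ᵥ y := by simpa using hxy
    simpa [Matrix.mulVec_mulVec, hQ] using congrArg (fun v => Qᵀ *ᵥ v) hxy'
  · intro z
    have := hs z
    rw [← norm_toLp_sq, ← inner_toLp, ← toEuclideanLin_apply_toLp] at this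
    exact this

/-- The smallest eigenvalue bounds the quadratic form. -/
theorem le_dotProduct_mulVec {k : ℕ} {M : Matrix (Fin k) (Fin k) ℝ} (hM : M.IsHermitian) {c : ℝ}
    (hc : c ≤ nthEig M (k - 1)) (z : Fin k → ℝ) : c * (z ⬝ᵥ z) ≤ z ⬝ᵥ (M *ᵥ z) := by
  rcases Nat.eq_zero_or_pos k with rfl | hk
  · simp [dotProduct]
  have hj : k - 1 < Fintype.card (Fin k) := by simp; omega
  rw [nthEig_eq hM hj] at hc
  have := le_inner_map_self_of_le_eigenvalues (Matrix.isSymmetric_toEuclideanLin_iff.mpr hM)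
    finrank_euclideanSpace (c := c) (fun i => hc.trans (LinearMap.IsSymmetric.eigenvalues_antitone
      _ _ (Fin.le_def.2 (by have := i.2; simp at this ⊢; omega)))) (WithLp.toLp 2 z)
  rwa [norm_toLp_sq, toEuclideanLin_apply_toLp, inner_toLp] at this

/-- The smallest singular value of a matrix with `k` columns bounds the matrix from below. -/
theorem singVal_sq_mul_le {ι : Type*} [Fintype ι] {k : ℕ} (M : Matrix ι (Fin k) ℝ)
    (z : Fin k → ℝ) : singVal M (k - 1) ^ 2 * (z ⬝ᵥ z) ≤ (M *ᵥ z) ⬝ᵥ (M *ᵥ z) := by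
  rcases Nat.eq_zero_or_pos k with rfl | hk
  · simp [dotProduct, Matrix.mulVec]
  have hj : k - 1 < k := by omega
  rw [singVal, LinearMap.sq_singularValues_of_lt _ (n := k) (by simp) hj]
  have := le_inner_map_self_of_le_eigenvalues
    (Matrix.toEuclideanLin M).isSymmetric_adjoint_comp_self (n := k) (by simp)
    (c := (Matrix.toEuclideanLin M).isSymmetric_adjoint_comp_self.eigenvalues (by simp)
      ⟨k - 1, hj⟩) (fun i => LinearMap.IsSymmetric.eigenvalues_antitone
      _ _ (Fin.le_def.2 (by have := i.2; simp; omega))) (WithLp.toLp 2 z)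
  rw [norm_toLp_sq, LinearMap.comp_apply, LinearMap.adjoint_inner_right,
    toEuclideanLin_apply_toLp, inner_toLp] at this
  exact this

/-! ### Sums of squares of matrix entries -/

/-- The squared Frobenius norm. -/
def frobSq {ι κ : Type*} [Fintype ι] [Fintype κ] (M : Matrix ι κ ℝ) : ℝ := ∑ i, ∑ j, M i j ^ 2

theorem frobSq_nonneg {ι κ : Type*} [Fintype ι] [Fintype κ] (M : Matrix ι κ ℝ) : 0 ≤ frobSq M :=
  Finset.sum_nonneg fun _ _ => Finset.sum_nonneg fun _ _ => sq_nonneg _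

theorem dotProduct_self_nonneg {ι : Type*} [Fintype ι] (x : ι → ℝ) : 0 ≤ x ⬝ᵥ x :=
  Finset.sum_nonneg fun _ _ => mul_self_nonneg _

theorem frobSq_mulVec_le {ι κ : Type*} [Fintype ι] [Fintype κ] (M : Matrix ι κ ℝ) (x : κ → ℝ) :
    (M *ᵥ x) ⬝ᵥ (M *ᵥ x) ≤ frobSq M * (x ⬝ᵥ x) := by
  rw [frobSq, Finset.sum_mul]
  refine Finset.sum_le_sum fun i _ => ?_
  rw [← sq, Matrix.mulVec, dotProduct]
  refine (Finset.sum_mul_sq_le_sq_mul_sq _ _ _).trans_eq ?_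
  simp [dotProduct, sq]

theorem dotProduct_sq_le {ι : Type*} [Fintype ι] (x y : ι → ℝ) :
    (x ⬝ᵥ y) ^ 2 ≤ (x ⬝ᵥ x) * (y ⬝ᵥ y) := by
  refine (Finset.sum_mul_sq_le_sq_mul_sq _ _ _).trans_eq ?_
  simp [dotProduct, sq]

theorem abs_dotProduct_mulVec_le {ι : Type*} [Fintype ι] (M : Matrix ι ι ℝ) (x : ι → ℝ) :
    |x ⬝ᵥ (M *ᵥ x)| ≤ √(frobSq M) * (x ⬝ᵥ x) := by
  have hx : 0 ≤ x ⬝ᵥ x := dotProduct_self_nonneg x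
  refine Real.abs_le_sqrt (y := (√(frobSq M) * (x ⬝ᵥ x)) ^ 2) ?_ |>.trans_eq
    (Real.sqrt_sq (by positivity))
  rw [mul_pow, Real.sq_sqrt (frobSq_nonneg _)]
  calc _ ≤ (x ⬝ᵥ x) * ((M *ᵥ x) ⬝ᵥ (M *ᵥ x)) := dotProduct_sq_le _ _
    _ ≤ (x ⬝ᵥ x) * (frobSq M * (x ⬝ᵥ x)) :=
      mul_le_mul_of_nonneg_left (frobSq_mulVec_le _ _) hx
    _ = _ := by ring

section Frobenius

open scoped Matrix.Norms.Frobenius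

theorem frobSq_eq_norm_sq {ι κ : Type*} [Fintype ι] [Fintype κ] (M : Matrix ι κ ℝ) :
    frobSq M = ‖M‖ ^ 2 := by
  have h := frobSq_nonneg M
  rw [Matrix.frobenius_norm_def, ← Real.sqrt_eq_rpow, Real.sq_sqrt]
  · simp [frobSq]
  · simpa [frobSq] using h

theorem sqrt_frobSq {ι κ : Type*} [Fintype ι] [Fintype κ] (M : Matrix ι κ ℝ) :
    √(frobSq M) = ‖M‖ := by
  rw [frobSq_eq_norm_sq, Real.sqrt_sq (norm_nonneg _)]

/-- With Δ = H - G one has HH' - GG' = ΔΔ' + ΔG' + GΔ'. Cauchy–Schwarz over the index `e` keeps the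
bound in terms of the totals, with no factor for the number of summands. -/
theorem sqrt_frobSq_sum_mul_transpose_sub_le {ι κ α : Type*} [Fintype ι] [Fintype κ]
    (s : Finset α) (G H : α → Matrix ι κ ℝ) {a b : ℝ} (ha : 0 ≤ a) (hb : 0 ≤ b)
    (hG : ∑ e ∈ s, frobSq (G e) ≤ b ^ 2) (hH : ∑ e ∈ s, frobSq (H e - G e) ≤ a ^ 2) :
    √(frobSq (∑ e ∈ s, H e * (H e)ᵀ - ∑ e ∈ s, G e * (G e)ᵀ)) ≤ a ^ 2 + 2 * a * b := by
  simp only [frobSq_eq_norm_sq] at hG hH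
  rw [sqrt_frobSq, ← Finset.sum_sub_distrib]
  have hcs : ∑ e ∈ s, ‖H e - G e‖ * ‖G e‖ ≤ a * b := by
    refine (Real.sum_mul_le_sqrt_mul_sqrt s _ _).trans (mul_le_mul ?_ ?_ (Real.sqrt_nonneg _) ha)
    · exact Real.sqrt_le_iff.2 ⟨ha, hH⟩
    · exact Real.sqrt_le_iff.2 ⟨hb, hG⟩
  calc _ ≤ ∑ e ∈ s, ‖H e * (H e)ᵀ - G e * (G e)ᵀ‖ := norm_sum_le _ _
    _ ≤ ∑ e ∈ s, (‖H e - G e‖ ^ 2 + 2 * (‖H e - G e‖ * ‖G e‖)) := by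
      refine Finset.sum_le_sum fun e _ => ?_
      have : H e * (H e)ᵀ - G e * (G e)ᵀ = (H e - G e) * (H e - G e)ᵀ +
          ((H e - G e) * (G e)ᵀ + G e * (H e - G e)ᵀ) := by
        simp only [Matrix.transpose_sub, Matrix.sub_mul, Matrix.mul_sub]
        abel
      rw [this]
      refine (norm_add_le _ _).trans (add_le_add ?_ ((norm_add_le _ _).trans ?_))
      · refine (Matrix.frobenius_norm_mul _ _).trans_eq ?_
        rw [Matrix.frobenius_norm_transpose, sq]
      · have h1 := Matrix.frobenius_norm_mul (H e - G e) (G e)ᵀ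
        have h2 := Matrix.frobenius_norm_mul (G e) (H e - G e)ᵀ
        rw [Matrix.frobenius_norm_transpose] at h1 h2
        linarith
    _ ≤ _ := by
      rw [Finset.sum_add_distrib, ← Finset.mul_sum]
      linarith

theorem frobSq_mul_le {ι κ α : Type*} [Fintype ι] [Fintype κ] [Fintype α]
    (M : Matrix ι κ ℝ) (N : Matrix κ α ℝ) : frobSq (M * N) ≤ frobSq M * frobSq N := by
  simp only [frobSq_eq_norm_sq, ← mul_pow]
  exact pow_le_pow_left₀ (norm_nonneg _) (Matrix.frobenius_norm_mul _ _) 2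

end Frobenius

open scoped Matrix.Norms.L2Operator in
-- Each column is the image of a unit vector. As the number of factors is fixed, the two norms of a
-- loading matrix have the same order.
theorem frobSq_le_specNorm {ι : Type*} [Fintype ι] {k : ℕ} (M : Matrix ι (Fin k) ℝ) :
    frobSq M ≤ k * specNorm M ^ 2 := by
  rw [frobSq, Finset.sum_comm]
  calc _ ≤ ∑ j : Fin k, specNorm M ^ 2 := by
        refine Finset.sum_le_sum fun j _ => ?_
        have h := Matrix.l2_opNorm_mulVec M (EuclideanSpace.single j (1 : ℝ))
        have h' := pow_le_pow_left₀ (norm_nonneg _) h 2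
        rw [EuclideanSpace.norm_sq_eq] at h'
        simpa [specNorm] using h'
    _ = _ := by simp

/-! ### Perturbation of the leading eigenvectors -/

/-- `M` has rank at most k and k positive eigenvalues, so `Q` spans the range of `L`, and the
projection N onto the orthogonal complement satisfies NM = 0. An eigenpair (λ, x) of `M'` then has
λNx = N(M' - M)x, while λ ≥ s/2 by the variational bound. The squared distance is the average of
‖Nx‖² over the columns x of `Q'`. -/
theorem subspaceDist_le_of_eigenvectors {a k : ℕ} (hk : 1 ≤ k) (hka : k ≤ a)
    {M M' : Matrix (Fin a) (Fin a) ℝ} {Q Q' : Matrix (Fin a) (Fin k) ℝ}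
    {L : Matrix (Fin a) (Fin k) ℝ} {B : Matrix (Fin k) (Fin a) ℝ} (hML : M = L * B)
    (hM' : M'.IsHermitian)
    (hQ : IsLeadingEigenvectors M Q) (hpos : ∀ j < k, 0 < nthEig M j)
    (hQ' : IsLeadingEigenvectors M' Q') {s : ℝ} (hs0 : 0 < s)
    (hs : ∀ z, s * ((L *ᵥ z) ⬝ᵥ (L *ᵥ z)) ≤ (L *ᵥ z) ⬝ᵥ (M *ᵥ (L *ᵥ z)))
    (hΔ : √(frobSq (M' - M)) ≤ s / 2) :
    subspaceDist Q' Q ≤ 2 / s * √(frobSq (M' - M)) := by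
  obtain ⟨hQQ, hQe⟩ := hQ
  obtain ⟨hQQ', hQe'⟩ := hQ'
  set δ := √(frobSq (M' - M)) with hδ
  have hδ0 : 0 ≤ δ := Real.sqrt_nonneg _
  -- the columns of `Q` lie in the range of `L`
  obtain ⟨D, hD⟩ : ∃ D : Matrix (Fin k) (Fin k) ℝ, Q = L * D := by
    -- From MQ = QΛ with Λ invertible: Q = MQΛ⁻¹ = L(BQΛ⁻¹).
    refine ⟨B * Q * Matrix.diagonal fun j : Fin k => (nthEig M j)⁻¹, ?_⟩
    rw [← Matrix.mul_assoc, ← Matrix.mul_assoc, ← hML]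
    ext i j
    rw [Matrix.mul_diagonal, Matrix.mul_apply]
    have := congrFun (hQe j) i
    simp only [Matrix.mulVec, dotProduct, Pi.smul_apply, smul_eq_mul] at this
    rw [this]
    field_simp [(hpos j j.2).ne']
  have hLQ : L = Q * (Qᵀ * L) := by
    -- For square matrices a one-sided inverse is two-sided, so Q = LD can be solved for L.
    have h1 : (Qᵀ * L) * D = 1 := by rw [Matrix.mul_assoc, ← hD, hQQ]
    have h2 := mul_eq_one_comm.1 h1
    conv_rhs => rw [hD, Matrix.mul_assoc, ← hD, h2, Matrix.mul_one]
  set N : Matrix (Fin a) (Fin a) ℝ := 1 - Q * Qᵀ with hN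
  have hNM : N * M = 0 := by
    rw [hML, ← Matrix.mul_assoc, hN, Matrix.sub_mul, Matrix.one_mul, Matrix.mul_assoc, ← hLQ,
      sub_self, Matrix.zero_mul]
  have hNt : Nᵀ = N := by simp [hN, Matrix.transpose_mul]
  have hNN : N * N = N := by
    have : Q * Qᵀ * (Q * Qᵀ) = Q * Qᵀ := by
      rw [Matrix.mul_assoc, ← Matrix.mul_assoc Qᵀ, hQQ, Matrix.one_mul]
    rw [hN, Matrix.sub_mul, Matrix.mul_sub, Matrix.mul_sub, this]
    simp
  have hNx : ∀ x : Fin a → ℝ, (N *ᵥ x) ⬝ᵥ (N *ᵥ x) ≤ x ⬝ᵥ x := by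
    intro x
    have h1 : (N *ᵥ x) ⬝ᵥ (N *ᵥ x) = x ⬝ᵥ (N *ᵥ x) := by
      rw [Matrix.dotProduct_mulVec, Matrix.vecMul_mulVec, hNt, hNN, ← Matrix.mulVec_transpose, hNt,
        dotProduct_comm]
    have h2 : x ⬝ᵥ (N *ᵥ x) = x ⬝ᵥ x - (Qᵀ *ᵥ x) ⬝ᵥ (Qᵀ *ᵥ x) := by
      rw [hN, Matrix.sub_mulVec, dotProduct_sub, Matrix.one_mulVec, ← Matrix.mulVec_mulVec,
        Matrix.dotProduct_mulVec, ← Matrix.mulVec_transpose]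
    rw [h1, h2]
    linarith [dotProduct_self_nonneg (Qᵀ *ᵥ x)]
  -- lower bound for the leading eigenvalues of `M'`
  have hlam : ∀ j < k, s / 2 ≤ nthEig M' j := by
    intro j hj
    refine le_nthEig hM' hQQ hka (fun z => ?_) hj
    have h1 := hs (D *ᵥ z)
    rw [Matrix.mulVec_mulVec, ← hD] at h1
    have h2 := abs_dotProduct_mulVec_le (M' - M) (Q *ᵥ z)
    rw [Matrix.sub_mulVec, dotProduct_sub] at h2
    have h3 := (abs_le.1 h2).1
    have h4 := mul_le_mul_of_nonneg_right hΔ (dotProduct_self_nonneg (Q *ᵥ z))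
    linarith
  have hcol : ∀ j : Fin k, (N *ᵥ fun i => Q' i j) ⬝ᵥ (N *ᵥ fun i => Q' i j) ≤ (2 / s * δ) ^ 2 := by
    intro j
    set x : Fin a → ℝ := fun i => Q' i j
    have hx : x ⬝ᵥ x = 1 := by
      have := congrFun (congrFun hQQ' j) j
      simpa [Matrix.mul_apply, dotProduct, x] using this
    have h1 : nthEig M' j • (N *ᵥ x) = N *ᵥ ((M' - M) *ᵥ x) := by
      rw [Matrix.sub_mulVec M', Matrix.mulVec_sub N, Matrix.mulVec_mulVec x N M, hNM, Matrix.zero_mulVec,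
        sub_zero, hQe' j, Matrix.mulVec_smul]
    have h2 : nthEig M' j ^ 2 * ((N *ᵥ x) ⬝ᵥ (N *ᵥ x)) ≤ δ ^ 2 := by
      have : nthEig M' j ^ 2 * ((N *ᵥ x) ⬝ᵥ (N *ᵥ x)) =
          (nthEig M' j • (N *ᵥ x)) ⬝ᵥ (nthEig M' j • (N *ᵥ x)) := by
        simp only [smul_dotProduct, dotProduct_smul, smul_eq_mul]; ring
      rw [this, h1, hδ, Real.sq_sqrt (frobSq_nonneg _)]
      refine (hNx _).trans ((frobSq_mulVec_le _ _).trans_eq ?_)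
      rw [hx, mul_one]
    have h3 : (s / 2) ^ 2 * ((N *ᵥ x) ⬝ᵥ (N *ᵥ x)) ≤ δ ^ 2 :=
      (mul_le_mul_of_nonneg_right (pow_le_pow_left₀ (by positivity) (hlam j j.2) 2)
        (dotProduct_self_nonneg _)).trans h2
    calc _ = (2 / s) ^ 2 * ((s / 2) ^ 2 * ((N *ᵥ x) ⬝ᵥ (N *ᵥ x))) := by field_simp
      _ ≤ (2 / s) ^ 2 * δ ^ 2 := mul_le_mul_of_nonneg_left h3 (by positivity)
      _ = _ := by ring
  rw [subspaceDist]
  refine Real.sqrt_le_iff.2 ⟨by positivity, ?_⟩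
  have hk0 : (0 : ℝ) < k := by exact_mod_cast hk
  -- Since N is an orthogonal projection, the trace defect is exactly the squared Frobenius norm of
  -- NQ'.
  have htr : (Q' * Q'ᵀ * (Q * Qᵀ)).trace =
      k - ∑ j, (N *ᵥ fun i => Q' i j) ⬝ᵥ (N *ᵥ fun i => Q' i j) := by
    have e1 : ∑ j, (N *ᵥ fun i => Q' i j) ⬝ᵥ (N *ᵥ fun i => Q' i j) =
        ((N * Q')ᵀ * (N * Q')).trace := by
      simp only [Matrix.trace, Matrix.mul_apply, Matrix.mulVec, dotProduct, Matrix.diag_apply,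
        Matrix.transpose_apply]
    have e2 : ((N * Q')ᵀ * (N * Q')) = Q'ᵀ * Q' - Q'ᵀ * (Q * Qᵀ) * Q' := by
      rw [Matrix.transpose_mul, hNt, Matrix.mul_assoc, ← Matrix.mul_assoc N, hNN, hN,
        Matrix.sub_mul, Matrix.mul_sub, Matrix.one_mul, Matrix.mul_assoc Q'ᵀ]
    rw [e1, e2, hQQ', Matrix.trace_sub, Matrix.trace_one, Fintype.card_fin, sub_sub_cancel,
      Matrix.mul_assoc, Matrix.trace_mul_comm]
  rw [htr, max_self]
  have hsum := Finset.sum_le_sum fun (j : Fin k) (_ : j ∈ Finset.univ) => hcol j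
  rw [Finset.sum_const, Finset.card_univ, Fintype.card_fin, nsmul_eq_mul] at hsum
  have : 1 - 1 / (k : ℝ) * (k - ∑ j, (N *ᵥ fun i => Q' i j) ⬝ᵥ (N *ᵥ fun i => Q' i j)) =
    1 / (k : ℝ) * ∑ j, (N *ᵥ fun i => Q' i j) ⬝ᵥ (N *ᵥ fun i => Q' i j) := by field_simp; ring
  rw [this]
  calc _ ≤ 1 / (k : ℝ) * (k * (2 / s * δ) ^ 2) := mul_le_mul_of_nonneg_left hsum (by positivity)
    _ = _ := by field_simp

/-! ### Covariance inequalities under mixing -/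

/-- The covariance equals E[Ug] with g = E[V|m] - EV, hence is at most a·E|g|. The sets {g ≥ 0} and
{g < 0} both lie in `m`, and each contributes at most K to E|g|. -/
theorem abs_integral_mul_sub_le_of_bounded {Ω : Type*} {m m₀ : MeasurableSpace Ω} (hm : m ≤ m₀)
    {μ : Measure[m₀] Ω} [IsProbabilityMeasure μ] {U V : Ω → ℝ} {a K : ℝ}
    (hU : Measurable[m] U) (hUa : ∀ ω, |U ω| ≤ a) (hV : Integrable V μ)
    (hK : ∀ A, MeasurableSet[m] A → |∫ ω in A, V ω ∂μ - μ.real A * ∫ ω, V ω ∂μ| ≤ K) :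
    |∫ ω, U ω * V ω ∂μ - (∫ ω, U ω ∂μ) * ∫ ω, V ω ∂μ| ≤ 2 * a * K := by
  have ha : 0 ≤ a := by
    obtain ⟨ω⟩ : Nonempty Ω := nonempty_of_isProbabilityMeasure μ
    exact (abs_nonneg _).trans (hUa ω)
  set c := ∫ ω, V ω ∂μ with hc
  set g : Ω → ℝ := fun ω => (μ[V | m]) ω - c with hg
  have hgm : Measurable[m] g := (stronglyMeasurable_condExp.measurable).sub_const _
  have hgi : Integrable g μ := integrable_condExp.sub (integrable_const c)
  have hUm : AEStronglyMeasurable U μ := (hU.mono hm le_rfl).aestronglyMeasurable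
  have hUb : ∀ᵐ ω ∂μ, ‖U ω‖ ≤ a := Eventually.of_forall hUa
  have hUi : Integrable U μ := Integrable.of_bound hUm a hUb
  have hUV : Integrable (U * V) μ := hV.bdd_mul hUm hUb
  have hUg : Integrable (fun ω => U ω * g ω) μ := hgi.bdd_mul hUm hUb
  have hUE : Integrable (fun ω => U ω * (μ[V | m]) ω) μ := integrable_condExp.bdd_mul hUm hUb
  have e1 : ∫ ω, U ω * V ω ∂μ = ∫ ω, U ω * (μ[V | m]) ω ∂μ := by
    rw [← integral_condExp hm (f := fun ω => U ω * V ω)]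
    exact integral_congr_ae
      (condExp_mul_of_stronglyMeasurable_left hU.stronglyMeasurable hUV hV)
  have e2 : ∫ ω, U ω * V ω ∂μ - (∫ ω, U ω ∂μ) * c = ∫ ω, U ω * g ω ∂μ := by
    rw [e1, ← integral_mul_const, ← integral_sub hUE (hUi.mul_const c)]
    exact integral_congr_ae (Eventually.of_forall fun ω => by simp only [hg]; ring)
  have hset : ∀ A, MeasurableSet[m] A → |∫ ω in A, g ω ∂μ| ≤ K := by
    intro A hA
    have : ∫ ω in A, g ω ∂μ = ∫ ω in A, V ω ∂μ - μ.real A * c := by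
      rw [hg, integral_sub integrable_condExp.integrableOn (integrable_const c).integrableOn,
        setIntegral_condExp hm hV hA, setIntegral_const, smul_eq_mul]
    rw [this]
    exact hK A hA
  have hA : MeasurableSet[m] {ω | 0 ≤ g ω} := measurableSet_le measurable_const hgm
  have e3 : ∫ ω, |g ω| ∂μ ≤ 2 * K := by
    rw [← integral_add_compl (hm _ hA) hgi.abs]
    have h1 : ∫ ω in {ω | 0 ≤ g ω}, |g ω| ∂μ = ∫ ω in {ω | 0 ≤ g ω}, g ω ∂μ :=
      setIntegral_congr_fun (hm _ hA) fun ω hω => abs_of_nonneg hω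
    have h2 : ∫ ω in {ω | 0 ≤ g ω}ᶜ, |g ω| ∂μ = -∫ ω in {ω | 0 ≤ g ω}ᶜ, g ω ∂μ := by
      rw [← integral_neg]
      exact setIntegral_congr_fun (hm _ hA.compl) fun ω hω => abs_of_neg (not_le.1 hω)
    have h3 := (abs_le.1 (hset _ hA)).2
    have h4 := (abs_le.1 (hset _ hA.compl)).1
    rw [h1, h2]
    linarith
  rw [e2]
  calc _ ≤ ∫ ω, |U ω * g ω| ∂μ := abs_integral_le_integral_abs
    _ ≤ ∫ ω, a * |g ω| ∂μ := by
      refine integral_mono hUg.abs (hgi.abs.const_mul a) fun ω => ?_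
      rw [abs_mul]
      exact mul_le_mul_of_nonneg_right (hUa ω) (abs_nonneg _)
    _ ≤ _ := by
      rw [integral_const_mul]
      nlinarith

/-- The preceding bound is used twice: once to replace `U` by events (factor 2a), then to replace
`V` by events (factor 2b). -/
theorem abs_integral_mul_sub_le_of_mixing {Ω : Type*} {m₁ m₂ m₀ : MeasurableSpace Ω}
    (hm₁ : m₁ ≤ m₀) (hm₂ : m₂ ≤ m₀) {μ : Measure[m₀] Ω} [IsProbabilityMeasure μ] {U V : Ω → ℝ}
    {a b α : ℝ} (hU : Measurable[m₁] U) (hUa : ∀ ω, |U ω| ≤ a)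
    (hV : Measurable[m₂] V) (hVb : ∀ ω, |V ω| ≤ b)
    (hα : ∀ A B, MeasurableSet[m₁] A → MeasurableSet[m₂] B →
      |μ.real A * μ.real B - μ.real (A ∩ B)| ≤ α) :
    |∫ ω, U ω * V ω ∂μ - (∫ ω, U ω ∂μ) * ∫ ω, V ω ∂μ| ≤ 4 * a * b * α := by
  have hVi : Integrable V μ := Integrable.of_bound (hV.mono hm₂ le_rfl).aestronglyMeasurable b
    (Eventually.of_forall hVb)
  have := abs_integral_mul_sub_le_of_bounded (K := 2 * b * α) hm₁ hU hUa hVi ?_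
  · linarith
  intro A hA
  have hA' := hm₁ _ hA
  -- The roles are exchanged: `V` is now the bounded variable, tested against the indicator of the
  -- event from `m₁`.
  have h1 := abs_integral_mul_sub_le_of_bounded (U := V) (V := A.indicator 1) (K := α) (μ := μ) hm₂ hV hVb
    ((integrable_const (1 : ℝ)).indicator hA') ?_
  · have e1 : ∫ ω, V ω * A.indicator 1 ω ∂μ = ∫ ω in A, V ω ∂μ := by
      rw [← integral_indicator hA']
      refine integral_congr_ae (Eventually.of_forall fun ω => ?_)
      by_cases h : ω ∈ A <;> simp [h]
    rwa [e1, integral_indicator_one hA', mul_comm (∫ ω, V ω ∂μ)] at h1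
  intro B hB
  have hB' := hm₂ _ hB
  rw [setIntegral_indicator hA', integral_indicator_one hA']
  simp only [Pi.one_apply, setIntegral_const, smul_eq_mul, mul_one]
  rw [abs_sub_comm, mul_comm, Set.inter_comm]
  exact hα A B hA hB

theorem rpow_le_one_add_rpow {x s t : ℝ} (hx : 0 ≤ x) (hs : 0 ≤ s) (hst : s ≤ t) :
    x ^ s ≤ 1 + x ^ t := by
  rcases le_total x 1 with h | h
  · exact (Real.rpow_le_one hx h hs).trans (le_add_of_nonneg_right (Real.rpow_nonneg hx _))
  · exact (Real.rpow_le_rpow_of_exponent_le h hst).trans (le_add_of_nonneg_left zero_le_one)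

theorem sq_le_one_add_rpow (x : ℝ) {γ : ℝ} (hγ : 2 ≤ γ) : x ^ 2 ≤ 1 + |x| ^ γ := by
  rw [← sq_abs, ← Real.rpow_natCast]
  exact rpow_le_one_add_rpow (abs_nonneg x) (by norm_num) (by exact_mod_cast hγ)

theorem abs_le_one_add_rpow (x : ℝ) {γ : ℝ} (hγ : 1 ≤ γ) : |x| ≤ 1 + |x| ^ γ := by
  have := rpow_le_one_add_rpow (abs_nonneg x) zero_le_one hγ
  rwa [Real.rpow_one] at this

theorem le_rpow_mul_rpow_of_lt {x M s γ : ℝ} (hM : 0 < M) (hx : M < x) (hs : s ≤ γ) :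
    x ^ s ≤ M ^ (s - γ) * x ^ γ := by
  have hx0 : 0 < x := hM.trans hx
  calc x ^ s = x ^ (s - γ) * x ^ γ := by rw [← Real.rpow_add hx0]; ring_nf
    _ ≤ _ := mul_le_mul_of_nonneg_right
      (Real.rpow_le_rpow_of_nonpos hM hx.le (by linarith)) (Real.rpow_nonneg hx0.le _)

/-- `x` cut off at level `M`. -/
def cutoff (M x : ℝ) : ℝ := if |x| ≤ M then x else 0

theorem measurable_cutoff (M : ℝ) : Measurable (cutoff M) :=
  Measurable.ite (measurableSet_le measurable_id.abs measurable_const) measurable_id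
    measurable_const

theorem abs_cutoff_le {M : ℝ} (hM : 0 ≤ M) (x : ℝ) : |cutoff M x| ≤ M := by
  unfold cutoff; split_ifs with h
  · exact h
  · simpa using hM

theorem abs_cutoff_le_abs (M x : ℝ) : |cutoff M x| ≤ |x| := by
  unfold cutoff; split_ifs with h
  · exact le_rfl
  · simp

theorem abs_sub_cutoff_le {M γ : ℝ} (hM : 0 < M) (hγ : 1 ≤ γ) (x : ℝ) :
    |x - cutoff M x| ≤ M ^ (1 - γ) * |x| ^ γ := by
  unfold cutoff; split_ifs with h
  · simp only [sub_self, abs_zero]; positivity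
  · simpa only [Real.rpow_one, sub_zero] using le_rpow_mul_rpow_of_lt hM (not_le.1 h) hγ

/-- If a factor is cut, the cut product vanishes and the larger factor z exceeds M, so |xy| ≤ z² ≤
M^(2-γ)|z|^γ. -/
theorem abs_mul_sub_cutoff_le {M γ : ℝ} (hM : 0 < M) (hγ : 2 ≤ γ) (x y : ℝ) :
    |x * y - cutoff M x * cutoff M y| ≤ M ^ (2 - γ) * (|x| ^ γ + |y| ^ γ) := by
  have hx0 : 0 ≤ |x| ^ γ := Real.rpow_nonneg (abs_nonneg _) _
  have hy0 : 0 ≤ |y| ^ γ := Real.rpow_nonneg (abs_nonneg _) _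
  have hM0 : 0 ≤ M ^ (2 - γ) := Real.rpow_nonneg hM.le _
  by_cases h : |x| ≤ M ∧ |y| ≤ M
  · simp only [cutoff, h.1, h.2, if_true, sub_self, abs_zero]; positivity
  have h0 : cutoff M x * cutoff M y = 0 := by
    unfold cutoff
    rcases not_and_or.1 h with h | h <;> simp [h]
  have key : ∀ z, |x| ≤ |z| → |y| ≤ |z| → M < |z| → |x * y| ≤ M ^ (2 - γ) * |z| ^ γ := by
    intro z hxz hyz hz
    rw [abs_mul]
    refine (mul_le_mul hxz hyz (abs_nonneg _) (abs_nonneg _)).trans ?_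
    have := le_rpow_mul_rpow_of_lt hM hz hγ
    rwa [Real.rpow_ofNat, sq] at this
  rw [h0, sub_zero, mul_add]
  rcases le_total |x| |y| with hxy | hxy
  · have hy : M < |y| := by
      by_contra! h'
      exact h ⟨hxy.trans h', h'⟩
    linarith [key y hxy le_rfl hy, mul_nonneg hM0 hx0]
  · have hx : M < |x| := by
      by_contra! h'
      exact h ⟨h', hxy.trans h'⟩
    linarith [key x le_rfl hxy hx, mul_nonneg hM0 hy0]

theorem integrable_mul_of_integrable_rpow {Ω : Type*} [MeasurableSpace Ω] {μ : Measure Ω}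
    [IsFiniteMeasure μ] {U V : Ω → ℝ} {γ : ℝ} (hγ : 2 ≤ γ) (hU : Measurable U) (hV : Measurable V)
    (hUi : Integrable (fun ω => |U ω| ^ γ) μ) (hVi : Integrable (fun ω => |V ω| ^ γ) μ) :
    Integrable (fun ω => U ω * V ω) μ := by
  refine Integrable.mono' (g := fun ω => (1 + |U ω| ^ γ) + (1 + |V ω| ^ γ))
    (((integrable_const _).add hUi).add ((integrable_const _).add hVi))
    (hU.mul hV).aestronglyMeasurable (Eventually.of_forall fun ω => ?_)
  have h1 := sq_le_one_add_rpow (U ω) hγ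
  have h2 := sq_le_one_add_rpow (V ω) hγ
  rw [Real.norm_eq_abs, abs_le]
  constructor <;> nlinarith [sq_nonneg (U ω + V ω), sq_nonneg (U ω - V ω), sq_nonneg (U ω),
    sq_nonneg (V ω)]

theorem integrable_of_integrable_rpow {Ω : Type*} [MeasurableSpace Ω] {μ : Measure Ω}
    [IsFiniteMeasure μ] {U : Ω → ℝ} {γ : ℝ} (hγ : 1 ≤ γ) (hU : Measurable U)
    (hUi : Integrable (fun ω => |U ω| ^ γ) μ) : Integrable U μ :=
  Integrable.mono' ((integrable_const 1).add hUi) hU.aestronglyMeasurable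
    (Eventually.of_forall fun _ => abs_le_one_add_rpow _ hγ)

theorem integral_abs_le_of_integral_rpow_le {Ω : Type*} [MeasurableSpace Ω] {μ : Measure Ω}
    [IsProbabilityMeasure μ] {U : Ω → ℝ} {γ D : ℝ} (hγ : 1 ≤ γ) (hU : Measurable U)
    (hUi : Integrable (fun ω => |U ω| ^ γ) μ) (hUD : ∫ ω, |U ω| ^ γ ∂μ ≤ D) :
    ∫ ω, |U ω| ∂μ ≤ 1 + D := by
  calc _ ≤ ∫ ω, (1 + |U ω| ^ γ) ∂μ := integral_mono
        (integrable_of_integrable_rpow hγ hU hUi).abs ((integrable_const 1).add hUi)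
        fun ω => abs_le_one_add_rpow _ hγ
    _ ≤ _ := by
      rw [integral_add (integrable_const 1) hUi]
      simpa using hUD

/-- The truncation bound for covariances of mixing random variables. -/
theorem abs_integral_mul_sub_le_of_moment {Ω : Type*} {m₁ m₂ m₀ : MeasurableSpace Ω}
    (hm₁ : m₁ ≤ m₀) (hm₂ : m₂ ≤ m₀) {μ : Measure[m₀] Ω} [IsProbabilityMeasure μ] {U V : Ω → ℝ}
    {γ D M α : ℝ} (hγ : 2 ≤ γ) (hM : 1 ≤ M) (hU : Measurable[m₁] U) (hV : Measurable[m₂] V)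
    (hUi : Integrable (fun ω => |U ω| ^ γ) μ) (hUD : ∫ ω, |U ω| ^ γ ∂μ ≤ D)
    (hVi : Integrable (fun ω => |V ω| ^ γ) μ) (hVD : ∫ ω, |V ω| ^ γ ∂μ ≤ D)
    (hα : ∀ A B, MeasurableSet[m₁] A → MeasurableSet[m₂] B →
      |μ.real A * μ.real B - μ.real (A ∩ B)| ≤ α) :
    |∫ ω, U ω * V ω ∂μ - (∫ ω, U ω ∂μ) * ∫ ω, V ω ∂μ| ≤
      4 * M ^ 2 * α + (4 * D + 2 * D ^ 2) * M ^ (2 - γ) := by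
  have hM0 : 0 < M := by linarith
  have hγ1 : 1 ≤ γ := by linarith
  have hD : 0 ≤ D := (integral_nonneg fun ω => Real.rpow_nonneg (abs_nonneg _) _).trans hUD
  have hU0 := hU.mono hm₁ le_rfl
  have hV0 := hV.mono hm₂ le_rfl
  set U₁ : Ω → ℝ := fun ω => cutoff M (U ω) with hU₁
  set V₁ : Ω → ℝ := fun ω => cutoff M (V ω) with hV₁
  have hU₁m : Measurable[m₁] U₁ := (measurable_cutoff M).comp hU
  have hV₁m : Measurable[m₂] V₁ := (measurable_cutoff M).comp hV
  have hU₁m0 := hU₁m.mono hm₁ le_rfl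
  have hV₁m0 := hV₁m.mono hm₂ le_rfl
  have hb := abs_integral_mul_sub_le_of_mixing hm₁ hm₂ hU₁m (fun ω => abs_cutoff_le hM0.le _) hV₁m
    (fun ω => abs_cutoff_le hM0.le _) hα
  have hUint := integrable_of_integrable_rpow hγ1 hU0 hUi
  have hVint := integrable_of_integrable_rpow hγ1 hV0 hVi
  have hU₁int : Integrable U₁ μ := Integrable.of_bound hU₁m0.aestronglyMeasurable M
    (Eventually.of_forall fun ω => abs_cutoff_le hM0.le _)
  have hV₁int : Integrable V₁ μ := Integrable.of_bound hV₁m0.aestronglyMeasurable M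
    (Eventually.of_forall fun ω => abs_cutoff_le hM0.le _)
  have hUVint := integrable_mul_of_integrable_rpow hγ hU0 hV0 hUi hVi
  have hUV₁int : Integrable (fun ω => U₁ ω * V₁ ω) μ :=
    hV₁int.bdd_mul hU₁m0.aestronglyMeasurable
      (Eventually.of_forall fun ω => abs_cutoff_le hM0.le _)
  have h1 : |∫ ω, U ω * V ω ∂μ - ∫ ω, U₁ ω * V₁ ω ∂μ| ≤ M ^ (2 - γ) * (2 * D) := by
    rw [← integral_sub hUVint hUV₁int]
    refine abs_integral_le_integral_abs.trans ((integral_mono (hUVint.sub hUV₁int).abs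
      ((hUi.add hVi).const_mul (M ^ (2 - γ)))
      fun ω => abs_mul_sub_cutoff_le hM0 hγ (U ω) (V ω)).trans ?_)
    rw [integral_const_mul]
    refine mul_le_mul_of_nonneg_left ?_ (Real.rpow_nonneg hM0.le _)
    simp only [Pi.add_apply]
    rw [integral_add hUi hVi]
    linarith
  have hdiff : ∀ Z : Ω → ℝ, Measurable[m₀] Z → Integrable (fun ω => |Z ω| ^ γ) μ →
      ∫ ω, |Z ω| ^ γ ∂μ ≤ D →
      |∫ ω, Z ω ∂μ - ∫ ω, cutoff M (Z ω) ∂μ| ≤ M ^ (2 - γ) * D := by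
    intro Z hZ hZi hZD
    have hZint := integrable_of_integrable_rpow hγ1 hZ hZi
    have hZ₁int : Integrable (fun ω => cutoff M (Z ω)) μ :=
      Integrable.of_bound ((measurable_cutoff M).comp hZ).aestronglyMeasurable M
        (Eventually.of_forall fun ω => abs_cutoff_le hM0.le _)
    rw [← integral_sub hZint hZ₁int]
    refine abs_integral_le_integral_abs.trans ((integral_mono (hZint.sub hZ₁int).abs
      (hZi.const_mul (M ^ (1 - γ))) fun ω => abs_sub_cutoff_le hM0 hγ1 (Z ω)).trans ?_)
    rw [integral_const_mul]
    -- As M ≥ 1, the sharper factor M^(1-γ) may be weakened to the M^(2-γ) of the product term.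
    exact mul_le_mul (Real.rpow_le_rpow_of_exponent_le hM (by linarith)) hZD
      (integral_nonneg fun ω => Real.rpow_nonneg (abs_nonneg _) _) (Real.rpow_nonneg hM0.le _)
  have h2 := hdiff U hU0 hUi hUD
  have h3 := hdiff V hV0 hVi hVD
  have h4 : |∫ ω, V ω ∂μ| ≤ 1 + D :=
    abs_integral_le_integral_abs.trans (integral_abs_le_of_integral_rpow_le hγ1 hV0 hVi hVD)
  have h5 : |∫ ω, U₁ ω ∂μ| ≤ 1 + D :=
    (abs_integral_le_integral_abs.trans (integral_mono hU₁int.abs hUint.abs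
      fun ω => abs_cutoff_le_abs M (U ω))).trans
        (integral_abs_le_of_integral_rpow_le hγ1 hU0 hUi hUD)
  have hMγ : 0 ≤ M ^ (2 - γ) * D := mul_nonneg (Real.rpow_nonneg hM0.le _) hD
  have h6 : |(∫ ω, U ω ∂μ) * ∫ ω, V ω ∂μ - (∫ ω, U₁ ω ∂μ) * ∫ ω, V₁ ω ∂μ| ≤
      M ^ (2 - γ) * D * (1 + D) + (1 + D) * (M ^ (2 - γ) * D) := by
    have e : (∫ ω, U ω ∂μ) * ∫ ω, V ω ∂μ - (∫ ω, U₁ ω ∂μ) * ∫ ω, V₁ ω ∂μ =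
        (∫ ω, U ω ∂μ - ∫ ω, U₁ ω ∂μ) * ∫ ω, V ω ∂μ +
          (∫ ω, U₁ ω ∂μ) * (∫ ω, V ω ∂μ - ∫ ω, V₁ ω ∂μ) := by ring
    rw [e]
    refine (abs_add_le _ _).trans (add_le_add ?_ ?_)
    · rw [abs_mul]
      exact mul_le_mul h2 h4 (abs_nonneg _) hMγ
    · rw [abs_mul]
      exact mul_le_mul h5 h3 (abs_nonneg _) (by linarith)
  have h1' := abs_le.1 h1
  have h6' := abs_le.1 h6
  have hb' := abs_le.1 hb
  rw [abs_le]
  constructor <;> nlinarith [h1'.1, h1'.2, h6'.1, h6'.2, hb'.1, hb'.2]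

/-- Davydov's covariance inequality, with moments of order `γ`. -/
theorem abs_integral_mul_sub_le_rpow {Ω : Type*} {m₁ m₂ m₀ : MeasurableSpace Ω}
    (hm₁ : m₁ ≤ m₀) (hm₂ : m₂ ≤ m₀) {μ : Measure[m₀] Ω} [IsProbabilityMeasure μ] {U V : Ω → ℝ}
    {γ D α : ℝ} (hγ : 2 < γ) (hU : Measurable[m₁] U) (hV : Measurable[m₂] V)
    (hUi : Integrable (fun ω => |U ω| ^ γ) μ) (hUD : ∫ ω, |U ω| ^ γ ∂μ ≤ D)
    (hVi : Integrable (fun ω => |V ω| ^ γ) μ) (hVD : ∫ ω, |V ω| ^ γ ∂μ ≤ D)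
    (hα0 : 0 ≤ α) (hα1 : α < 1)
    (hα : ∀ A B, MeasurableSet[m₁] A → MeasurableSet[m₂] B →
      |μ.real A * μ.real B - μ.real (A ∩ B)| ≤ α) :
    |∫ ω, U ω * V ω ∂μ - (∫ ω, U ω ∂μ) * ∫ ω, V ω ∂μ| ≤
      (4 + 4 * D + 2 * D ^ 2) * α ^ (1 - 2 / γ) := by
  have hγ0 : 0 < γ := by linarith
  -- The truncation level M = β^(-1/γ) balances M²β against M^(2-γ): both equal β^(1-2/γ). It needs
  -- β > 0 whereas α may vanish, so the bound is proved for β > α and β tends to α at the end; β < 1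
  -- ensures M ≥ 1.
  have hpos : ∀ β, α < β → β < 1 →
      |∫ ω, U ω * V ω ∂μ - (∫ ω, U ω ∂μ) * ∫ ω, V ω ∂μ| ≤
        (4 + 4 * D + 2 * D ^ 2) * β ^ (1 - 2 / γ) := by
    intro β hαβ hβ1
    have hβ0 : 0 < β := hα0.trans_lt hαβ
    have hM : 1 ≤ β ^ (-(1 / γ)) :=
      Real.one_le_rpow_of_pos_of_le_one_of_nonpos hβ0 hβ1.le (by simp; positivity)
    have := abs_integral_mul_sub_le_of_moment hm₁ hm₂ hγ.le hM hU hV hUi hUD hVi hVD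
      (fun A B hA hB => (hα A B hA hB).trans hαβ.le)
    have e1 : (β ^ (-(1 / γ))) ^ 2 * β = β ^ (1 - 2 / γ) := by
      rw [← Real.rpow_natCast, ← Real.rpow_mul hβ0.le]
      nth_rewrite 2 [← Real.rpow_one β]
      rw [← Real.rpow_add hβ0]
      congr 1; push_cast; ring
    have e2 : (β ^ (-(1 / γ))) ^ (2 - γ) = β ^ (1 - 2 / γ) := by
      rw [← Real.rpow_mul hβ0.le]
      congr 1; field_simp; ring
    rw [mul_assoc, e1, e2] at this
    linarith
  have hcont : Tendsto (fun β => (4 + 4 * D + 2 * D ^ 2) * β ^ (1 - 2 / γ)) (𝓝[>] α)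
      (𝓝 ((4 + 4 * D + 2 * D ^ 2) * α ^ (1 - 2 / γ))) := by
    refine Tendsto.mono_left ?_ nhdsWithin_le_nhds
    refine ((Real.continuous_rpow_const ?_).tendsto α).const_mul _
    rw [sub_nonneg, div_le_one hγ0]; exact hγ.le
  refine ge_of_tendsto hcont ?_
  filter_upwards [Ioo_mem_nhdsGT hα1] with β hβ using hpos β hβ.1 hβ.2

/-! ### Variances of averages of mixing processes -/

/-- This makes the set in `alphaMixing` bounded, so that its supremum is not a default value, and
keeps the coefficients below 1. -/
theorem abs_real_mul_sub_real_inter_le {Ω : Type*} [MeasurableSpace Ω] (μ : Measure Ω)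
    [IsProbabilityMeasure μ] (A : Set Ω) {B : Set Ω} (hB : MeasurableSet B) :
    |μ.real A * μ.real B - μ.real (A ∩ B)| ≤ 1 / 4 := by
  have h1 : μ.real (A ∩ B) ≤ μ.real A := measureReal_mono Set.inter_subset_left
  have h2 : μ.real (A ∩ B) ≤ μ.real B := measureReal_mono Set.inter_subset_right
  have h3 : μ.real A + μ.real B ≤ 1 + μ.real (A ∩ B) := by
    have := measureReal_union_add_inter (μ := μ) (s := A) hB
    have h : μ.real (A ∪ B) ≤ 1 := measureReal_le_one
    linarith
  have hA0 : 0 ≤ μ.real A := measureReal_nonneg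
  have hB0 : 0 ≤ μ.real B := measureReal_nonneg
  have hA1 : μ.real A ≤ 1 := measureReal_le_one
  have hB1 : μ.real B ≤ 1 := measureReal_le_one
  have hC0 : 0 ≤ μ.real (A ∩ B) := measureReal_nonneg
  generalize μ.real A = x at *
  generalize μ.real B = y at *
  generalize μ.real (A ∩ B) = z at *
  rw [abs_le]
  -- Lower side: z ≤ x and z ≤ y give xy - z ≥ z² - z ≥ -1/4. Upper side: xy ≤ 1/4 when x + y ≤ 1,
  -- and otherwise z ≥ x + y - 1 gives xy - z ≤ (1-x)(1-y) ≤ 1/4.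
  constructor
  · nlinarith [mul_le_mul h1 h2 hC0 hA0, sq_nonneg (z - 1 / 2)]
  · rcases le_total (x + y) 1 with h | h
    · nlinarith [sq_nonneg (x - y)]
    · nlinarith [sq_nonneg (x - y), mul_nonneg (sub_nonneg.2 hA1) (sub_nonneg.2 hB1)]

section Alpha

variable {Ω : Type*} [m₀ : MeasurableSpace Ω] {μ : Measure Ω} [IsProbabilityMeasure μ]
  {𝓖 : ℤ → MeasurableSpace Ω}

theorem le_alphaMixing (h𝓖 : ∀ t, 𝓖 t ≤ m₀) (l : ℕ) (i : ℤ) {A B : Set Ω}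
    (hA : MeasurableSet[⨆ t ∈ Set.Iic i, 𝓖 t] A)
    (hB : MeasurableSet[⨆ t ∈ Set.Ici (i + (l : ℤ)), 𝓖 t] B) :
    |μ.real A * μ.real B - μ.real (A ∩ B)| ≤ alphaMixing μ 𝓖 l := by
  refine le_csSup ⟨1 / 4, ?_⟩ ⟨i, A, B, hA, hB, rfl⟩
  rintro x ⟨i, A, B, -, hB, rfl⟩
  exact abs_real_mul_sub_real_inter_le μ A ((iSup₂_le fun t _ => h𝓖 t) _ hB)

omit [IsProbabilityMeasure μ] in
theorem alphaMixing_nonneg (l : ℕ) : 0 ≤ alphaMixing μ 𝓖 l :=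
  Real.sSup_nonneg (by rintro x ⟨i, A, B, -, -, rfl⟩; exact abs_nonneg _)

theorem alphaMixing_lt_one (h𝓖 : ∀ t, 𝓖 t ≤ m₀) (l : ℕ) : alphaMixing μ 𝓖 l < 1 := by
  refine lt_of_le_of_lt (Real.sSup_le ?_ (by norm_num : (0 : ℝ) ≤ 1 / 4)) (by norm_num)
  rintro x ⟨i, A, B, -, hB, rfl⟩
  exact abs_real_mul_sub_real_inter_le μ A ((iSup₂_le fun t _ => h𝓖 t) _ hB)

/-- Bound for the covariances of a process with moments at most `D` that is `h`-dependent on a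
mixing process with coefficients `a`. -/
def covBound (D : ℝ) (h : ℕ) (a : ℕ → ℝ) (d : ℕ) : ℝ :=
  if d ≤ h then (1 + D) + (1 + D) ^ 2 else (4 + 4 * D + 2 * D ^ 2) * a (d - h - 1)

theorem sum_covBound_le {D : ℝ} (hD : 0 ≤ D) (h : ℕ) {a : ℕ → ℝ} (ha : ∀ l, 0 ≤ a l)
    (has : Summable a) {B : ℝ} (hB : ∑' l, a l ≤ B) (F : Finset ℕ) :
    ∑ d ∈ F, covBound D h a d ≤
      (h + 1) * ((1 + D) + (1 + D) ^ 2) + (4 + 4 * D + 2 * D ^ 2) * B := by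
  rw [← Finset.sum_filter_add_sum_filter_not F (· ≤ h)]
  refine add_le_add ?_ ?_
  · calc _ = ∑ d ∈ F.filter (· ≤ h), ((1 + D) + (1 + D) ^ 2) :=
          Finset.sum_congr rfl fun d hd => if_pos (Finset.mem_filter.1 hd).2
      _ ≤ ∑ d ∈ Finset.range (h + 1), ((1 + D) + (1 + D) ^ 2) := by
          refine Finset.sum_le_sum_of_subset_of_nonneg ?_ ?_
          · intro d hd
            have := (Finset.mem_filter.1 hd).2
            simp; omega
          · intro _ _ _; positivity
      _ = _ := by simp; ring
  · have e : ∀ d ∈ F.filter (fun d => ¬ d ≤ h),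
        covBound D h a d = (4 + 4 * D + 2 * D ^ 2) * a (d - h - 1) :=
      fun d hd => if_neg (Finset.mem_filter.1 hd).2
    rw [Finset.sum_congr rfl e, ← Finset.mul_sum]
    refine mul_le_mul_of_nonneg_left ?_ (by positivity)
    rw [← Finset.sum_image (s := F.filter fun d => ¬ d ≤ h) (g := fun d => d - h - 1) (f := a)]
    · exact (has.sum_le_tsum _ fun l _ => ha l).trans hB
    · intro x hx y hy hxy
      have hx' := (Finset.mem_filter.1 hx).2
      have hy' := (Finset.mem_filter.1 hy).2
      simp only at hxy
      omega

/-- Each absolute lag is attained at most once on either side of `s`. -/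
theorem sum_natAbs_sub_le {b : ℕ → ℝ} {B : ℝ}
    (hB : ∀ F : Finset ℕ, ∑ d ∈ F, b d ≤ B) (s : ℤ) (F : Finset ℤ) :
    ∑ t ∈ F, b (s - t).natAbs ≤ 2 * B := by
  rw [← Finset.sum_filter_add_sum_filter_not F (· ≤ s), two_mul]
  refine add_le_add ?_ ?_
  · rw [← Finset.sum_image (g := fun t => (s - t).natAbs) (f := b)]
    · exact hB _
    · intro x hx y hy hxy
      have hx' := (Finset.mem_filter.1 hx).2
      have hy' := (Finset.mem_filter.1 hy).2
      simp only at hxy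
      omega
  · rw [← Finset.sum_image (g := fun t => (s - t).natAbs) (f := b)]
    · exact hB _
    · intro x hx y hy hxy
      have hx' := (Finset.mem_filter.1 hx).2
      have hy' := (Finset.mem_filter.1 hy).2
      simp only at hxy
      omega

omit [IsProbabilityMeasure μ] in
theorem MomentLe.nonneg {z : Ω → ℝ} {s B : ℝ} (hz : MomentLe μ z s B) : 0 ≤ B :=
  (integral_nonneg fun _ => Real.rpow_nonneg (abs_nonneg _) _).trans hz.2

/-- `U s` depends on times up to s + h and `U t` on times from t on. If t > s + h, mixing applies
across the remaining gap; for closer times the moments suffice. -/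
theorem abs_cov_le_covBound (h𝓖 : ∀ t, 𝓖 t ≤ m₀) {γ : ℝ} (hγ : 2 < γ) {h : ℕ} {D : ℝ}
    {U : ℤ → Ω → ℝ} (hU : ∀ t, Measurable[𝓖 t ⊔ 𝓖 (t + h)] (U t)) {s t : ℤ} (hst : s ≤ t)
    (hs : MomentLe μ (U s) γ D) (ht : MomentLe μ (U t) γ D) :
    |∫ ω, U s ω * U t ω ∂μ - (∫ ω, U s ω ∂μ) * ∫ ω, U t ω ∂μ| ≤
      covBound D h (fun l => alphaMixing μ 𝓖 (l + 1) ^ (1 - 2 / γ)) (s - t).natAbs := by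
  have hU0 : ∀ t, Measurable (U t) := fun t => (hU t).mono (sup_le (h𝓖 _) (h𝓖 _)) le_rfl
  unfold covBound
  split_ifs with hd
  · have h1 := integral_abs_le_of_integral_rpow_le (by linarith) (hU0 s) hs.1 hs.2
    have h2 := integral_abs_le_of_integral_rpow_le (by linarith) (hU0 t) ht.1 ht.2
    have hD := hs.nonneg
    have h3 : |∫ ω, U s ω * U t ω ∂μ| ≤ 1 + D := by
      calc _ ≤ ∫ ω, |U s ω * U t ω| ∂μ := abs_integral_le_integral_abs
        _ ≤ ∫ ω, (1 + 1 / 2 * (|U s ω| ^ γ + |U t ω| ^ γ)) ∂μ := by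
          refine integral_mono
            (integrable_mul_of_integrable_rpow hγ.le (hU0 s) (hU0 t) hs.1 ht.1).abs
            ((integrable_const 1).add ((hs.1.add ht.1).const_mul _)) fun ω => ?_
          have h1 := sq_le_one_add_rpow (U s ω) hγ.le
          have h2 := sq_le_one_add_rpow (U t ω) hγ.le
          simp only
          rw [abs_le]
          constructor <;> nlinarith [sq_nonneg (U s ω + U t ω), sq_nonneg (U s ω - U t ω)]
        _ ≤ _ := by
          have e : ∀ ω, 1 + 1 / 2 * (|U s ω| ^ γ + |U t ω| ^ γ) =
              (1 + 1 / 2 * |U s ω| ^ γ) + 1 / 2 * |U t ω| ^ γ := fun ω => by ring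
          have i1 := hs.1.const_mul (1 / 2)
          have i2 := ht.1.const_mul (1 / 2)
          have i3 : Integrable (fun ω => 1 + 1 / 2 * |U s ω| ^ γ) μ := (integrable_const 1).add i1
          simp only [e]
          rw [integral_add i3 i2, integral_add (integrable_const 1) i1,
            integral_const_mul, integral_const_mul]
          have := hs.2
          have := ht.2
          simp only [integral_const, probReal_univ, smul_eq_mul, one_mul]
          linarith
    have h4 : |(∫ ω, U s ω ∂μ) * ∫ ω, U t ω ∂μ| ≤ (1 + D) ^ 2 := by
      rw [abs_mul, sq]
      exact mul_le_mul (abs_integral_le_integral_abs.trans h1)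
        (abs_integral_le_integral_abs.trans h2) (abs_nonneg _) (by linarith)
    exact (abs_sub _ _).trans (add_le_add h3 h4)
  · set l := (s - t).natAbs - h - 1 with hl
    -- The gap between s + h and t is l + 1, which matches the summable sequence starting with the
    -- coefficient at lag 1.
    have ht' : (s + h) + ((l + 1 : ℕ) : ℤ) = t := by push_cast; omega
    refine abs_integral_mul_sub_le_rpow (m₁ := ⨆ r ∈ Set.Iic (s + (h : ℤ)), 𝓖 r)
      (m₂ := ⨆ r ∈ Set.Ici (s + (h : ℤ) + ((l + 1 : ℕ) : ℤ)), 𝓖 r)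
      (iSup₂_le fun t _ => h𝓖 t) (iSup₂_le fun t _ => h𝓖 t) hγ
      ((hU s).mono (sup_le ?_ ?_) le_rfl) ((hU t).mono (sup_le ?_ ?_) le_rfl)
      hs.1 hs.2 ht.1 ht.2 (alphaMixing_nonneg _) (alphaMixing_lt_one h𝓖 _)
      fun A B hA hB => le_alphaMixing h𝓖 _ _ hA hB
    · exact le_biSup 𝓖 (Set.mem_Iic.2 (by omega))
    · exact le_biSup 𝓖 (Set.mem_Iic.2 (by omega))
    · exact le_biSup 𝓖 (Set.mem_Ici.2 (by omega))
    · exact le_biSup 𝓖 (Set.mem_Ici.2 (by omega))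

/-- The constant in the variance bounds. -/
def varConst (D : ℝ) (h : ℕ) (B : ℝ) : ℝ :=
  2 * ((h + 1) * ((1 + D) + (1 + D) ^ 2) + (4 + 4 * D + 2 * D ^ 2) * B)

theorem integrable_sum_sub_integral_sq {γ : ℝ} (hγ : 2 < γ) {D : ℝ} {U : ℤ → Ω → ℝ}
    (hU : ∀ t, Measurable (U t)) (F : Finset ℤ) (hUD : ∀ t ∈ F, MomentLe μ (U t) γ D) (c : ℤ → ℝ) :
    Integrable (fun ω => (∑ t ∈ F, (U t ω - c t)) ^ 2) μ := by
  simp only [sq, Finset.sum_mul_sum]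
  refine integrable_finsetSum _ fun s hs => integrable_finsetSum _ fun t ht => ?_
  have h1 := integrable_mul_of_integrable_rpow hγ.le (hU s) (hU t) (hUD s hs).1 (hUD t ht).1
  have h2 := integrable_of_integrable_rpow (by linarith) (hU s) (hUD s hs).1
  have h3 := integrable_of_integrable_rpow (by linarith) (hU t) (hUD t ht).1
  have : (fun ω => (U s ω - c s) * (U t ω - c t)) =
      fun ω => U s ω * U t ω - U s ω * c t - c s * U t ω + c s * c t := by
    ext ω; ring
  rw [this]
  exact ((h1.sub (h2.mul_const _)).sub (h3.const_mul _)).add (integrable_const _)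

/-- The variance is a double sum of covariances, and each row sum is bounded independently of `F`.
Hence the growth is linear in the number of times, which is the source of T^(-1/2). -/
theorem integral_sum_sub_integral_sq_le (h𝓖 : ∀ t, 𝓖 t ≤ m₀) {γ : ℝ} (hγ : 2 < γ) {h : ℕ}
    {D B : ℝ} (hD : 0 ≤ D)
    (hs : Summable fun l : ℕ => alphaMixing μ 𝓖 (l + 1) ^ (1 - 2 / γ))
    (hB : ∑' l : ℕ, alphaMixing μ 𝓖 (l + 1) ^ (1 - 2 / γ) ≤ B)
    {U : ℤ → Ω → ℝ} (hU : ∀ t, Measurable[𝓖 t ⊔ 𝓖 (t + h)] (U t)) (F : Finset ℤ)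
    (hUD : ∀ t ∈ F, MomentLe μ (U t) γ D) :
    ∫ ω, (∑ t ∈ F, (U t ω - ∫ ω, U t ω ∂μ)) ^ 2 ∂μ ≤ F.card * varConst D h B := by
  have hU0 : ∀ t, Measurable (U t) := fun t => (hU t).mono (sup_le (h𝓖 _) (h𝓖 _)) le_rfl
  have hi : ∀ t ∈ F, Integrable (U t) μ := fun t ht =>
    integrable_of_integrable_rpow (by linarith) (hU0 t) (hUD t ht).1
  have hii : ∀ s ∈ F, ∀ t ∈ F, Integrable (fun ω => U s ω * U t ω) μ := fun s hs t ht =>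
    integrable_mul_of_integrable_rpow hγ.le (hU0 s) (hU0 t) (hUD s hs).1 (hUD t ht).1
  set a : ℕ → ℝ := fun l => alphaMixing μ 𝓖 (l + 1) ^ (1 - 2 / γ)
  have ha : ∀ l, 0 ≤ a l := fun l => Real.rpow_nonneg (alphaMixing_nonneg _) _
  have hcov : ∀ s ∈ F, ∀ t ∈ F, ∫ ω, (U s ω - ∫ ω, U s ω ∂μ) * (U t ω - ∫ ω, U t ω ∂μ) ∂μ =
      ∫ ω, U s ω * U t ω ∂μ - (∫ ω, U s ω ∂μ) * ∫ ω, U t ω ∂μ := by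
    intro s hs t ht
    have : ∀ ω, (U s ω - ∫ ω, U s ω ∂μ) * (U t ω - ∫ ω, U t ω ∂μ) =
        U s ω * U t ω - U s ω * (∫ ω, U t ω ∂μ) - (∫ ω, U s ω ∂μ) * U t ω +
          (∫ ω, U s ω ∂μ) * (∫ ω, U t ω ∂μ) := fun ω => by ring
    simp only [this]
    have i1 := (hi s hs).mul_const (∫ ω, U t ω ∂μ)
    have i2 := (hi t ht).const_mul (∫ ω, U s ω ∂μ)
    have i3 : Integrable (fun ω => U s ω * U t ω - U s ω * ∫ ω, U t ω ∂μ) μ :=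
      (hii s hs t ht).sub i1
    have i4 : Integrable (fun ω => U s ω * U t ω - U s ω * (∫ ω, U t ω ∂μ) -
      (∫ ω, U s ω ∂μ) * U t ω) μ := i3.sub i2
    rw [integral_add i4 (integrable_const _), integral_sub i3 i2,
      integral_sub (hii s hs t ht) i1, integral_mul_const, integral_const_mul]
    simp
  have hint : ∀ s ∈ F, ∀ t ∈ F,
      Integrable (fun ω => (U s ω - ∫ ω, U s ω ∂μ) * (U t ω - ∫ ω, U t ω ∂μ)) μ := by
    intro s hs t ht
    have : (fun ω => (U s ω - ∫ ω, U s ω ∂μ) * (U t ω - ∫ ω, U t ω ∂μ)) = fun ω =>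
        U s ω * U t ω - U s ω * (∫ ω, U t ω ∂μ) - (∫ ω, U s ω ∂μ) * U t ω +
          (∫ ω, U s ω ∂μ) * (∫ ω, U t ω ∂μ) := by ext ω; ring
    rw [this]
    exact (((hii s hs t ht).sub ((hi s hs).mul_const _)).sub ((hi t ht).const_mul _)).add
      (integrable_const _)
  simp only [sq, Finset.sum_mul_sum]
  rw [integral_finsetSum _ fun s hs => integrable_finsetSum _ fun t ht => hint s hs t ht]
  calc _ ≤ ∑ s ∈ F, varConst D h B := by
        refine Finset.sum_le_sum fun s hs' => ?_
        rw [integral_finsetSum _ fun t ht => hint s hs' t ht]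
        refine (Finset.sum_le_sum fun t ht => ?_).trans (sum_natAbs_sub_le
          (fun F => sum_covBound_le hD h ha hs hB F) s F)
        rw [hcov s hs' t ht]
        refine (le_abs_self _).trans ?_
        rcases le_total s t with hst | hst
        · exact abs_cov_le_covBound h𝓖 hγ hU hst (hUD s hs') (hUD t ht)
        · have := abs_cov_le_covBound h𝓖 hγ hU hst (hUD t ht) (hUD s hs')
          rw [← Int.natAbs_neg, neg_sub] at this
          simpa only [mul_comm] using this
    _ = _ := by rw [Finset.sum_const, nsmul_eq_mul]

omit [IsProbabilityMeasure μ] in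
-- |uv| is at most the larger of u² and v². This is why moments of order 2γ are needed: the products
-- must have moments of order γ.
theorem MomentLe.mul {u v : Ω → ℝ} {γ D : ℝ} (hγ : 0 ≤ γ) (hu : Measurable u) (hv : Measurable v)
    (hu' : MomentLe μ u (2 * γ) D) (hv' : MomentLe μ v (2 * γ) D) :
    MomentLe μ (fun ω => u ω * v ω) γ (2 * D) := by
  have key : ∀ ω, |u ω * v ω| ^ γ ≤ |u ω| ^ (2 * γ) + |v ω| ^ (2 * γ) := by
    intro ω
    have h0 : 0 ≤ |u ω| ^ (2 * γ) := Real.rpow_nonneg (abs_nonneg _) _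
    have h0' : 0 ≤ |v ω| ^ (2 * γ) := Real.rpow_nonneg (abs_nonneg _) _
    have e : ∀ x : ℝ, (|x| * |x|) ^ γ = |x| ^ (2 * γ) := fun x => by
      rw [Real.rpow_mul (abs_nonneg _), Real.rpow_two, sq]
    rw [abs_mul]
    rcases le_total |u ω| |v ω| with h | h
    · refine (Real.rpow_le_rpow (by positivity)
        (mul_le_mul_of_nonneg_right h (abs_nonneg _)) hγ).trans ?_
      rw [e]; linarith
    · refine (Real.rpow_le_rpow (by positivity)
        (mul_le_mul_of_nonneg_left h (abs_nonneg _)) hγ).trans ?_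
      rw [e]; linarith
  have hint : Integrable (fun ω => |u ω * v ω| ^ γ) μ := by
    refine Integrable.mono' (hu'.1.add hv'.1)
      ((hu.mul hv).abs.pow_const γ).aestronglyMeasurable (Eventually.of_forall fun ω => ?_)
    rw [Real.norm_of_nonneg (Real.rpow_nonneg (abs_nonneg _) _)]
    exact key ω
  refine ⟨hint, (integral_mono hint (hu'.1.add hv'.1) key).trans ?_⟩
  simp only [Pi.add_apply]
  rw [integral_add hu'.1 hv'.1]
  linarith [hu'.2, hv'.2]

/-- The mean squared error of a sample lagged second moment of a mixing process; `a` and `b` are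
the scales of the two components. -/
theorem integral_avg_mul_sub_sq_le (h𝓖 : ∀ t, 𝓖 t ≤ m₀) {γ : ℝ} (hγ : 2 < γ) {h T : ℕ}
    (hT : 1 ≤ T) (hhT : 2 * h ≤ T) {D B : ℝ}
    (hs : Summable fun l : ℕ => alphaMixing μ 𝓖 (l + 1) ^ (1 - 2 / γ))
    (hB : ∑' l : ℕ, alphaMixing μ 𝓖 (l + 1) ^ (1 - 2 / γ) ≤ B)
    {u v : ℤ → Ω → ℝ} (hu : ∀ t, Measurable[𝓖 t] (u t)) (hv : ∀ t, Measurable[𝓖 t] (v t))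
    {a b : ℝ} (ha : 0 < a) (hb : 0 < b)
    (hum : ∀ t ∈ Finset.Icc (1 : ℤ) T, MomentLe μ (fun ω => u t ω / a) (2 * γ) D)
    (hvm : ∀ t ∈ Finset.Icc (1 : ℤ) T, MomentLe μ (fun ω => v t ω / b) (2 * γ) D) :
    Integrable (fun ω => (((T : ℝ) - h)⁻¹ * ∑ t ∈ Finset.Icc (1 : ℤ) ((T : ℤ) - (h : ℤ)),
      u t ω * v (t + h) ω - ((T : ℝ) - h)⁻¹ * ∑ t ∈ Finset.Icc (1 : ℤ) ((T : ℤ) - (h : ℤ)),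
        ∫ ω, u t ω * v (t + h) ω ∂μ) ^ 2) μ ∧
    ∫ ω, (((T : ℝ) - h)⁻¹ * ∑ t ∈ Finset.Icc (1 : ℤ) ((T : ℤ) - (h : ℤ)), u t ω * v (t + h) ω -
      ((T : ℝ) - h)⁻¹ * ∑ t ∈ Finset.Icc (1 : ℤ) ((T : ℤ) - (h : ℤ)),
        ∫ ω, u t ω * v (t + h) ω ∂μ) ^ 2 ∂μ ≤
      a ^ 2 * b ^ 2 * (2 * varConst (2 * D) h B / T) := by
  set F := Finset.Icc (1 : ℤ) ((T : ℤ) - (h : ℤ)) with hF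
  -- After division by the scales the moment bound is uniform; the scales return as the factor a²b².
  set U : ℤ → Ω → ℝ := fun t ω => (u t ω / a) * (v (t + h) ω / b) with hU
  have hUm : ∀ t, Measurable[𝓖 t ⊔ 𝓖 (t + h)] (U t) := fun t =>
    (((hu t).mono le_sup_left le_rfl).div_const a).mul
      (((hv (t + h)).mono le_sup_right le_rfl).div_const b)
  have hU0 : ∀ t, Measurable (U t) := fun t => (hUm t).mono (sup_le (h𝓖 _) (h𝓖 _)) le_rfl
  have hUD : ∀ t ∈ F, MomentLe μ (U t) γ (2 * D) := by
    intro t ht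
    rw [hF, Finset.mem_Icc] at ht
    refine MomentLe.mul (by linarith) (((hu t).mono (h𝓖 _) le_rfl).div_const a)
      (((hv (t + h)).mono (h𝓖 _) le_rfl).div_const b) (hum t ?_) (hvm (t + h) ?_)
    · rw [Finset.mem_Icc]; omega
    · rw [Finset.mem_Icc]; omega
  have hD : 0 ≤ D := (hum 1 (by rw [Finset.mem_Icc]; omega)).nonneg
  have hN : (F.card : ℝ) = (T : ℝ) - h := by
    have : F.card = T - h := by rw [hF, Int.card_Icc]; omega
    rw [this, Nat.cast_sub (by omega)]
  have hT0 : (0 : ℝ) < T := by exact_mod_cast hT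
  -- Replacing T - h by T/2 produces the factor 2 in the bound.
  have hTh : (T : ℝ) / 2 ≤ (T : ℝ) - h := by
    have : (2 * h : ℝ) ≤ T := by exact_mod_cast hhT
    linarith
  have hN0 : 0 < (T : ℝ) - h := by linarith
  have e : ∀ ω, (((T : ℝ) - h)⁻¹ * ∑ t ∈ F, u t ω * v (t + h) ω -
      ((T : ℝ) - h)⁻¹ * ∑ t ∈ F, ∫ ω, u t ω * v (t + h) ω ∂μ) ^ 2 =
      (a * b / ((T : ℝ) - h)) ^ 2 * (∑ t ∈ F, (U t ω - ∫ ω, U t ω ∂μ)) ^ 2 := by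
    intro ω
    have e1 : ∀ t ω, u t ω * v (t + h) ω = a * b * U t ω := fun t ω => by
      simp only [hU]; field_simp
    simp only [e1, integral_const_mul]
    rw [← mul_sub, ← Finset.sum_sub_distrib, ← mul_pow]
    simp only [← mul_sub, ← Finset.mul_sum]
    congr 1; ring
  have hmain := integral_sum_sub_integral_sq_le h𝓖 hγ (by positivity : 0 ≤ 2 * D) hs hB hUm F hUD
  simp only [e]
  refine ⟨(integrable_sum_sub_integral_sq hγ hU0 F hUD _).const_mul _, ?_⟩
  rw [integral_const_mul]
  rw [hN] at hmain
  have hK : 0 ≤ varConst (2 * D) h B := by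
    have h0 := (integral_nonneg fun ω => sq_nonneg _).trans hmain
    exact nonneg_of_mul_nonneg_right h0 hN0
  calc _ ≤ (a * b / ((T : ℝ) - h)) ^ 2 * (((T : ℝ) - h) * varConst (2 * D) h B) :=
        mul_le_mul_of_nonneg_left hmain (sq_nonneg _)
    _ = a ^ 2 * b ^ 2 * (varConst (2 * D) h B / ((T : ℝ) - h)) := by field_simp
    _ ≤ a ^ 2 * b ^ 2 * (varConst (2 * D) h B / (T / 2)) := by gcongr
    _ = _ := by field_simp

end Alpha

/-! ### The population matrices of a process with low-rank autocovariances -/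

theorem dotProduct_mul_transpose_mulVec {ι κ : Type*} [Fintype ι] [Fintype κ] (A : Matrix ι κ ℝ)
    (v : ι → ℝ) : v ⬝ᵥ ((A * Aᵀ) *ᵥ v) = (Aᵀ *ᵥ v) ⬝ᵥ (Aᵀ *ᵥ v) := by
  rw [← Matrix.mulVec_mulVec, Matrix.dotProduct_mulVec, ← Matrix.mulVec_transpose]

theorem dotProduct_popM_mulVec {Ω : Type*} [MeasurableSpace Ω] (μ : Measure Ω) {a b : ℕ}
    (T h₀ : ℕ) (W : ℤ → Ω → Matrix (Fin a) (Fin b) ℝ) (v : Fin a → ℝ) :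
    v ⬝ᵥ (popM μ T h₀ W *ᵥ v) = ∑ h ∈ Finset.Icc 1 h₀, ∑ i : Fin b, ∑ j : Fin b,
      ((avgLagCov μ T h (fun t ω x => W t ω x i) (fun t ω x => W t ω x j))ᵀ *ᵥ v) ⬝ᵥ
        ((avgLagCov μ T h (fun t ω x => W t ω x i) (fun t ω x => W t ω x j))ᵀ *ᵥ v) := by
  simp only [popM, Matrix.sum_mulVec, dotProduct_sum, dotProduct_mul_transpose_mulVec]

section Loaded

variable {a b k r : ℕ} (L : Matrix (Fin a) (Fin k) ℝ) (N : Matrix (Fin b) (Fin r) ℝ)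

/-- The covariance of the columns `i` and `j` of `L F N'`, where `Γ c d` is that of the columns
`c` and `d` of `F`. -/
def loadedCov (Γ : Fin r → Fin r → Matrix (Fin k) (Fin k) ℝ) (i j : Fin b) :
    Matrix (Fin a) (Fin a) ℝ :=
  L * (∑ c, ∑ d, (N i c * N j d) • Γ c d) * Lᵀ

theorem loadedCov_apply (Γ : Fin r → Fin r → Matrix (Fin k) (Fin k) ℝ) (i j : Fin b)
    (x y : Fin a) : loadedCov L N Γ i j x y =
      ∑ e : Fin k × Fin r, ∑ f : Fin k × Fin r,
        (L x e.1 * N i e.2) * (L y f.1 * N j f.2) * Γ e.2 f.2 e.1 f.1 := by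
  simp only [loadedCov, Matrix.mul_apply, Matrix.sum_apply, Matrix.smul_apply, smul_eq_mul,
    Matrix.transpose_apply, Fintype.sum_prod_type, Finset.mul_sum, Finset.sum_mul]
  rw [Finset.sum_comm]
  refine Finset.sum_congr rfl fun e₁ _ => ?_
  rw [Finset.sum_comm]
  refine Finset.sum_congr rfl fun e₂ _ => Finset.sum_congr rfl fun f₁ _ =>
    Finset.sum_congr rfl fun f₂ _ => ?_
  ring

variable {L N}

/-- This is the lower bound for N ⊗ N, obtained by applying that for N in one index and then in the
other. -/
theorem sum_sq_kronecker_ge {σ : ℝ} (hσ : 0 ≤ σ) (hN : ∀ z, σ * (z ⬝ᵥ z) ≤ (N *ᵥ z) ⬝ᵥ (N *ᵥ z))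
    (g : Fin r → Fin r → ℝ) :
    σ ^ 2 * ∑ c, ∑ d, g c d ^ 2 ≤ ∑ i, ∑ j, (∑ c, ∑ d, N i c * N j d * g c d) ^ 2 := by
  have hN' : ∀ z : Fin r → ℝ, σ * ∑ c, z c ^ 2 ≤ ∑ i, (∑ c, N i c * z c) ^ 2 := fun z => by
    simpa [dotProduct, Matrix.mulVec, sq] using hN z
  calc σ ^ 2 * ∑ c, ∑ d, g c d ^ 2 = σ * ∑ c, σ * ∑ d, g c d ^ 2 := by
        rw [← Finset.mul_sum]; ring
    _ ≤ σ * ∑ c, ∑ j, (∑ d, N j d * g c d) ^ 2 :=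
      mul_le_mul_of_nonneg_left (Finset.sum_le_sum fun c _ => hN' (g c)) hσ
    _ = ∑ j, σ * ∑ c, (∑ d, N j d * g c d) ^ 2 := by rw [Finset.sum_comm, Finset.mul_sum]
    _ ≤ ∑ j, ∑ i, (∑ c, N i c * ∑ d, N j d * g c d) ^ 2 :=
      Finset.sum_le_sum fun j _ => hN' fun c => ∑ d, N j d * g c d
    _ = _ := by
      rw [Finset.sum_comm]
      simp only [Finset.mul_sum, mul_assoc]

/-- With u = L'v the vectors on the right are L applied to the sums of N_ic N_jd Γ_cd' u. The outer
L costs σL, and the Kronecker bound in each coordinate costs σN². -/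
theorem loadedCov_transpose_mulVec_ge {σL σN : ℝ} (hσL : 0 ≤ σL) (hσN : 0 ≤ σN)
    (hL : ∀ z, σL * (z ⬝ᵥ z) ≤ (L *ᵥ z) ⬝ᵥ (L *ᵥ z))
    (hN : ∀ z, σN * (z ⬝ᵥ z) ≤ (N *ᵥ z) ⬝ᵥ (N *ᵥ z))
    (Γ : Fin r → Fin r → Matrix (Fin k) (Fin k) ℝ) (v : Fin a → ℝ) :
    σL * (σN ^ 2 * ∑ c, ∑ d, ((Γ c d)ᵀ *ᵥ (Lᵀ *ᵥ v)) ⬝ᵥ ((Γ c d)ᵀ *ᵥ (Lᵀ *ᵥ v))) ≤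
      ∑ i, ∑ j, ((loadedCov L N Γ i j)ᵀ *ᵥ v) ⬝ᵥ ((loadedCov L N Γ i j)ᵀ *ᵥ v) := by
  set u := Lᵀ *ᵥ v with hu
  have e1 : ∀ i j, (loadedCov L N Γ i j)ᵀ *ᵥ v =
      L *ᵥ (∑ c, ∑ d, (N i c * N j d) • ((Γ c d)ᵀ *ᵥ u)) := by
    intro i j
    simp only [loadedCov, Matrix.transpose_mul, Matrix.transpose_transpose, Matrix.transpose_sum,
      Matrix.transpose_smul, ← Matrix.mulVec_mulVec, Matrix.sum_mulVec, Matrix.smul_mulVec, ← hu]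
  calc _ = σL * ∑ x, σN ^ 2 * ∑ c, ∑ d, (((Γ c d)ᵀ *ᵥ u) x) ^ 2 := by
        rw [← Finset.mul_sum]
        congr 2
        conv_rhs => rw [Finset.sum_comm]
        refine Finset.sum_congr rfl fun c _ => ?_
        conv_rhs => rw [Finset.sum_comm]
        simp only [dotProduct, sq]
    _ ≤ σL * ∑ x, ∑ i, ∑ j, (∑ c, ∑ d, N i c * N j d * ((Γ c d)ᵀ *ᵥ u) x) ^ 2 :=
      mul_le_mul_of_nonneg_left
        (Finset.sum_le_sum fun x _ => sum_sq_kronecker_ge hσN hN fun c d => ((Γ c d)ᵀ *ᵥ u) x) hσL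
    _ = ∑ i, ∑ j, σL * ((∑ c, ∑ d, (N i c * N j d) • ((Γ c d)ᵀ *ᵥ u)) ⬝ᵥ
          (∑ c, ∑ d, (N i c * N j d) • ((Γ c d)ᵀ *ᵥ u))) := by
      simp only [← Finset.mul_sum]
      congr 1
      rw [Finset.sum_comm]
      refine Finset.sum_congr rfl fun i _ => ?_
      rw [Finset.sum_comm]
      refine Finset.sum_congr rfl fun j _ => ?_
      simp only [dotProduct, Finset.sum_apply, Pi.smul_apply, smul_eq_mul, sq]
    _ ≤ _ := by
      refine Finset.sum_le_sum fun i _ => Finset.sum_le_sum fun j _ => ?_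
      rw [e1]
      exact hL _

/-- L' may have a kernel, but not on the range of L: ‖Lz‖⁴ = ⟨z, L'Lz⟩² ≤ ‖z‖²‖L'Lz‖² and σL‖z‖² ≤
‖Lz‖². -/
theorem transpose_mulVec_mulVec_ge {σL : ℝ} (hσL : 0 ≤ σL)
    (hL : ∀ z, σL * (z ⬝ᵥ z) ≤ (L *ᵥ z) ⬝ᵥ (L *ᵥ z)) (z : Fin k → ℝ) :
    σL * ((L *ᵥ z) ⬝ᵥ (L *ᵥ z)) ≤ (Lᵀ *ᵥ (L *ᵥ z)) ⬝ᵥ (Lᵀ *ᵥ (L *ᵥ z)) := by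
  have h0 := dotProduct_self_nonneg (L *ᵥ z)
  have h0' := dotProduct_self_nonneg (Lᵀ *ᵥ (L *ᵥ z))
  have h1 := dotProduct_sq_le z (Lᵀ *ᵥ (L *ᵥ z))
  have e : z ⬝ᵥ (Lᵀ *ᵥ (L *ᵥ z)) = (L *ᵥ z) ⬝ᵥ (L *ᵥ z) := by
    rw [Matrix.dotProduct_mulVec, Matrix.vecMul_transpose]
  rw [e] at h1
  rcases h0.eq_or_lt with h | h
  · rw [← h, mul_zero]; exact h0'
  · refine le_of_mul_le_mul_right ?_ h
    have h2 := mul_le_mul_of_nonneg_right (hL z) h0'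
    nlinarith [mul_le_mul_of_nonneg_left h1 hσL]

theorem exists_sum_eq_mul {α κ ι : Type*} [Fintype κ] (L : Matrix ι κ ℝ) (s : Finset α)
    {f : α → Matrix ι ι ℝ} (hf : ∀ i ∈ s, ∃ B : Matrix κ ι ℝ, f i = L * B) :
    ∃ B : Matrix κ ι ℝ, ∑ i ∈ s, f i = L * B := by
  choose! B hB using hf
  exact ⟨∑ i ∈ s, B i, by rw [Matrix.mul_sum]; exact Finset.sum_congr rfl hB⟩

variable (L N) in
-- Every block begins with the factor L, which gives the range. In the form at Lz, the squared least
-- singular value of L enters twice (through the outer L, and through L' on the range of L), that of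
-- N enters twice through N ⊗ N, and c is what the factors themselves contribute.
theorem popM_of_loadedCov {Ω : Type*} [MeasurableSpace Ω] {μ : Measure Ω} {T h₀ : ℕ}
    {W : ℤ → Ω → Matrix (Fin a) (Fin b) ℝ} {Φ : ℤ → Ω → Matrix (Fin k) (Fin r) ℝ}
    (hΩ : ∀ h ∈ Finset.Icc 1 h₀, ∀ i j,
      avgLagCov μ T h (fun t ω x => W t ω x i) (fun t ω x => W t ω x j) = loadedCov L N
        (fun c d => avgLagCov μ T h (fun t ω x => Φ t ω x c) (fun t ω x => Φ t ω x d)) i j)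
    {c : ℝ} (hc0 : 0 ≤ c) (hc : c ≤ nthEig (popM μ T h₀ Φ) (k - 1)) :
    (∃ B : Matrix (Fin k) (Fin a) ℝ, popM μ T h₀ W = L * B) ∧
      ∀ z, c * (singVal L (k - 1) ^ 2) ^ 2 * (singVal N (r - 1) ^ 2) ^ 2 *
        ((L *ᵥ z) ⬝ᵥ (L *ᵥ z)) ≤ (L *ᵥ z) ⬝ᵥ (popM μ T h₀ W *ᵥ (L *ᵥ z)) := by
  set σL := singVal L (k - 1) ^ 2 with hσL
  set σN := singVal N (r - 1) ^ 2 with hσN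
  have hL0 : 0 ≤ σL := sq_nonneg _
  have hN0 : 0 ≤ σN := sq_nonneg _
  constructor
  · refine exists_sum_eq_mul L _ fun h hh => exists_sum_eq_mul L _ fun i _ =>
      exists_sum_eq_mul L _ fun j _ => ?_
    rw [hΩ h hh i j]
    nth_rewrite 1 [loadedCov]
    rw [Matrix.mul_assoc, Matrix.mul_assoc]
    exact ⟨_, rfl⟩
  · intro z
    rw [dotProduct_popM_mulVec]
    have h1 := le_dotProduct_mulVec (popM_isHermitian μ T h₀ Φ) hc (Lᵀ *ᵥ (L *ᵥ z))
    rw [dotProduct_popM_mulVec] at h1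
    have h2 := transpose_mulVec_mulVec_ge hL0 (singVal_sq_mul_le L) z
    calc _ = σL * σN ^ 2 * (c * (σL * ((L *ᵥ z) ⬝ᵥ (L *ᵥ z)))) := by ring
      _ ≤ σL * σN ^ 2 * (c * ((Lᵀ *ᵥ (L *ᵥ z)) ⬝ᵥ (Lᵀ *ᵥ (L *ᵥ z)))) := by gcongr
      _ ≤ σL * σN ^ 2 * _ := mul_le_mul_of_nonneg_left h1 (by positivity)
      _ ≤ _ := by
        rw [Finset.mul_sum]
        refine Finset.sum_le_sum fun h hh => ?_
        simp only [hΩ h hh]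
        rw [mul_assoc]
        exact loadedCov_transpose_mulVec_ge hL0 hN0 (singVal_sq_mul_le L) (singVal_sq_mul_le N)
          _ _

end Loaded

/-! ### Bounds in mean -/

/-- `f` is integrable with integral at most `c`. -/
def MeanLe {Ω : Type*} [MeasurableSpace Ω] (μ : Measure Ω) (f : Ω → ℝ) (c : ℝ) : Prop :=
  Integrable f μ ∧ ∫ ω, f ω ∂μ ≤ c

section MeanLe

variable {Ω : Type*} [MeasurableSpace Ω] {μ : Measure Ω}

theorem MeanLe.mono {f : Ω → ℝ} {c d : ℝ} (hf : MeanLe μ f c) (hcd : c ≤ d) : MeanLe μ f d :=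
  ⟨hf.1, hf.2.trans hcd⟩

theorem MeanLe.add {f g : Ω → ℝ} {c d : ℝ} (hf : MeanLe μ f c) (hg : MeanLe μ g d) :
    MeanLe μ (fun ω => f ω + g ω) (c + d) :=
  ⟨hf.1.add hg.1, by rw [integral_add hf.1 hg.1]; exact add_le_add hf.2 hg.2⟩

theorem MeanLe.const_mul {f : Ω → ℝ} {c a : ℝ} (hf : MeanLe μ f c) (ha : 0 ≤ a) :
    MeanLe μ (fun ω => a * f ω) (a * c) :=
  ⟨hf.1.const_mul a, by rw [integral_const_mul]; exact mul_le_mul_of_nonneg_left hf.2 ha⟩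

theorem MeanLe.sum {α : Type*} {s : Finset α} {f : α → Ω → ℝ} {c : α → ℝ}
    (hf : ∀ i ∈ s, MeanLe μ (f i) (c i)) : MeanLe μ (fun ω => ∑ i ∈ s, f i ω) (∑ i ∈ s, c i) :=
  ⟨integrable_finsetSum _ fun i hi => (hf i hi).1, by
    rw [integral_finsetSum _ fun i hi => (hf i hi).1]
    exact Finset.sum_le_sum fun i hi => (hf i hi).2⟩

/-- Markov's inequality. -/
theorem MeanLe.measure_lt_le {f : Ω → ℝ} {c : ℝ} (hf : MeanLe μ f c) (h0 : ∀ ω, 0 ≤ f ω)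
    [IsFiniteMeasure μ] {ε : ℝ} (hε : 0 < ε) (hc : 0 < c) :
    μ {ω | c / ε < f ω} ≤ ENNReal.ofReal ε := by
  have h1 := mul_meas_ge_le_integral_of_nonneg (Eventually.of_forall h0) hf.1 (c / ε)
  have h2 : μ.real {ω | c / ε ≤ f ω} ≤ ε := by
    have h3 : c / ε * μ.real {ω | c / ε ≤ f ω} ≤ c / ε * ε := by
      rw [div_mul_cancel₀ _ hε.ne']; exact h1.trans hf.2
    exact le_of_mul_le_mul_left h3 (by positivity)
  refine (measure_mono (t := {ω | c / ε ≤ f ω}) fun ω (hω : c / ε < f ω) => hω.le).trans ?_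
  rw [← ENNReal.ofReal_toReal (measure_ne_top μ _)]
  exact ENNReal.ofReal_le_ofReal h2

theorem MomentLe.mono {z : Ω → ℝ} {s B B' : ℝ} (hz : MomentLe μ z s B) (hB : B ≤ B') :
    MomentLe μ z s B' :=
  ⟨hz.1, hz.2.trans hB⟩

theorem MomentLe.meanLe_sq [IsProbabilityMeasure μ] {z : Ω → ℝ} {s B : ℝ} (hz : MomentLe μ z s B)
    (hm : Measurable z) (hs : 2 ≤ s) : MeanLe μ (fun ω => z ω ^ 2) (1 + B) := by
  have hi : Integrable (fun ω => z ω ^ 2) μ :=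
    Integrable.mono' ((integrable_const 1).add hz.1) (hm.pow_const 2).aestronglyMeasurable
      (Eventually.of_forall fun ω => by
        rw [Real.norm_of_nonneg (sq_nonneg _)]; exact sq_le_one_add_rpow _ hs)
  refine ⟨hi, (integral_mono hi ((integrable_const 1).add hz.1)
    fun ω => sq_le_one_add_rpow (z ω) hs).trans ?_⟩
  simp only [Pi.add_apply]
  rw [integral_add (integrable_const 1) hz.1]
  simpa using hz.2

theorem MomentLe.memLp_two [IsProbabilityMeasure μ] {z : Ω → ℝ} {s B : ℝ} (hz : MomentLe μ z s B)
    (hm : Measurable z) (hs : 2 ≤ s) : MemLp z 2 μ :=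
  (memLp_two_iff_integrable_sq hm.aestronglyMeasurable).2 (hz.meanLe_sq hm hs).1

end MeanLe

namespace Model

variable {k r m : ℕ} {Ω : Type*} [mΩ : MeasurableSpace Ω] (S : Model k r m Ω)

instance : IsProbabilityMeasure S.μ := S.isProb

/-! ### Measurability -/

theorem W_apply (t : ℤ) (ω : Ω) (x : Fin S.p) (i : Fin S.q) :
    S.W t ω x i = ∑ e : Fin k × Fin r, S.R x e.1 * S.C i e.2 * S.F t ω e.1 e.2 + S.E t ω x i := by
  simp only [W, Matrix.add_apply, Matrix.mul_apply, Fintype.sum_prod_type, Finset.sum_mul,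
    Matrix.transpose_apply]
  rw [Finset.sum_comm]
  congr 1
  exact Finset.sum_congr rfl fun a _ => Finset.sum_congr rfl fun b _ => by ring

theorem Y_eq (t : ℤ) (ω : Ω) : S.Y t ω = S.A * S.X t ω + S.W t ω := by
  rw [Y, W, add_assoc]

theorem measurable_W (t : ℤ) (x : Fin S.p) (i : Fin S.q) : Measurable fun ω => S.W t ω x i := by
  simp only [W_apply]
  exact (Finset.measurable_sum _ fun e _ => (S.measurable_F t _ _).const_mul _).add
    (S.measurable_E t x i)

theorem measurable_Y (t : ℤ) (x : Fin S.p) (i : Fin S.q) : Measurable fun ω => S.Y t ω x i := by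
  simp only [Y_eq, Matrix.add_apply, Matrix.mul_apply]
  exact (Finset.measurable_sum _ fun e _ => (S.measurable_X t _ _).const_mul _).add
    (S.measurable_W t x i)

theorem obsSigma_le (t : ℤ) : S.obsSigma t ≤ mΩ :=
  sup_le (sup_le (iSup₂_le fun i j => (S.measurable_Y t i j).comap_le)
    (iSup₂_le fun i j => (S.measurable_X t i j).comap_le))
    (iSup₂_le fun i j => (S.measurable_F t i j).comap_le)

theorem measurable_obsSigma_Y (t : ℤ) (i : Fin S.p) (j : Fin S.q) :
    Measurable[S.obsSigma t] fun ω => S.Y t ω i j :=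
  (comap_measurable _).mono
    ((le_iSup₂ (f := fun i j => MeasurableSpace.comap (fun ω => S.Y t ω i j) inferInstance)
      i j).trans (le_sup_left.trans le_sup_left)) le_rfl

theorem measurable_obsSigma_X (t : ℤ) (i : Fin m) (j : Fin S.q) :
    Measurable[S.obsSigma t] fun ω => S.X t ω i j :=
  (comap_measurable _).mono
    ((le_iSup₂ (f := fun i j => MeasurableSpace.comap (fun ω => S.X t ω i j) inferInstance)
      i j).trans (le_sup_right.trans le_sup_left)) le_rfl

/-- The errors need not be treated separately in the mixing condition, because W = Y - AX is a
function of the mixing process. -/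
theorem measurable_obsSigma_W (t : ℤ) (x : Fin S.p) (i : Fin S.q) :
    Measurable[S.obsSigma t] fun ω => S.W t ω x i := by
  have : (fun ω => S.W t ω x i) = fun ω => S.Y t ω x i - ∑ l, S.A x l * S.X t ω l i := by
    ext ω
    rw [Y_eq, Matrix.add_apply, Matrix.mul_apply, add_sub_cancel_left]
  rw [this]
  exact (S.measurable_obsSigma_Y t x i).sub
    (Finset.measurable_sum _ fun l _ => (S.measurable_obsSigma_X t l i).const_mul _)

/-! ### Moments -/

/-- The moments of order `s` are at most `D`. -/
def MomentsLe (s D : ℝ) : Prop :=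
  ∀ t ∈ S.times,
    (∀ i j, MomentLe S.μ (fun ω => S.F t ω i j) s D) ∧
    (∀ l g, MomentLe S.μ (fun ω => S.X t ω l g) s D) ∧
    (∀ u g, MomentLe S.μ (fun ω => S.E t ω u g) s D)

/-- The contribution of the loadings to the scale of the entry `(x, i)` of `W_t`. -/
def loading (x : Fin S.p) (i : Fin S.q) : ℝ := (∑ a, |S.R x a|) * ∑ b, |S.C i b|

/-- The scale of the entry `(x, i)` of `W_t`. -/
def scale (x : Fin S.p) (i : Fin S.q) : ℝ := 1 + S.loading x i

theorem loading_nonneg (x : Fin S.p) (i : Fin S.q) : 0 ≤ S.loading x i :=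
  mul_nonneg (Finset.sum_nonneg fun _ _ => abs_nonneg _)
    (Finset.sum_nonneg fun _ _ => abs_nonneg _)

theorem scale_pos (x : Fin S.p) (i : Fin S.q) : 0 < S.scale x i := by
  have := S.loading_nonneg x i
  unfold scale
  linarith

theorem loading_eq (x : Fin S.p) (i : Fin S.q) :
    S.loading x i = ∑ e : Fin k × Fin r, |S.R x e.1 * S.C i e.2| := by
  simp only [loading, Finset.sum_mul_sum, Fintype.sum_prod_type, abs_mul]

theorem sum_loading_sq_le :
    ∑ x, ∑ i, S.loading x i ^ 2 ≤ (k * frobSq S.R) * (r * frobSq S.C) := by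
  have h : ∀ {a b : ℕ} (M : Matrix (Fin a) (Fin b) ℝ), ∑ x, (∑ y, |M x y|) ^ 2 ≤ b * frobSq M := by
    intro a b M
    rw [frobSq, Finset.mul_sum]
    refine Finset.sum_le_sum fun x _ => ?_
    have := sq_sum_le_card_mul_sum_sq (s := Finset.univ) (f := fun y => |M x y|)
    simpa only [sq_abs, Finset.card_univ, Fintype.card_fin] using this
  simp only [loading, mul_pow]
  rw [← Finset.sum_mul_sum]
  exact mul_le_mul (h _) (h _) (Finset.sum_nonneg fun _ _ => sq_nonneg _)
    (mul_nonneg (Nat.cast_nonneg _) (frobSq_nonneg _))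

/-- The individual loadings need not be bounded, so the entries of W may have very different sizes.
Only the total of their squared scales is controlled, and it will be of order pq. -/
theorem sum_scale_sq_le :
    ∑ x, ∑ i, S.scale x i ^ 2 ≤ 2 * (S.p * S.q + (k * frobSq S.R) * (r * frobSq S.C)) := by
  calc _ ≤ ∑ x, ∑ i, (2 + 2 * S.loading x i ^ 2) :=
        Finset.sum_le_sum fun x _ => Finset.sum_le_sum fun i _ => by
          unfold scale; nlinarith [sq_nonneg (1 - S.loading x i)]
    _ = 2 * (S.p * S.q + ∑ x, ∑ i, S.loading x i ^ 2) := by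
      simp only [Finset.sum_add_distrib, ← Finset.mul_sum, Finset.sum_const, Finset.card_univ,
        Fintype.card_fin, nsmul_eq_mul]
      ring
    _ ≤ _ := by linarith [S.sum_loading_sq_le]

variable {S}

/-- All kr + 1 variables entering W_{t,xi} are at most G^(1/s) in absolute value, where G is the sum
of their s-th powers, and the scale is the sum of the absolute coefficients. Hence |W/scale|^s ≤ G.
-/
theorem MomentsLe.W {s D : ℝ} (hs : 0 < s) (hM : S.MomentsLe s D) {t : ℤ} (ht : t ∈ S.times)
    (x : Fin S.p) (i : Fin S.q) :
    MomentLe S.μ (fun ω => S.W t ω x i / S.scale x i) s ((k * r + 1) * D) := by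
  obtain ⟨hF, -, hE⟩ := hM t ht
  set G : Ω → ℝ := fun ω => ∑ e : Fin k × Fin r, |S.F t ω e.1 e.2| ^ s + |S.E t ω x i| ^ s
  have hG : MeanLe S.μ G ((k * r + 1) * D) := by
    refine MeanLe.mono (MeanLe.add (MeanLe.sum (c := fun _ => D)
      fun (e : Fin k × Fin r) _ => hF e.1 e.2) (hE x i)) ?_
    simp only [Finset.sum_const, Finset.card_univ, Fintype.card_prod, Fintype.card_fin,
      nsmul_eq_mul, Nat.cast_mul]
    exact le_of_eq (by ring)
  have hle : ∀ ω, |S.W t ω x i / S.scale x i| ^ s ≤ G ω := by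
    intro ω
    have hFn : ∀ e : Fin k × Fin r, 0 ≤ |S.F t ω e.1 e.2| ^ s := fun e =>
      Real.rpow_nonneg (abs_nonneg _) _
    have hEn : 0 ≤ |S.E t ω x i| ^ s := Real.rpow_nonneg (abs_nonneg _) _
    have hG0 : 0 ≤ G ω := add_nonneg (Finset.sum_nonneg fun e _ => hFn e) hEn
    set M := G ω ^ (1 / s) with hMdef
    have hM0 : 0 ≤ M := Real.rpow_nonneg hG0 _
    have hroot : ∀ z : ℝ, |z| ^ s ≤ G ω → |z| ≤ M := by
      intro z hz
      have := Real.rpow_le_rpow (Real.rpow_nonneg (abs_nonneg z) s) hz (by positivity : 0 ≤ 1 / s)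
      rwa [← Real.rpow_mul (abs_nonneg z), mul_one_div_cancel hs.ne', Real.rpow_one] at this
    have hFM : ∀ e : Fin k × Fin r, |S.F t ω e.1 e.2| ≤ M := fun e => hroot _ <|
      (Finset.single_le_sum (f := fun e : Fin k × Fin r => |S.F t ω e.1 e.2| ^ s)
        (fun e _ => hFn e) (Finset.mem_univ e)).trans (le_add_of_nonneg_right hEn)
    have hEM : |S.E t ω x i| ≤ M := hroot _ <|
      le_add_of_nonneg_left (Finset.sum_nonneg fun e _ => hFn e)
    have hW : |S.W t ω x i| ≤ S.scale x i * M := by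
      rw [W_apply, scale, loading_eq, add_comm 1, add_mul, one_mul, Finset.sum_mul]
      refine (abs_add_le _ _).trans (add_le_add ((Finset.abs_sum_le_sum_abs _ _).trans
        (Finset.sum_le_sum fun e _ => ?_)) hEM)
      rw [abs_mul]
      exact mul_le_mul_of_nonneg_left (hFM e) (abs_nonneg _)
    have hdiv : |S.W t ω x i / S.scale x i| ≤ M := by
      rw [abs_div, abs_of_pos (S.scale_pos x i), div_le_iff₀ (S.scale_pos x i), mul_comm]
      exact hW
    calc _ ≤ M ^ s := Real.rpow_le_rpow (abs_nonneg _) hdiv hs.le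
      _ = G ω := by rw [hMdef, ← Real.rpow_mul hG0, one_div_mul_cancel hs.ne', Real.rpow_one]
  have hint : Integrable (fun ω => |S.W t ω x i / S.scale x i| ^ s) S.μ :=
    Integrable.mono' hG.1
      (((S.measurable_W t x i).div_const _).abs.pow_const s).aestronglyMeasurable
      (Eventually.of_forall fun ω => by
        rw [Real.norm_of_nonneg (Real.rpow_nonneg (abs_nonneg _) _)]; exact hle ω)
  exact ⟨hint, (integral_mono hint hG.1 hle).trans hG.2⟩

variable (S) in
theorem W_eq_add (t : ℤ) (x : Fin S.p) (i : Fin S.q) : (fun ω => S.W t ω x i) =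
    (fun ω => ∑ e : Fin k × Fin r, S.R x e.1 * S.C i e.2 * S.F t ω e.1 e.2) +
      fun ω => S.E t ω x i := by
  ext ω
  rw [W_apply, Pi.add_apply]

/-! ### Covariances of `W` with the regressors and with itself. -/

section Covariances

variable {s D : ℝ} (hs : 2 ≤ s) (hM : S.MomentsLe s D) (hS : S.Standing)
include hs hM

theorem MomentsLe.memLp_F {t : ℤ} (ht : t ∈ S.times) (i : Fin k) (j : Fin r) :
    MemLp (fun ω => S.F t ω i j) 2 S.μ :=
  ((hM t ht).1 i j).memLp_two (S.measurable_F t i j) hs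

theorem MomentsLe.memLp_X {t : ℤ} (ht : t ∈ S.times) (i : Fin m) (j : Fin S.q) :
    MemLp (fun ω => S.X t ω i j) 2 S.μ :=
  ((hM t ht).2.1 i j).memLp_two (S.measurable_X t i j) hs

theorem MomentsLe.memLp_E {t : ℤ} (ht : t ∈ S.times) (i : Fin S.p) (j : Fin S.q) :
    MemLp (fun ω => S.E t ω i j) 2 S.μ :=
  ((hM t ht).2.2 i j).memLp_two (S.measurable_E t i j) hs

theorem MomentsLe.memLp_common {t : ℤ} (ht : t ∈ S.times) (c : Fin k × Fin r → ℝ) :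
    MemLp (fun ω => ∑ e : Fin k × Fin r, c e * S.F t ω e.1 e.2) 2 S.μ :=
  memLp_finsetSum _ fun e _ => (hM.memLp_F hs ht e.1 e.2).const_mul _

theorem MomentsLe.memLp_W {t : ℤ} (ht : t ∈ S.times) (x : Fin S.p) (i : Fin S.q) :
    MemLp (fun ω => S.W t ω x i) 2 S.μ := by
  rw [S.W_eq_add]
  exact (hM.memLp_common hs ht _).add (hM.memLp_E hs ht x i)

include hS

theorem MomentsLe.integral_W {t : ℤ} (ht : t ∈ S.times) (x : Fin S.p) (i : Fin S.q) :
    ∫ ω, S.W t ω x i ∂S.μ = 0 := by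
  simp only [W_apply]
  rw [integral_add ((hM.memLp_common hs ht _).integrable one_le_two)
    ((hM.memLp_E hs ht x i).integrable one_le_two), hS.mean_E t ht, add_zero,
    integral_finsetSum _ fun e _ =>
      ((hM.memLp_F hs ht e.1 e.2).integrable one_le_two).const_mul _]
  refine Finset.sum_eq_zero fun e _ => ?_
  rw [integral_const_mul, hS.mean_F t ht, mul_zero]

theorem MomentsLe.cov_W_X {t : ℤ} (ht : t ∈ S.times) (x : Fin S.p) (i : Fin S.q) (l : Fin m) :
    cov[fun ω => S.W t ω x i, fun ω => S.X t ω l i; S.μ] = 0 := by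
  rw [S.W_eq_add, covariance_add_left (hM.memLp_common hs ht _) (hM.memLp_E hs ht x i)
    (hM.memLp_X hs ht l i), hS.cov_E_X t ht, add_zero,
    covariance_fun_sum_left
      (X := fun (e : Fin k × Fin r) ω => S.R x e.1 * S.C i e.2 * S.F t ω e.1 e.2)
      (fun e => (hM.memLp_F hs ht e.1 e.2).const_mul _) (hM.memLp_X hs ht l i)]
  refine Finset.sum_eq_zero fun e _ => ?_
  rw [covariance_const_mul_left, hS.cov_F_X t ht, mul_zero]

/-- At distinct times the error–error term and both error–factor terms vanish. At equal times the
error covariance would remain, which is why only positive lags enter M₁ and M₂. -/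
theorem MomentsLe.cov_W_W {t u : ℤ} (ht : t ∈ S.times) (hu : u ∈ S.times) (htu : t ≠ u)
    (x y : Fin S.p) (i j : Fin S.q) :
    cov[fun ω => S.W t ω x i, fun ω => S.W u ω y j; S.μ] =
      ∑ e : Fin k × Fin r, ∑ f : Fin k × Fin r, (S.R x e.1 * S.C i e.2) * (S.R y f.1 * S.C j f.2) *
        cov[fun ω => S.F t ω e.1 e.2, fun ω => S.F u ω f.1 f.2; S.μ] := by
  have hFt := hM.memLp_common hs ht fun e => S.R x e.1 * S.C i e.2
  have hFu := hM.memLp_common hs hu fun e => S.R y e.1 * S.C j e.2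
  have hEt := hM.memLp_E hs ht x i
  have hEu := hM.memLp_E hs hu y j
  set U : Fin k × Fin r → Ω → ℝ := fun e ω => S.R x e.1 * S.C i e.2 * S.F t ω e.1 e.2
  set U' : Fin k × Fin r → Ω → ℝ := fun e ω => S.R y e.1 * S.C j e.2 * S.F u ω e.1 e.2
  have hU : ∀ e, MemLp (U e) 2 S.μ := fun e => (hM.memLp_F hs ht e.1 e.2).const_mul _
  have hU' : ∀ e, MemLp (U' e) 2 S.μ := fun e => (hM.memLp_F hs hu e.1 e.2).const_mul _
  rw [S.W_eq_add, S.W_eq_add, covariance_add_left hFt hEt (hFu.add hEu),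
    covariance_add_right hFt hFu hEu, covariance_add_right hEt hFu hEu, hS.white_E t ht u hu htu,
    covariance_fun_sum_right (X := U') hU' hEt, covariance_fun_sum_left (X := U) hU hEu,
    covariance_fun_sum_fun_sum (X := U) (Y := U') hU hU']
  rw [Finset.sum_eq_zero (f := fun e => cov[U e, fun ω => S.E u ω y j; S.μ])
      fun e _ => by rw [covariance_const_mul_left, covariance_comm, hS.cov_E_F u hu t ht, mul_zero],
    Finset.sum_eq_zero (f := fun e => cov[fun ω => S.E t ω x i, U' e; S.μ])
      fun e _ => by rw [covariance_const_mul_right, hS.cov_E_F t ht u hu, mul_zero]]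
  simp only [add_zero]
  refine Finset.sum_congr rfl fun e _ => Finset.sum_congr rfl fun f _ => ?_
  rw [covariance_const_mul_left, covariance_const_mul_right]
  ring

end Covariances

end Model

theorem varConst_mono {D B : ℝ} (hD : 0 ≤ D) {h h' : ℕ} (hh : h ≤ h') :
    varConst D h B ≤ varConst D h' B := by
  have : (h : ℝ) ≤ h' := by exact_mod_cast hh
  unfold varConst
  gcongr

theorem covariance_eq_integral_mul {Ω : Type*} [MeasurableSpace Ω] {μ : Measure Ω} {U V : Ω → ℝ}
    (hU : ∫ ω, U ω ∂μ = 0) (hV : ∫ ω, V ω ∂μ = 0) : cov[U, V; μ] = ∫ ω, U ω * V ω ∂μ := by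
  simp [covariance, hU, hV]

namespace Model

variable {k r m : ℕ} {Ω : Type*} [mΩ : MeasurableSpace Ω] (S : Model k r m Ω)

/-! ### Lagged second moments of `W` -/

/-- The vectorization of `W_t`. -/
def vecW (t : ℤ) (ω : Ω) (e : Fin S.p × Fin S.q) : ℝ := S.W t ω e.1 e.2

/-- The averaged lagged covariance of `vec W`. -/
def lagCov (h : ℕ) : Matrix (Fin S.p × Fin S.q) (Fin S.p × Fin S.q) ℝ :=
  avgLagCov S.μ S.T h S.vecW S.vecW

/-- The error of the sample lagged covariance of `vec W`. -/
def lagErr (h : ℕ) (ω : Ω) : Matrix (Fin S.p × Fin S.q) (Fin S.p × Fin S.q) ℝ :=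
  avgLagProd S.T h (fun t => S.vecW t ω) (fun t => S.vecW t ω) - S.lagCov h

/-- `∑ ‖T⁻¹ ∑_t W_{t,xg} X_{t,lg}‖²` over all `x`, `g`, `l`. -/
def crossErr (ω : Ω) : ℝ :=
  ∑ x, ∑ g, ∑ l, ((S.T : ℝ)⁻¹ * ∑ t ∈ S.times, S.W t ω x g * S.X t ω l g) ^ 2

/-- The squared errors of the sample second moments of the regressors. -/
def regErr (ω : Ω) : ℝ :=
  ∑ l, ∑ l', ∑ g, ((S.T : ℝ)⁻¹ * ∑ t ∈ S.times, S.X t ω l g * S.X t ω l' g -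
    (S.T : ℝ)⁻¹ * ∑ t ∈ S.times, ∫ ω, S.X t ω l g * S.X t ω l' g ∂S.μ) ^ 2

/-- The total squared scale of `W_t`. -/
def scaleSq : ℝ := ∑ e : Fin S.p × Fin S.q, S.scale e.1 e.2 ^ 2

variable {S}

theorem mem_times_of_mem_Icc {h : ℕ} {t : ℤ} (ht : t ∈ Finset.Icc (1 : ℤ) ((S.T : ℤ) - (h : ℤ))) :
    t ∈ S.times ∧ t + h ∈ S.times := by
  rw [Finset.mem_Icc] at ht
  simp only [times, Finset.mem_Icc]
  omega

theorem abs_avg_le {T h : ℕ} (hh : h < T) {f : ℤ → ℝ} {c : ℝ}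
    (hf : ∀ t ∈ Finset.Icc (1 : ℤ) ((T : ℤ) - (h : ℤ)), |f t| ≤ c) :
    |((T : ℝ) - h)⁻¹ * ∑ t ∈ Finset.Icc (1 : ℤ) ((T : ℤ) - (h : ℤ)), f t| ≤ c := by
  have hpos : 0 < (T : ℝ) - h := by
    have : (h : ℝ) < T := by exact_mod_cast hh
    linarith
  have hcard : ((Finset.Icc (1 : ℤ) ((T : ℤ) - (h : ℤ))).card : ℝ) = (T : ℝ) - h := by
    have : (Finset.Icc (1 : ℤ) ((T : ℤ) - (h : ℤ))).card = T - h := by rw [Int.card_Icc]; omega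
    rw [this, Nat.cast_sub hh.le]
  rw [abs_mul, abs_of_pos (inv_pos.2 hpos), inv_mul_le_iff₀ hpos]
  refine (Finset.abs_sum_le_sum_abs _ _).trans ((Finset.sum_le_sum hf).trans_eq ?_)
  rw [Finset.sum_const, nsmul_eq_mul, hcard]

section Bounds

variable {γ D B : ℝ} {h₀ : ℕ} (hγ : 2 < γ) (hD : 0 ≤ D) (hM : S.MomentsLe (2 * γ) D)
  (hS : S.Standing) (hT : 1 ≤ S.T) (hhT : 2 * h₀ ≤ S.T)
  (hs : Summable fun l : ℕ => alphaMixing S.μ S.obsSigma (l + 1) ^ (1 - 2 / γ))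
  (hB : ∑' l : ℕ, alphaMixing S.μ S.obsSigma (l + 1) ^ (1 - 2 / γ) ≤ B)

include hγ hM hS in
theorem lagCov_apply {h : ℕ} (hh : 1 ≤ h) (e f : Fin S.p × Fin S.q) :
    S.lagCov h e f = ∑ a : Fin k × Fin r, ∑ b : Fin k × Fin r,
      (S.R e.1 a.1 * S.C e.2 a.2) * (S.R f.1 b.1 * S.C f.2 b.2) * S.Sigmaf h a b := by
  have e1 : S.lagCov h e f = ((S.T : ℝ) - h)⁻¹ *
      ∑ t ∈ Finset.Icc (1 : ℤ) ((S.T : ℤ) - (h : ℤ)),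
        ∑ a : Fin k × Fin r, ∑ b : Fin k × Fin r,
          (S.R e.1 a.1 * S.C e.2 a.2) * (S.R f.1 b.1 * S.C f.2 b.2) *
            cov[fun ω => S.F t ω a.1 a.2, fun ω => S.F (t + h) ω b.1 b.2; S.μ] := by
    rw [lagCov, avgLagCov, Matrix.of_apply]
    congr 1
    refine Finset.sum_congr rfl fun t ht => ?_
    obtain ⟨h1, h2⟩ := mem_times_of_mem_Icc ht
    exact hM.cov_W_W (by linarith) hS h1 h2 (by omega) e.1 f.1 e.2 f.2
  rw [e1, Finset.sum_comm, Finset.mul_sum]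
  refine Finset.sum_congr rfl fun a _ => ?_
  rw [Finset.sum_comm, Finset.mul_sum]
  refine Finset.sum_congr rfl fun b _ => ?_
  rw [← Finset.mul_sum, Sigmaf, avgLagCov, Matrix.of_apply]
  ring

include hγ hM hS in
theorem abs_Sigmaf_le {h : ℕ} (hh : h < S.T) (a b : Fin k × Fin r) :
    |S.Sigmaf h a b| ≤ 1 + D := by
  rw [Sigmaf, avgLagCov, Matrix.of_apply]
  refine abs_avg_le hh fun t ht => ?_
  obtain ⟨h1, h2⟩ := mem_times_of_mem_Icc ht
  rw [covariance_eq_integral_mul (hS.mean_F t h1 _ _) (hS.mean_F _ h2 _ _)]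
  have i1 := ((hM t h1).1 a.1 a.2).meanLe_sq (S.measurable_F _ _ _) (by linarith)
  have i2 := ((hM _ h2).1 b.1 b.2).meanLe_sq (S.measurable_F _ _ _) (by linarith)
  have i3 := (i1.add i2).const_mul (by norm_num : (0 : ℝ) ≤ 1 / 2)
  have hint := (hM.memLp_F (by linarith) h1 a.1 a.2).integrable_mul
    (hM.memLp_F (by linarith) h2 b.1 b.2)
  calc _ ≤ ∫ ω, |S.F t ω a.1 a.2 * S.F (t + h) ω b.1 b.2| ∂S.μ := abs_integral_le_integral_abs
    _ ≤ _ := integral_mono hint.abs i3.1 fun ω => by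
      simp only
      rw [abs_le]
      constructor <;>
        nlinarith [sq_nonneg (S.F t ω a.1 a.2 + S.F (t + h) ω b.1 b.2),
          sq_nonneg (S.F t ω a.1 a.2 - S.F (t + h) ω b.1 b.2)]
    _ ≤ _ := i3.2
    _ = _ := by ring

include hγ hM hS in
-- Since the noise is absent, the size is set by the loadings alone: of order x = p^(1-δ₁) q^(1-δ₂),
-- not pq.
theorem frobSq_lagCov_le {h : ℕ} (hh : 1 ≤ h) (hhT : h < S.T) :
    frobSq (S.lagCov h) ≤ ((1 + D) * ((k * frobSq S.R) * (r * frobSq S.C))) ^ 2 := by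
  have hl : ∑ e : Fin S.p × Fin S.q, S.loading e.1 e.2 ^ 2 ≤
      (k * frobSq S.R) * (r * frobSq S.C) := by
    rw [Fintype.sum_prod_type]; exact S.sum_loading_sq_le
  have hl0 : 0 ≤ ∑ e : Fin S.p × Fin S.q, S.loading e.1 e.2 ^ 2 :=
    Finset.sum_nonneg fun _ _ => sq_nonneg _
  have hent : ∀ e f, |S.lagCov h e f| ≤ (1 + D) * (S.loading e.1 e.2 * S.loading f.1 f.2) := by
    intro e f
    rw [lagCov_apply hγ hM hS hh]
    simp only [loading_eq]
    rw [Finset.sum_mul_sum, Finset.mul_sum]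
    refine (Finset.abs_sum_le_sum_abs _ _).trans (Finset.sum_le_sum fun a _ => ?_)
    rw [Finset.mul_sum]
    refine (Finset.abs_sum_le_sum_abs _ _).trans (Finset.sum_le_sum fun b _ => ?_)
    rw [abs_mul, abs_mul (_ * _) (_ * _), mul_comm]
    exact mul_le_mul_of_nonneg_right (abs_Sigmaf_le hγ hM hS hhT a b) (by positivity)
  calc frobSq (S.lagCov h) ≤ ∑ e : Fin S.p × Fin S.q, ∑ f : Fin S.p × Fin S.q,
        (1 + D) ^ 2 * (S.loading e.1 e.2 ^ 2 * S.loading f.1 f.2 ^ 2) := by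
        refine Finset.sum_le_sum fun e _ => Finset.sum_le_sum fun f _ => ?_
        rw [← sq_abs, ← mul_pow, ← mul_pow]
        exact pow_le_pow_left₀ (abs_nonneg _) (hent e f) 2
    _ = (1 + D) ^ 2 * (∑ e : Fin S.p × Fin S.q, S.loading e.1 e.2 ^ 2) ^ 2 := by
      simp only [← Finset.mul_sum, ← Finset.sum_mul, sq]
    _ ≤ _ := by
      rw [mul_pow]
      gcongr

include hγ hM hS hT hhT hs hB hD

/-- The entry (e, f) has mean squared error of order scale_e² scale_f² / T, and the double sum of
these weights factors. -/
theorem meanLe_frobSq_lagErr {h : ℕ} (hh : h ≤ h₀) :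
    MeanLe S.μ (fun ω => frobSq (S.lagErr h ω))
      (S.scaleSq ^ 2 * (2 * varConst (2 * ((k * r + 1) * D)) h₀ B / S.T)) := by
  have hD' : 0 ≤ 2 * ((k * r + 1) * D) := by positivity
  refine MeanLe.mono (MeanLe.sum fun e _ => MeanLe.sum (c := fun f : Fin S.p × Fin S.q =>
    S.scale e.1 e.2 ^ 2 * S.scale f.1 f.2 ^ 2 *
      (2 * varConst (2 * ((k * r + 1) * D)) h B / S.T)) fun f _ => ?_) ?_
  · have := integral_avg_mul_sub_sq_le S.obsSigma_le hγ hT (by omega : 2 * h ≤ S.T) hs hB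
      (fun t => S.measurable_obsSigma_W t e.1 e.2) (fun t => S.measurable_obsSigma_W t f.1 f.2)
      (S.scale_pos e.1 e.2) (S.scale_pos f.1 f.2) (fun t ht => hM.W (by linarith) ht e.1 e.2)
      (fun t ht => hM.W (by linarith) ht f.1 f.2)
    have e1 : S.lagCov h e f = ((S.T : ℝ) - h)⁻¹ *
        ∑ t ∈ Finset.Icc (1 : ℤ) ((S.T : ℤ) - (h : ℤ)),
          ∫ ω, S.W t ω e.1 e.2 * S.W (t + h) ω f.1 f.2 ∂S.μ := by
      rw [lagCov, avgLagCov, Matrix.of_apply]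
      congr 1
      refine Finset.sum_congr rfl fun t ht => ?_
      obtain ⟨h1, h2⟩ := mem_times_of_mem_Icc ht
      exact covariance_eq_integral_mul (hM.integral_W (by linarith) hS h1 _ _)
        (hM.integral_W (by linarith) hS h2 _ _)
    simp only [lagErr, Matrix.sub_apply, e1]
    exact this
  · simp only [← Finset.sum_mul, ← Finset.mul_sum, scaleSq, ← sq]
    have := varConst_mono (B := B) hD' hh
    gcongr

omit hhT in
-- The products W X at equal times have mean zero, because `W` is centred and uncorrelated with X;
-- the regressors themselves need not be centred. The variance bound is used at lag 0.
theorem meanLe_crossErr : MeanLe S.μ S.crossErr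
    (m * S.scaleSq * (2 * varConst (2 * ((k * r + 1) * D)) h₀ B / S.T)) := by
  have hD' : 0 ≤ 2 * ((k * r + 1) * D) := by positivity
  have hDD : D ≤ (k * r + 1) * D := le_mul_of_one_le_left hD (by
    have : (0 : ℝ) ≤ k * r := by positivity
    linarith)
  refine MeanLe.mono (MeanLe.sum fun x _ => MeanLe.sum fun g _ => MeanLe.sum (c := fun l =>
    S.scale x g ^ 2 * 1 ^ 2 *
      (2 * varConst (2 * ((k * r + 1) * D)) 0 B / S.T)) fun l _ => ?_) ?_
  · have := integral_avg_mul_sub_sq_le (h := 0) S.obsSigma_le hγ hT (by omega) hs hB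
      (fun t => S.measurable_obsSigma_W t x g) (fun t => S.measurable_obsSigma_X t l g)
      (S.scale_pos x g) one_pos (fun t ht => hM.W (by linarith) ht x g)
      (fun t ht => by simpa only [div_one] using ((hM t ht).2.1 l g).mono hDD)
    have e1 : ∑ t ∈ Finset.Icc (1 : ℤ) (S.T : ℤ), ∫ ω, S.W t ω x g * S.X t ω l g ∂S.μ = 0 := by
      refine Finset.sum_eq_zero fun t ht => ?_
      have h1 := hM.cov_W_X (by linarith) hS ht x g l
      rw [covariance_eq_sub (hM.memLp_W (by linarith) ht x g) (hM.memLp_X (by linarith) ht l g),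
        hM.integral_W (by linarith) hS ht, zero_mul, sub_zero] at h1
      exact h1
    simp only [Nat.cast_zero, sub_zero, add_zero, e1, mul_zero] at this
    exact this
  · simp only [one_pow, mul_one, Finset.sum_const, Finset.card_univ, Fintype.card_fin,
      nsmul_eq_mul, ← Finset.mul_sum, ← Finset.sum_mul, scaleSq, Fintype.sum_prod_type]
    have := varConst_mono (B := B) hD' (Nat.zero_le h₀)
    have h0 : 0 ≤ ∑ x, ∑ g, S.scale x g ^ 2 :=
      Finset.sum_nonneg fun _ _ => Finset.sum_nonneg fun _ _ => sq_nonneg _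
    rw [← mul_assoc]
    gcongr

omit hS hhT in
theorem meanLe_regErr : MeanLe S.μ S.regErr
    (m * m * S.q * (2 * varConst (2 * ((k * r + 1) * D)) h₀ B / S.T)) := by
  have hD' : 0 ≤ 2 * ((k * r + 1) * D) := by positivity
  have hDD : D ≤ (k * r + 1) * D := le_mul_of_one_le_left hD (by
    have : (0 : ℝ) ≤ k * r := by positivity
    linarith)
  refine MeanLe.mono (MeanLe.sum fun l _ => MeanLe.sum fun l' _ => MeanLe.sum (c := fun g =>
    1 ^ 2 * 1 ^ 2 * (2 * varConst (2 * ((k * r + 1) * D)) 0 B / S.T)) fun g _ => ?_) ?_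
  · have := integral_avg_mul_sub_sq_le (h := 0) S.obsSigma_le hγ hT (by omega) hs hB
      (fun t => S.measurable_obsSigma_X t l g) (fun t => S.measurable_obsSigma_X t l' g)
      one_pos one_pos
      (fun t ht => by simpa only [div_one] using ((hM t ht).2.1 l g).mono hDD)
      (fun t ht => by simpa only [div_one] using ((hM t ht).2.1 l' g).mono hDD)
    simp only [Nat.cast_zero, sub_zero, add_zero] at this
    exact this
  · simp only [one_pow, one_mul, Finset.sum_const, Finset.card_univ, Fintype.card_fin,
      nsmul_eq_mul]
    have := varConst_mono (B := B) hD' (Nat.zero_le h₀)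
    simp only [mul_assoc]
    gcongr

omit hs hB hD hS hhT in
theorem meanLe_frobSq_X :
    MeanLe S.μ (fun ω => (S.T : ℝ)⁻¹ * ∑ t ∈ S.times, frobSq (S.X t ω)) (m * S.q * (1 + D)) := by
  have hT0 : (0 : ℝ) < S.T := by exact_mod_cast hT
  refine MeanLe.mono (MeanLe.const_mul (MeanLe.sum fun t ht => MeanLe.sum fun l _ => MeanLe.sum
    fun g _ => ((hM t ht).2.1 l g).meanLe_sq (S.measurable_X _ _ _) (by linarith))
    (by positivity)) (le_of_eq ?_)
  simp only [Finset.sum_const, Finset.card_univ, Fintype.card_fin, nsmul_eq_mul, times,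
    Int.card_Icc, add_sub_cancel_right, Int.toNat_natCast]
  field_simp

omit hs hB hD hS hhT in
theorem meanLe_frobSq_W :
    MeanLe S.μ (fun ω => (S.T : ℝ)⁻¹ * ∑ t ∈ S.times, frobSq (S.W t ω))
      (S.scaleSq * (1 + (k * r + 1) * D)) := by
  have hT0 : (0 : ℝ) < S.T := by exact_mod_cast hT
  refine MeanLe.mono (MeanLe.const_mul (MeanLe.sum fun t ht => MeanLe.sum fun x _ => MeanLe.sum
    (c := fun g => S.scale x g ^ 2 * (1 + (k * r + 1) * D))
    fun g _ => ?_) (by positivity)) (le_of_eq ?_)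
  · have := ((hM.W (by linarith) ht x g).meanLe_sq ((S.measurable_W t x g).div_const _)
      (by linarith)).const_mul (sq_nonneg (S.scale x g))
    have e : ∀ ω, S.scale x g ^ 2 * (S.W t ω x g / S.scale x g) ^ 2 = S.W t ω x g ^ 2 := by
      intro ω
      rw [← mul_pow, mul_div_cancel₀ _ (S.scale_pos x g).ne']
    simpa only [e] using this
  · simp only [Finset.sum_const, ← Finset.sum_mul, scaleSq, Fintype.sum_prod_type, nsmul_eq_mul,
      times, Int.card_Icc, add_sub_cancel_right, Int.toNat_natCast]
    field_simp

end Bounds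

end Model

/-! ### Deterministic error bounds -/

/-- By Cauchy–Schwarz, κ‖d‖² ≤ ⟨dM, d⟩ ≤ ‖dM‖‖d‖. -/
theorem sq_mul_le_dotProduct_vecMul {ι : Type*} [Fintype ι] {M : Matrix ι ι ℝ} {κ : ℝ} (hκ : 0 ≤ κ)
    (hM : ∀ z, κ * (z ⬝ᵥ z) ≤ z ⬝ᵥ (M *ᵥ z)) (d : ι → ℝ) :
    κ ^ 2 * (d ⬝ᵥ d) ≤ (d ᵥ* M) ⬝ᵥ (d ᵥ* M) := by
  have h0 := dotProduct_self_nonneg d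
  have h1 := hM d
  rw [Matrix.dotProduct_mulVec] at h1
  have h2 := dotProduct_sq_le (d ᵥ* M) d
  rcases h0.eq_or_lt with h | h
  · rw [← h, mul_zero]; exact dotProduct_self_nonneg _
  · refine le_of_mul_le_mul_right ?_ h
    calc _ = (κ * (d ⬝ᵥ d)) ^ 2 := by ring
      _ ≤ (d ᵥ* M ⬝ᵥ d) ^ 2 := pow_le_pow_left₀ (by positivity) h1 2
      _ ≤ _ := h2

theorem isUnit_det_of_le_quadratic {ι : Type*} [Fintype ι] [DecidableEq ι] {M : Matrix ι ι ℝ}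
    {κ : ℝ} (hκ : 0 < κ) (hM : ∀ z, κ * (z ⬝ᵥ z) ≤ z ⬝ᵥ (M *ᵥ z)) : IsUnit M.det := by
  rw [isUnit_iff_ne_zero]
  intro h
  obtain ⟨v, hv, hv0⟩ := Matrix.exists_mulVec_eq_zero_iff.2 h
  have h1 := hM v
  rw [hv0, dotProduct_zero] at h1
  have h2 : 0 < v ⬝ᵥ v := lt_of_le_of_ne (dotProduct_self_nonneg v)
    (Ne.symm fun h => hv (dotProduct_self_eq_zero.1 h))
  nlinarith

theorem avg_mul_sq_le {α : Type*} (s : Finset α) {c : ℝ} (u v : α → ℝ) :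
    (c * ∑ t ∈ s, u t * v t) ^ 2 ≤ (c * ∑ t ∈ s, u t ^ 2) * (c * ∑ t ∈ s, v t ^ 2) := by
  have := mul_le_mul_of_nonneg_left (Finset.sum_mul_sq_le_sq_mul_sq s u v) (sq_nonneg c)
  calc _ = c ^ 2 * (∑ t ∈ s, u t * v t) ^ 2 := by ring
    _ ≤ _ := this
    _ = _ := by ring

/-- Cauchy–Schwarz in time, entry by entry. Both the original and the shifted window lie in 1, …, T,
and (T-h)⁻¹ ≤ 2/T enters twice. -/
theorem frobSq_avgLagProd_le {α β : Type*} [Fintype α] [Fintype β] {T h : ℕ} (hT : 1 ≤ T)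
    (hhT : 2 * h ≤ T) (u : ℤ → α → ℝ) (v : ℤ → β → ℝ) :
    frobSq (avgLagProd T h u v) ≤
      4 * (((T : ℝ)⁻¹ * ∑ t ∈ Finset.Icc (1 : ℤ) T, ∑ e, u t e ^ 2) *
        ((T : ℝ)⁻¹ * ∑ t ∈ Finset.Icc (1 : ℤ) T, ∑ f, v t f ^ 2)) := by
  have hT0 : (0 : ℝ) < T := by exact_mod_cast hT
  have hTh : (T : ℝ) / 2 ≤ (T : ℝ) - h := by
    have : (2 * h : ℝ) ≤ T := by exact_mod_cast hhT
    linarith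
  have hN0 : 0 < (T : ℝ) - h := by linarith
  have hinv : ((T : ℝ) - h)⁻¹ ≤ 2 * (T : ℝ)⁻¹ := by
    calc _ ≤ ((T : ℝ) / 2)⁻¹ := inv_anti₀ (by positivity) hTh
      _ = _ := by field_simp
  set F := Finset.Icc (1 : ℤ) ((T : ℤ) - (h : ℤ)) with hF
  have h1 : ∑ t ∈ F, ∑ e, u t e ^ 2 ≤ ∑ t ∈ Finset.Icc (1 : ℤ) T, ∑ e, u t e ^ 2 := by
    refine Finset.sum_le_sum_of_subset_of_nonneg (fun t ht => ?_)
      fun _ _ _ => Finset.sum_nonneg fun _ _ => sq_nonneg _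
    rw [hF, Finset.mem_Icc] at ht
    rw [Finset.mem_Icc]; omega
  have h2 : ∑ t ∈ F, ∑ f, v (t + h) f ^ 2 ≤ ∑ t ∈ Finset.Icc (1 : ℤ) T, ∑ f, v t f ^ 2 := by
    rw [← Finset.sum_image (s := F) (g := fun t => t + (h : ℤ)) (f := fun t => ∑ f, v t f ^ 2)
      (fun x _ y _ hxy => by simpa using hxy)]
    refine Finset.sum_le_sum_of_subset_of_nonneg (fun t ht => ?_)
      fun _ _ _ => Finset.sum_nonneg fun _ _ => sq_nonneg _
    obtain ⟨t', ht', rfl⟩ := Finset.mem_image.1 ht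
    rw [hF, Finset.mem_Icc] at ht'
    rw [Finset.mem_Icc]; omega
  have hu0 : 0 ≤ ∑ t ∈ F, ∑ e, u t e ^ 2 :=
    Finset.sum_nonneg fun _ _ => Finset.sum_nonneg fun _ _ => sq_nonneg _
  have hv0 : 0 ≤ ∑ t ∈ F, ∑ f, v (t + h) f ^ 2 :=
    Finset.sum_nonneg fun _ _ => Finset.sum_nonneg fun _ _ => sq_nonneg _
  calc frobSq (avgLagProd T h u v)
      ≤ ∑ e, ∑ f, (((T : ℝ) - h)⁻¹ * ∑ t ∈ F, u t e ^ 2) *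
          (((T : ℝ) - h)⁻¹ * ∑ t ∈ F, v (t + h) f ^ 2) :=
        Finset.sum_le_sum fun e _ => Finset.sum_le_sum fun f _ => avg_mul_sq_le F _ _
    _ = (((T : ℝ) - h)⁻¹ * ∑ t ∈ F, ∑ e, u t e ^ 2) *
          (((T : ℝ) - h)⁻¹ * ∑ t ∈ F, ∑ f, v (t + h) f ^ 2) := by
      rw [← Finset.sum_mul_sum, ← Finset.mul_sum, ← Finset.mul_sum, Finset.sum_comm,
        Finset.sum_comm (s := Finset.univ)]
    _ ≤ (2 * (T : ℝ)⁻¹ * ∑ t ∈ Finset.Icc (1 : ℤ) T, ∑ e, u t e ^ 2) *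
          (2 * (T : ℝ)⁻¹ * ∑ t ∈ Finset.Icc (1 : ℤ) T, ∑ f, v t f ^ 2) := by gcongr
    _ = _ := by ring

/-- Column pairs and row pairs are two ways of cutting the same matrix into blocks, and the sum of
squares does not depend on the cut. So M₁ and M₂ share their error bounds. -/
theorem sum_frobSq_columns {p q : ℕ} (G : Matrix (Fin p × Fin q) (Fin p × Fin q) ℝ) :
    ∑ i, ∑ j, frobSq (Matrix.of fun x y => G (x, i) (y, j)) = frobSq G := by
  simp only [frobSq, Fintype.sum_prod_type, Matrix.of_apply]
  rw [Finset.sum_congr rfl fun i _ => Finset.sum_comm, Finset.sum_comm]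
  exact Finset.sum_congr rfl fun x _ => Finset.sum_congr rfl fun i _ => Finset.sum_comm

theorem sum_frobSq_rows {p q : ℕ} (G : Matrix (Fin p × Fin q) (Fin p × Fin q) ℝ) :
    ∑ x, ∑ y, frobSq (Matrix.of fun i j => G (x, i) (y, j)) = frobSq G := by
  simp only [frobSq, Fintype.sum_prod_type, Matrix.of_apply]
  refine Finset.sum_congr rfl fun x _ => ?_
  rw [Finset.sum_comm]

theorem sqrt_frobSq_sampleM_sub_popM_le {Ω : Type*} [MeasurableSpace Ω] {μ : Measure Ω} {p q : ℕ}
    {T h₀ : ℕ} {w : ℤ → Matrix (Fin p) (Fin q) ℝ} {W : ℤ → Ω → Matrix (Fin p) (Fin q) ℝ}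
    {a b : ℝ} (ha : 0 ≤ a) (hb : 0 ≤ b)
    (hpop : ∑ h ∈ Finset.Icc 1 h₀, ∑ i : Fin q, ∑ j : Fin q, frobSq
      (avgLagCov μ T h (fun t ω x => W t ω x i) (fun t ω x => W t ω x j)) ≤ b ^ 2)
    (herr : ∑ h ∈ Finset.Icc 1 h₀, ∑ i : Fin q, ∑ j : Fin q, frobSq
      (avgLagProd T h (fun t x => w t x i) (fun t x => w t x j) -
        avgLagCov μ T h (fun t ω x => W t ω x i) (fun t ω x => W t ω x j)) ≤ a ^ 2) :
    √(frobSq (sampleM T h₀ w - popM μ T h₀ W)) ≤ a ^ 2 + 2 * a * b := by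
  have := sqrt_frobSq_sum_mul_transpose_sub_le
    (Finset.Icc 1 h₀ ×ˢ (Finset.univ : Finset (Fin q × Fin q)))
    (fun e => avgLagCov μ T e.1 (fun t ω x => W t ω x e.2.1) (fun t ω x => W t ω x e.2.2))
    (fun e => avgLagProd T e.1 (fun t x => w t x e.2.1) (fun t x => w t x e.2.2)) ha hb
    (by simpa only [Finset.sum_product, Fintype.sum_prod_type] using hpop)
    (by simpa only [Finset.sum_product, Fintype.sum_prod_type] using herr)
  simpa only [Finset.sum_product, Fintype.sum_prod_type, sampleM, popM] using this

/-- The error of the leading eigenvectors of a sample matrix: `x` is the strength of the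
factors and `η` the rate. -/
theorem subspaceDist_le_of_loadedCov {Ω : Type*} [MeasurableSpace Ω] {μ : Measure Ω}
    {a b k r T h₀ : ℕ} (hk : 1 ≤ k) (hka : k ≤ a) (L : Matrix (Fin a) (Fin k) ℝ)
    (N : Matrix (Fin b) (Fin r) ℝ) {w : ℤ → Matrix (Fin a) (Fin b) ℝ}
    {W : ℤ → Ω → Matrix (Fin a) (Fin b) ℝ} {Φ : ℤ → Ω → Matrix (Fin k) (Fin r) ℝ}
    (hΩ : ∀ h ∈ Finset.Icc 1 h₀, ∀ i j,
      avgLagCov μ T h (fun t ω x => W t ω x i) (fun t ω x => W t ω x j) = loadedCov L N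
        (fun c d => avgLagCov μ T h (fun t ω x => Φ t ω x c) (fun t ω x => Φ t ω x d)) i j)
    {c : ℝ} (hc0 : 0 ≤ c) (hc : c ≤ nthEig (popM μ T h₀ Φ) (k - 1))
    {Q Q' : Matrix (Fin a) (Fin k) ℝ} (hQ : IsLeadingEigenvectors (popM μ T h₀ W) Q)
    (hpos : ∀ j < k, 0 < nthEig (popM μ T h₀ W) j)
    (hQ' : IsLeadingEigenvectors (sampleM T h₀ w) Q')
    {x η cs Ka Kb : ℝ} (hx : 0 < x) (hη0 : 0 ≤ η) (hη1 : η ≤ 1) (hcs : 0 < cs) (hKa : 0 ≤ Ka)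
    (hKb : 0 ≤ Kb)
    (hsig : cs * x ^ 2 ≤ c * (singVal L (k - 1) ^ 2) ^ 2 * (singVal N (r - 1) ^ 2) ^ 2)
    (hpop : ∑ h ∈ Finset.Icc 1 h₀, ∑ i : Fin b, ∑ j : Fin b, frobSq
      (avgLagCov μ T h (fun t ω x => W t ω x i) (fun t ω x => W t ω x j)) ≤ (Kb * x) ^ 2)
    (herr : ∑ h ∈ Finset.Icc 1 h₀, ∑ i : Fin b, ∑ j : Fin b, frobSq
      (avgLagProd T h (fun t x => w t x i) (fun t x => w t x j) -
        avgLagCov μ T h (fun t ω x => W t ω x i) (fun t ω x => W t ω x j)) ≤ (Ka * x * η) ^ 2)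
    (hη : (Ka ^ 2 + 2 * Ka * Kb) * η ≤ cs / 2) :
    subspaceDist Q' Q ≤ 2 / cs * (Ka ^ 2 + 2 * Ka * Kb) * η := by
  obtain ⟨⟨B, hB⟩, hquad⟩ := popM_of_loadedCov L N hΩ hc0 hc
  have hΔ : √(frobSq (sampleM T h₀ w - popM μ T h₀ W)) ≤
      (Ka ^ 2 + 2 * Ka * Kb) * η * x ^ 2 := by
    refine (sqrt_frobSq_sampleM_sub_popM_le (by positivity) (by positivity) hpop herr).trans ?_
    -- The quadratic term a² of the perturbation is absorbed into the order of ab.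
    have : η ^ 2 ≤ η := by nlinarith
    calc _ = (Ka ^ 2 * η ^ 2 + 2 * Ka * Kb * η) * x ^ 2 := by ring
      _ ≤ (Ka ^ 2 * η + 2 * Ka * Kb * η) * x ^ 2 := by gcongr
      _ = _ := by ring
  have hx2 : 0 < x ^ 2 := by positivity
  have hs : ∀ z, cs * x ^ 2 * ((L *ᵥ z) ⬝ᵥ (L *ᵥ z)) ≤
      (L *ᵥ z) ⬝ᵥ (popM μ T h₀ W *ᵥ (L *ᵥ z)) := fun z =>
    (mul_le_mul_of_nonneg_right hsig (dotProduct_self_nonneg _)).trans (hquad z)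
  have := subspaceDist_le_of_eigenvectors hk hka hB (sampleM_isHermitian T h₀ w) hQ hpos hQ'
    (by positivity : 0 < cs * x ^ 2) hs (hΔ.trans (by nlinarith))
  refine this.trans ((mul_le_mul_of_nonneg_left hΔ (by positivity)).trans_eq ?_)
  field_simp

/-! ### Least squares and the replacement of `W` by residuals. -/

namespace Model

variable {k r m : ℕ} {Ω : Type*} [mΩ : MeasurableSpace Ω] (S : Model k r m Ω)

/-- The sample second moment of the regressors. -/
def regMoment (ω : Ω) : Matrix (Fin m) (Fin m) ℝ :=
  (S.T : ℝ)⁻¹ • ∑ t ∈ S.times, S.X t ω * (S.X t ω)ᵀ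

/-- The sample cross moment of `W` and the regressors. -/
def crossMoment (ω : Ω) : Matrix (Fin S.p) (Fin m) ℝ :=
  (S.T : ℝ)⁻¹ • ∑ t ∈ S.times, S.W t ω * (S.X t ω)ᵀ

/-- These are the normal equations. Invertibility is needed because the inverse in `Ahat` is a
default value at singular matrices. -/
theorem Ahat_sub_mul (ω : Ω) (h : IsUnit (S.regMoment ω).det) :
    (S.Ahat ω - S.A) * S.regMoment ω = S.crossMoment ω := by
  have e : (S.T : ℝ)⁻¹ • ∑ t ∈ S.times, S.Y t ω * (S.X t ω)ᵀ =
      S.A * S.regMoment ω + S.crossMoment ω := by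
    rw [regMoment, crossMoment, Matrix.mul_smul, ← smul_add, Matrix.mul_sum,
      ← Finset.sum_add_distrib]
    congr 1
    refine Finset.sum_congr rfl fun t _ => ?_
    rw [Y_eq, Matrix.add_mul, Matrix.mul_assoc]
  rw [Ahat, e, ← regMoment, Matrix.sub_mul, Matrix.nonsing_inv_mul_cancel_right _ _ h,
    add_sub_cancel_left]

/-- Summing over the q columns costs a factor q by Cauchy–Schwarz. With κ of order q and `crossErr`
of order pq/T this leaves p/T for ‖Â - A‖². -/
theorem sq_mul_frobSq_Ahat_sub_le (ω : Ω) {κ : ℝ} (hκ : 0 < κ)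
    (hX : ∀ z, κ * (z ⬝ᵥ z) ≤ z ⬝ᵥ (S.regMoment ω *ᵥ z)) :
    κ ^ 2 * frobSq (S.Ahat ω - S.A) ≤ S.q * S.crossErr ω := by
  have h1 : frobSq (S.crossMoment ω) ≤ S.q * S.crossErr ω := by
    rw [crossErr, frobSq, Finset.mul_sum]
    refine Finset.sum_le_sum fun x _ => ?_
    rw [Finset.sum_comm, Finset.mul_sum]
    refine Finset.sum_le_sum fun l _ => ?_
    have e : S.crossMoment ω x l =
        ∑ g, (S.T : ℝ)⁻¹ * ∑ t ∈ S.times, S.W t ω x g * S.X t ω l g := by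
      simp only [crossMoment, Matrix.smul_apply, Matrix.sum_apply, Matrix.mul_apply,
        Matrix.transpose_apply, smul_eq_mul]
      rw [Finset.sum_comm, Finset.mul_sum]
    rw [e]
    have := sq_sum_le_card_mul_sum_sq (s := Finset.univ) (f := fun g : Fin S.q =>
      (S.T : ℝ)⁻¹ * ∑ t ∈ S.times, S.W t ω x g * S.X t ω l g)
    simpa only [Finset.card_univ, Fintype.card_fin] using this
  refine le_trans ?_ h1
  rw [← S.Ahat_sub_mul ω (isUnit_det_of_le_quadratic hκ hX), frobSq, frobSq, Finset.mul_sum]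
  refine Finset.sum_le_sum fun x _ => ?_
  have := sq_mul_le_dotProduct_vecMul hκ.le hX ((S.Ahat ω - S.A) x)
  simpa only [dotProduct, ← sq] using! this

variable {S} in
theorem frobSq_regMoment_sub_le {s D : ℝ} (hs : 2 ≤ s) (hM : S.MomentsLe s D) (ω : Ω) :
    frobSq (S.regMoment ω - (S.T : ℝ)⁻¹ • ∑ t ∈ S.times, S.P t) ≤ S.q * S.regErr ω := by
  rw [regErr, frobSq, Finset.mul_sum]
  refine Finset.sum_le_sum fun l _ => ?_
  rw [Finset.mul_sum]
  refine Finset.sum_le_sum fun l' _ => ?_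
  have e : (S.regMoment ω - (S.T : ℝ)⁻¹ • ∑ t ∈ S.times, S.P t) l l' =
      ∑ g, ((S.T : ℝ)⁻¹ * ∑ t ∈ S.times, S.X t ω l g * S.X t ω l' g -
        (S.T : ℝ)⁻¹ * ∑ t ∈ S.times, ∫ ω, S.X t ω l g * S.X t ω l' g ∂S.μ) := by
    rw [Finset.sum_sub_distrib, ← Finset.mul_sum, ← Finset.mul_sum]
    simp only [regMoment, Matrix.sub_apply, Matrix.smul_apply, Matrix.sum_apply, smul_eq_mul]
    congr 2
    · rw [Finset.sum_comm]
      simp only [Matrix.mul_apply, Matrix.transpose_apply]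
    · rw [Finset.sum_comm]
      refine Finset.sum_congr rfl fun t ht => ?_
      simp only [P, Matrix.of_apply, Matrix.mul_apply, Matrix.transpose_apply]
      exact integral_finsetSum _ fun g _ =>
        (hM.memLp_X hs ht l g).integrable_mul (hM.memLp_X hs ht l' g)
  rw [e]
  have := sq_sum_le_card_mul_sum_sq (s := Finset.univ) (f := fun g : Fin S.q =>
    (S.T : ℝ)⁻¹ * ∑ t ∈ S.times, S.X t ω l g * S.X t ω l' g -
        (S.T : ℝ)⁻¹ * ∑ t ∈ S.times, ∫ ω, S.X t ω l g * S.X t ω l' g ∂S.μ)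
  simpa only [Finset.card_univ, Fintype.card_fin] using this

theorem What_eq (ω : Ω) (t : ℤ) : S.What ω t = S.W t ω - (S.Ahat ω - S.A) * S.X t ω := by
  rw [What, Y_eq, Matrix.sub_mul]
  abel

/-- The error of the sample lagged covariance of the residuals. -/
theorem frobSq_residual_lagErr_le (hT : 1 ≤ S.T) {h : ℕ} (hhT : 2 * h ≤ S.T) (ω : Ω) {d u : ℝ}
    (hd : frobSq (S.Ahat ω - S.A) * ((S.T : ℝ)⁻¹ * ∑ t ∈ S.times, frobSq (S.X t ω)) ≤ d)
    (hu : (S.T : ℝ)⁻¹ * ∑ t ∈ S.times, frobSq (S.W t ω) ≤ u) :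
    frobSq (avgLagProd S.T h (fun t (e : Fin S.p × Fin S.q) => S.What ω t e.1 e.2)
      (fun t (e : Fin S.p × Fin S.q) => S.What ω t e.1 e.2) - S.lagCov h) ≤
      4 * (frobSq (S.lagErr h ω) + 8 * (d * u) + 4 * (d * d)) := by
  set v : ℤ → Fin S.p × Fin S.q → ℝ := fun t => S.vecW t ω with hv
  set g : ℤ → Fin S.p × Fin S.q → ℝ := fun t e => ((S.Ahat ω - S.A) * S.X t ω) e.1 e.2 with hg
  have hT0 : (0 : ℝ) < S.T := by exact_mod_cast hT
  have hgd : (S.T : ℝ)⁻¹ * ∑ t ∈ Finset.Icc (1 : ℤ) S.T, ∑ e, g t e ^ 2 ≤ d := by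
    refine le_trans ?_ hd
    rw [mul_left_comm, Finset.mul_sum _ _ (frobSq _)]
    refine mul_le_mul_of_nonneg_left (Finset.sum_le_sum fun t _ => ?_) (by positivity)
    rw [Fintype.sum_prod_type]
    exact frobSq_mul_le _ _
  have hvu : (S.T : ℝ)⁻¹ * ∑ t ∈ Finset.Icc (1 : ℤ) S.T, ∑ e, v t e ^ 2 ≤ u := by
    refine le_trans (le_of_eq ?_) hu
    simp only [Fintype.sum_prod_type, hv, vecW]
    rfl
  have hg0 : 0 ≤ (S.T : ℝ)⁻¹ * ∑ t ∈ Finset.Icc (1 : ℤ) S.T, ∑ e, g t e ^ 2 :=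
    mul_nonneg (by positivity) (Finset.sum_nonneg fun _ _ => Finset.sum_nonneg fun _ _ =>
      sq_nonneg _)
  have hv0 : 0 ≤ (S.T : ℝ)⁻¹ * ∑ t ∈ Finset.Icc (1 : ℤ) S.T, ∑ e, v t e ^ 2 :=
    mul_nonneg (by positivity) (Finset.sum_nonneg fun _ _ => Finset.sum_nonneg fun _ _ =>
      sq_nonneg _)
  have hd0 : 0 ≤ d := hg0.trans hgd
  have hu0 : 0 ≤ u := hv0.trans hvu
  -- The residual is v - g. The products involving g need no cancellation: g has mean square at most
  -- d, which will be of order pq/T, and Cauchy–Schwarz is enough.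
  have b1 : frobSq (avgLagProd S.T h g v) ≤ 4 * (d * u) :=
    (frobSq_avgLagProd_le hT hhT g v).trans
      (mul_le_mul_of_nonneg_left (mul_le_mul hgd hvu hv0 hd0) (by norm_num))
  have b2 : frobSq (avgLagProd S.T h v g) ≤ 4 * (u * d) :=
    (frobSq_avgLagProd_le hT hhT v g).trans
      (mul_le_mul_of_nonneg_left (mul_le_mul hvu hgd hg0 hu0) (by norm_num))
  have b3 : frobSq (avgLagProd S.T h g g) ≤ 4 * (d * d) :=
    (frobSq_avgLagProd_le hT hhT g g).trans
      (mul_le_mul_of_nonneg_left (mul_le_mul hgd hgd hg0 hd0) (by norm_num))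
  have hent : ∀ e f, avgLagProd S.T h (fun t (e : Fin S.p × Fin S.q) => S.What ω t e.1 e.2)
      (fun t (e : Fin S.p × Fin S.q) => S.What ω t e.1 e.2) e f =
      avgLagProd S.T h v v e f - avgLagProd S.T h g v e f - avgLagProd S.T h v g e f +
        avgLagProd S.T h g g e f := by
    intro e f
    simp only [avgLagProd, Matrix.of_apply]
    rw [← mul_sub, ← mul_sub, ← mul_add, ← Finset.sum_sub_distrib, ← Finset.sum_sub_distrib,
      ← Finset.sum_add_distrib]
    congr 1
    refine Finset.sum_congr rfl fun t _ => ?_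
    simp only [What_eq, hv, hg, vecW, Matrix.sub_apply]
    ring
  have hsum : frobSq (avgLagProd S.T h (fun t (e : Fin S.p × Fin S.q) => S.What ω t e.1 e.2)
      (fun t (e : Fin S.p × Fin S.q) => S.What ω t e.1 e.2) - S.lagCov h) ≤
      4 * (frobSq (S.lagErr h ω) + frobSq (avgLagProd S.T h g v) +
        frobSq (avgLagProd S.T h v g) + frobSq (avgLagProd S.T h g g)) := by
    simp only [frobSq, ← Finset.sum_add_distrib, Finset.mul_sum]
    refine Finset.sum_le_sum fun e _ => Finset.sum_le_sum fun f _ => ?_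
    simp only [Matrix.sub_apply, hent, lagErr]
    have key : ∀ z₁ z₂ z₃ z₄ c : ℝ, (z₁ - z₂ - z₃ + z₄ - c) ^ 2 ≤
        4 * ((z₁ - c) ^ 2 + z₂ ^ 2 + z₃ ^ 2 + z₄ ^ 2) := fun z₁ z₂ z₃ z₄ c => by
      nlinarith [sq_nonneg (z₁ - c + z₂), sq_nonneg (z₁ - c + z₃), sq_nonneg (z₁ - c - z₄),
        sq_nonneg (z₂ - z₃), sq_nonneg (z₂ + z₄), sq_nonneg (z₃ + z₄)]
    exact key _ _ _ _ _
  linarith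

variable {S} in
theorem avgLagCov_columns {γ D : ℝ} (hγ : 2 < γ) (hM : S.MomentsLe (2 * γ) D) (hS : S.Standing)
    {h : ℕ} (hh : 1 ≤ h) (i j : Fin S.q) :
    avgLagCov S.μ S.T h (fun t ω x => S.W t ω x i) (fun t ω x => S.W t ω x j) =
      loadedCov S.R S.C (fun c d => avgLagCov S.μ S.T h (fun t ω x => S.F t ω x c)
        (fun t ω x => S.F t ω x d)) i j := by
  ext x y
  rw [loadedCov_apply]
  exact lagCov_apply hγ hM hS hh (x, i) (y, j)

variable {S} in
-- Transposing the model exchanges R with C and F with F', so the statement for M₂ follows after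
-- swapping the index pairs.
theorem avgLagCov_rows {γ D : ℝ} (hγ : 2 < γ) (hM : S.MomentsLe (2 * γ) D) (hS : S.Standing)
    {h : ℕ} (hh : 1 ≤ h) (x y : Fin S.p) :
    avgLagCov S.μ S.T h (fun t ω i => (S.W t ω)ᵀ i x) (fun t ω i => (S.W t ω)ᵀ i y) =
      loadedCov S.C S.R (fun c d => avgLagCov S.μ S.T h (fun t ω b => (S.F t ω)ᵀ b c)
        (fun t ω b => (S.F t ω)ᵀ b d)) x y := by
  ext i j
  rw [loadedCov_apply]
  refine (lagCov_apply hγ hM hS hh (x, i) (y, j)).trans ?_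
  refine Fintype.sum_equiv (Equiv.prodComm _ _) _ _ fun a => ?_
  refine Fintype.sum_equiv (Equiv.prodComm _ _) _ _ fun b => ?_
  simp only [Equiv.prodComm_apply, Prod.fst_swap, Prod.snd_swap]
  rw [mul_comm (S.C i a.2), mul_comm (S.C j b.2)]
  rfl

end Model

namespace Model

variable {k r m : ℕ} {Ω : Type*} [mΩ : MeasurableSpace Ω] (S : Model k r m Ω)

/-! ### The normalized total error -/

/-- The sum of the normalized errors of all sample moments. -/
def totalErr (h₀ : ℕ) (ω : Ω) : ℝ :=
  (S.T / (S.p * S.q) ^ 2 : ℝ) * ∑ h ∈ Finset.Icc 1 h₀, frobSq (S.lagErr h ω) +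
    (S.T / (S.p * S.q) : ℝ) * S.crossErr ω + (S.T / S.q : ℝ) * S.regErr ω +
      (S.q : ℝ)⁻¹ * ((S.T : ℝ)⁻¹ * ∑ t ∈ S.times, frobSq (S.X t ω)) +
        (S.p * S.q : ℝ)⁻¹ * ((S.T : ℝ)⁻¹ * ∑ t ∈ S.times, frobSq (S.W t ω))

theorem crossErr_nonneg (ω : Ω) : 0 ≤ S.crossErr ω :=
  Finset.sum_nonneg fun _ _ => Finset.sum_nonneg fun _ _ => Finset.sum_nonneg fun _ _ =>
    sq_nonneg _

theorem regErr_nonneg (ω : Ω) : 0 ≤ S.regErr ω :=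
  Finset.sum_nonneg fun _ _ => Finset.sum_nonneg fun _ _ => Finset.sum_nonneg fun _ _ =>
    sq_nonneg _

theorem avg_frobSq_nonneg {a b : ℕ} (V : ℤ → Matrix (Fin a) (Fin b) ℝ) :
    0 ≤ (S.T : ℝ)⁻¹ * ∑ t ∈ S.times, frobSq (V t) :=
  mul_nonneg (by positivity) (Finset.sum_nonneg fun _ _ => frobSq_nonneg _)

theorem sum_frobSq_lagErr_nonneg (h₀ : ℕ) (ω : Ω) :
    0 ≤ ∑ h ∈ Finset.Icc 1 h₀, frobSq (S.lagErr h ω) :=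
  Finset.sum_nonneg fun _ _ => frobSq_nonneg _

theorem totalErr_nonneg (h₀ : ℕ) (ω : Ω) : 0 ≤ S.totalErr h₀ ω := by
  have h1 := S.sum_frobSq_lagErr_nonneg h₀ ω
  have h2 := S.crossErr_nonneg ω
  have h3 := S.regErr_nonneg ω
  have h4 := S.avg_frobSq_nonneg fun t => S.X t ω
  have h5 := S.avg_frobSq_nonneg fun t => S.W t ω
  unfold totalErr
  positivity

/-- The constant in the bound for the mean of the total error. -/
def totalConst (k r m h₀ : ℕ) (D B V : ℝ) : ℝ :=
  h₀ * (V ^ 2 * (2 * varConst (2 * ((k * r + 1) * D)) h₀ B)) +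
    m * V * (2 * varConst (2 * ((k * r + 1) * D)) h₀ B) +
      m * m * (2 * varConst (2 * ((k * r + 1) * D)) h₀ B) + m * (1 + D) +
        V * (1 + (k * r + 1) * D)

variable {S}

/-- The weights in `totalErr` are the reciprocal orders of the means of its five terms, so every
dimension cancels once the total squared scale is at most V·pq. -/
theorem meanLe_totalErr {γ D B V : ℝ} {h₀ : ℕ} (hγ : 2 < γ) (hD : 0 ≤ D)
    (hM : S.MomentsLe (2 * γ) D) (hS : S.Standing) (hp : 1 ≤ S.p) (hq : 1 ≤ S.q) (hT : 1 ≤ S.T)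
    (hhT : 2 * h₀ ≤ S.T)
    (hs : Summable fun l : ℕ => alphaMixing S.μ S.obsSigma (l + 1) ^ (1 - 2 / γ))
    (hB : ∑' l : ℕ, alphaMixing S.μ S.obsSigma (l + 1) ^ (1 - 2 / γ) ≤ B)
    (hV : S.scaleSq ≤ V * (S.p * S.q)) :
    MeanLe S.μ (S.totalErr h₀) (totalConst k r m h₀ D B V) := by
  have hp0 : (0 : ℝ) < S.p := by exact_mod_cast hp
  have hq0 : (0 : ℝ) < S.q := by exact_mod_cast hq
  have hT0 : (0 : ℝ) < S.T := by exact_mod_cast hT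
  have hB0 : 0 ≤ B := (tsum_nonneg fun l => Real.rpow_nonneg (alphaMixing_nonneg _) _).trans hB
  have hsc : 0 ≤ S.scaleSq := Finset.sum_nonneg fun _ _ => sq_nonneg _
  set κ := 2 * varConst (2 * ((k * r + 1) * D)) h₀ B with hκ
  have hκ0 : 0 ≤ κ := by rw [hκ, varConst]; positivity
  refine MeanLe.mono (((((MeanLe.sum fun h hh => meanLe_frobSq_lagErr hγ hD hM hS hT hhT hs hB
    (Finset.mem_Icc.1 hh).2).const_mul (by positivity)).add
    ((meanLe_crossErr hγ hD hM hS hT hs hB (h₀ := h₀)).const_mul (by positivity))).add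
    ((meanLe_regErr hγ hD hM hT hs hB (h₀ := h₀)).const_mul (by positivity))).add
    ((meanLe_frobSq_X hγ hM hT).const_mul (by positivity)) |>.add
    ((meanLe_frobSq_W hγ hM hT).const_mul (by positivity))) ?_
  simp only [Finset.sum_const, Nat.card_Icc, add_tsub_cancel_right, nsmul_eq_mul]
  rw [← hκ, totalConst, ← hκ]
  have a1 : (S.T / (S.p * S.q) ^ 2 : ℝ) * (h₀ * (S.scaleSq ^ 2 * (κ / S.T))) ≤
      h₀ * (V ^ 2 * κ) := by
    calc _ ≤ (S.T / (S.p * S.q) ^ 2 : ℝ) * (h₀ * ((V * (S.p * S.q)) ^ 2 * (κ / S.T))) := by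
          gcongr
      _ = _ := by field_simp
  have a2 : (S.T / (S.p * S.q) : ℝ) * (m * S.scaleSq * (κ / S.T)) ≤ m * V * κ := by
    calc _ ≤ (S.T / (S.p * S.q) : ℝ) * (m * (V * (S.p * S.q)) * (κ / S.T)) := by gcongr
      _ = _ := by field_simp
  have a3 : (S.T / S.q : ℝ) * (m * m * S.q * (κ / S.T)) = m * m * κ := by field_simp
  have a4 : (S.q : ℝ)⁻¹ * (m * S.q * (1 + D)) = m * (1 + D) := by field_simp
  have a5 : (S.p * S.q : ℝ)⁻¹ * (S.scaleSq * (1 + (k * r + 1) * D)) ≤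
      V * (1 + (k * r + 1) * D) := by
    calc _ ≤ (S.p * S.q : ℝ)⁻¹ * (V * (S.p * S.q) * (1 + (k * r + 1) * D)) := by gcongr
      _ = _ := by field_simp
  linarith

/-- The sample second moment of the regressors is bounded below. -/
theorem le_regMoment_quadratic {P : Matrix (Fin m) (Fin m) ℝ} (hP : P.IsHermitian) {κ : ℝ}
    (hκ : 0 ≤ κ) (hPκ : 4 * κ ≤ nthEig P (m - 1)) {ω : Ω}
    (h1 : frobSq (S.regMoment ω - (S.T : ℝ)⁻¹ • ∑ t ∈ S.times, S.P t) ≤ κ ^ 2)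
    (h2 : frobSq ((S.T : ℝ)⁻¹ • ∑ t ∈ S.times, S.P t - P) ≤ κ ^ 2) (z : Fin m → ℝ) :
    2 * κ * (z ⬝ᵥ z) ≤ z ⬝ᵥ (S.regMoment ω *ᵥ z) := by
  set P' := (S.T : ℝ)⁻¹ • ∑ t ∈ S.times, S.P t
  have hz := dotProduct_self_nonneg z
  have b0 := le_dotProduct_mulVec hP hPκ z
  -- Of the 4κ available from P, the sampling error and the distance of the averaged P_t from P take
  -- at most κ each.
  have b1 := (abs_le.1 (abs_dotProduct_mulVec_le (S.regMoment ω - P') z)).1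
  have b2 := (abs_le.1 (abs_dotProduct_mulVec_le (P' - P) z)).1
  have c1 : √(frobSq (S.regMoment ω - P')) ≤ κ := Real.sqrt_le_iff.2 ⟨hκ, h1⟩
  have c2 : √(frobSq (P' - P)) ≤ κ := Real.sqrt_le_iff.2 ⟨hκ, h2⟩
  have d1 := mul_le_mul_of_nonneg_right c1 hz
  have d2 := mul_le_mul_of_nonneg_right c2 hz
  rw [Matrix.sub_mulVec, dotProduct_sub] at b1 b2
  linarith

/-- The constant in the bound for the errors of the residual autocovariances. -/
def residConst (h₀ : ℕ) (K c : ℝ) : ℝ :=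
  4 * (K + h₀ * (8 * (K ^ 2 / (4 * c ^ 2) * K) + 4 * (K ^ 2 / (4 * c ^ 2)) ^ 2))

/-- The errors of the residual autocovariances when the total error is at most `K`. -/
theorem sum_frobSq_residual_le {γ D : ℝ} {h₀ : ℕ} (hγ : 2 < γ)
    (hM : S.MomentsLe (2 * γ) D) (hp : 1 ≤ S.p) (hq : 1 ≤ S.q) (hT : 1 ≤ S.T)
    (hhT : 2 * h₀ ≤ S.T) {P : Matrix (Fin m) (Fin m) ℝ} (hP : P.IsHermitian) {c K : ℝ}
    (hc : 0 < c) (hPc : 4 * (c * S.q) ≤ nthEig P (m - 1))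
    (hPP : frobSq ((S.T : ℝ)⁻¹ • ∑ t ∈ S.times, S.P t - P) ≤ c ^ 2)
    (hKT : K ≤ c ^ 2 * S.T) {ω : Ω} (hω : S.totalErr h₀ ω ≤ K) :
    ∑ h ∈ Finset.Icc 1 h₀, frobSq
      (avgLagProd S.T h (fun t (e : Fin S.p × Fin S.q) => S.What ω t e.1 e.2)
        (fun t (e : Fin S.p × Fin S.q) => S.What ω t e.1 e.2) - S.lagCov h) ≤
      residConst h₀ K c * ((S.p * S.q) ^ 2 / S.T) := by
  have hp0 : (0 : ℝ) < S.p := by exact_mod_cast hp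
  have hq0 : (0 : ℝ) < S.q := by exact_mod_cast hq
  have hq1 : (1 : ℝ) ≤ S.q := by exact_mod_cast hq
  have hT0 : (0 : ℝ) < S.T := by exact_mod_cast hT
  have hT1 : (1 : ℝ) ≤ S.T := by exact_mod_cast hT
  have hK0 : 0 ≤ K := (S.totalErr_nonneg h₀ ω).trans hω
  have n1 := S.sum_frobSq_lagErr_nonneg h₀ ω
  have n2 := S.crossErr_nonneg ω
  have n3 := S.regErr_nonneg ω
  have n4 := S.avg_frobSq_nonneg fun t => S.X t ω
  have n5 := S.avg_frobSq_nonneg fun t => S.W t ω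
  rw [totalErr] at hω
  set lag := ∑ h ∈ Finset.Icc 1 h₀, frobSq (S.lagErr h ω)
  set sx := (S.T : ℝ)⁻¹ * ∑ t ∈ S.times, frobSq (S.X t ω) with hsx
  set sw := (S.T : ℝ)⁻¹ * ∑ t ∈ S.times, frobSq (S.W t ω) with hsw
  have m1 : 0 ≤ (S.T / (S.p * S.q) ^ 2 : ℝ) * lag := by positivity
  have m2 : 0 ≤ (S.T / (S.p * S.q) : ℝ) * S.crossErr ω := by positivity
  have m3 : 0 ≤ (S.T / S.q : ℝ) * S.regErr ω := by positivity
  have m4 : 0 ≤ (S.q : ℝ)⁻¹ * sx := by positivity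
  have m5 : 0 ≤ (S.p * S.q : ℝ)⁻¹ * sw := by positivity
  have e1 : lag ≤ K * ((S.p * S.q) ^ 2 / S.T) := by
    have : lag = ((S.T / (S.p * S.q) ^ 2 : ℝ) * lag) * ((S.p * S.q) ^ 2 / S.T) := by field_simp
    rw [this]
    exact mul_le_mul_of_nonneg_right (by linarith) (by positivity)
  have e2 : S.crossErr ω ≤ K * (S.p * S.q / S.T) := by
    have : S.crossErr ω = ((S.T / (S.p * S.q) : ℝ) * S.crossErr ω) * (S.p * S.q / S.T) := by
      field_simp
    rw [this]
    exact mul_le_mul_of_nonneg_right (by linarith) (by positivity)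
  have e3 : S.regErr ω ≤ K * (S.q / S.T) := by
    have : S.regErr ω = ((S.T / S.q : ℝ) * S.regErr ω) * (S.q / S.T) := by field_simp
    rw [this]
    exact mul_le_mul_of_nonneg_right (by linarith) (by positivity)
  have e4 : sx ≤ K * S.q := by
    have : sx = ((S.q : ℝ)⁻¹ * sx) * S.q := by field_simp
    rw [this]
    exact mul_le_mul_of_nonneg_right (by linarith) (by positivity)
  have e5 : sw ≤ K * (S.p * S.q) := by
    have : sw = ((S.p * S.q : ℝ)⁻¹ * sw) * (S.p * S.q) := by field_simp
    rw [this]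
    exact mul_le_mul_of_nonneg_right (by linarith) (by positivity)
  -- The error is at most K q²/T, so K ≤ c²T is precisely what makes it harmless.
  have hreg : frobSq (S.regMoment ω - (S.T : ℝ)⁻¹ • ∑ t ∈ S.times, S.P t) ≤ (c * S.q) ^ 2 := by
    refine (frobSq_regMoment_sub_le (by linarith) hM ω).trans ?_
    calc _ ≤ S.q * (K * (S.q / S.T)) := by gcongr
      _ ≤ S.q * (c ^ 2 * S.T * (S.q / S.T)) := by gcongr
      _ = _ := by field_simp
  have hquad := le_regMoment_quadratic hP (by positivity) hPc hreg
    (hPP.trans (pow_le_pow_left₀ hc.le (le_mul_of_one_le_right hc.le hq1) 2))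
  have hA : frobSq (S.Ahat ω - S.A) ≤ K / (4 * c ^ 2) * (S.p / S.T) := by
    have h1 := S.sq_mul_frobSq_Ahat_sub_le ω (by positivity : 0 < 2 * (c * S.q)) hquad
    have h2 : (2 * (c * S.q)) ^ 2 * frobSq (S.Ahat ω - S.A) ≤
        (2 * (c * S.q)) ^ 2 * (K / (4 * c ^ 2) * (S.p / S.T)) := by
      refine h1.trans ((mul_le_mul_of_nonneg_left e2 hq0.le).trans_eq ?_)
      field_simp
      ring
    exact le_of_mul_le_mul_left h2 (by positivity)
  have hd : frobSq (S.Ahat ω - S.A) * sx ≤ K ^ 2 / (4 * c ^ 2) * (S.p * S.q / S.T) := by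
    calc _ ≤ (K / (4 * c ^ 2) * (S.p / S.T)) * (K * S.q) := by gcongr
      _ = _ := by ring
  calc _ ≤ ∑ h ∈ Finset.Icc 1 h₀, 4 * (frobSq (S.lagErr h ω) +
        8 * (K ^ 2 / (4 * c ^ 2) * (S.p * S.q / S.T) * (K * (S.p * S.q))) +
        4 * (K ^ 2 / (4 * c ^ 2) * (S.p * S.q / S.T) *
          (K ^ 2 / (4 * c ^ 2) * (S.p * S.q / S.T)))) :=
        Finset.sum_le_sum fun h hh => S.frobSq_residual_lagErr_le hT
          (by have := (Finset.mem_Icc.1 hh).2; omega) ω hd e5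
    _ = 4 * (lag + h₀ * (8 * (K ^ 2 / (4 * c ^ 2) * K) * ((S.p * S.q) ^ 2 / S.T) +
        4 * (K ^ 2 / (4 * c ^ 2)) ^ 2 * ((S.p * S.q) ^ 2 / S.T * (1 / S.T)))) := by
      rw [← Finset.mul_sum, Finset.sum_add_distrib, Finset.sum_add_distrib]
      simp only [Finset.sum_const, Nat.card_Icc, add_tsub_cancel_right, nsmul_eq_mul]
      ring
    _ ≤ 4 * (K * ((S.p * S.q) ^ 2 / S.T) +
        h₀ * (8 * (K ^ 2 / (4 * c ^ 2) * K) * ((S.p * S.q) ^ 2 / S.T) +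
        4 * (K ^ 2 / (4 * c ^ 2)) ^ 2 * ((S.p * S.q) ^ 2 / S.T * 1))) := by
      -- The term quadratic in Â - A is smaller by a factor 1/T, which is given away.
      have : 1 / (S.T : ℝ) ≤ 1 := by rw [div_le_one hT0]; exact hT1
      gcongr
    _ = _ := by rw [residConst]; ring

/-- Both estimation errors when the total error is at most `K`; `x` is the strength of the factors
and `η` the rate. -/
theorem subspaceDist_le_of_totalErr_le {γ D : ℝ} {h₀ : ℕ} (hk : 1 ≤ k) (hr : 1 ≤ r)
    (hγ : 2 < γ) (hD : 0 ≤ D) (hM : S.MomentsLe (2 * γ) D) (hS : S.Standing)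
    (hp : k ≤ S.p) (hq : r ≤ S.q) (hT : 1 ≤ S.T) (hhT : 2 * h₀ ≤ S.T)
    {P : Matrix (Fin m) (Fin m) ℝ} (hP : P.IsHermitian) {c K : ℝ}
    (hc : 0 < c) (hPc : 4 * (c * S.q) ≤ nthEig P (m - 1))
    (hPP : frobSq ((S.T : ℝ)⁻¹ • ∑ t ∈ S.times, S.P t - P) ≤ c ^ 2)
    (hKT : K ≤ c ^ 2 * S.T) {cF : ℝ} (hcF : 0 ≤ cF) (hF₁ : cF ≤ nthEig (popM S.μ S.T h₀ S.F) (k - 1))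
    (hF₂ : cF ≤ nthEig (popM S.μ S.T h₀ fun t ω => (S.F t ω)ᵀ) (r - 1))
    (hpos₁ : ∀ j < k, 0 < nthEig (S.M₁ h₀) j) (hpos₂ : ∀ j < r, 0 < nthEig (S.M₂ h₀) j)
    {Q₁ Q₁' : Matrix (Fin S.p) (Fin k) ℝ} {Q₂ Q₂' : Matrix (Fin S.q) (Fin r) ℝ} {ω : Ω}
    (hQ₁ : IsLeadingEigenvectors (S.M₁ h₀) Q₁) (hQ₂ : IsLeadingEigenvectors (S.M₂ h₀) Q₂)
    (hQ₁' : IsLeadingEigenvectors (S.M₁hat h₀ ω) Q₁')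
    (hQ₂' : IsLeadingEigenvectors (S.M₂hat h₀ ω) Q₂')
    {x η cs L : ℝ} (hx : 0 < x) (hη0 : 0 ≤ η) (hη1 : η ≤ 1) (hcs : 0 < cs)
    (hsig : cs * x ^ 2 ≤
      cF * (singVal S.R (k - 1) ^ 2) ^ 2 * (singVal S.C (r - 1) ^ 2) ^ 2)
    (hload : (k * frobSq S.R) * (r * frobSq S.C) ≤ L * x)
    (hxη : (S.p * S.q : ℝ) ^ 2 / S.T = (x * η) ^ 2)
    (hη : (√(residConst h₀ K c) ^ 2 + 2 * √(residConst h₀ K c) * (h₀ * ((1 + D) * L))) * η ≤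
      cs / 2) (hω : S.totalErr h₀ ω ≤ K) :
    subspaceDist Q₁' Q₁ ≤ 2 / cs * (√(residConst h₀ K c) ^ 2 +
        2 * √(residConst h₀ K c) * (h₀ * ((1 + D) * L))) * η ∧
      subspaceDist Q₂' Q₂ ≤ 2 / cs * (√(residConst h₀ K c) ^ 2 +
        2 * √(residConst h₀ K c) * (h₀ * ((1 + D) * L))) * η := by
  have hK0 : 0 ≤ K := (S.totalErr_nonneg h₀ ω).trans hω
  have hres0 : 0 ≤ residConst h₀ K c := by unfold residConst; positivity
  have hfR := frobSq_nonneg S.R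
  have hfC := frobSq_nonneg S.C
  have hL0 : 0 ≤ L := by
    have : 0 ≤ L * x := le_trans (by positivity) hload
    exact nonneg_of_mul_nonneg_left this hx
  have hres := sum_frobSq_residual_le hγ hM (hk.trans hp) (hr.trans hq) hT hhT hP hc hPc hPP hKT hω
  have herr : ∑ h ∈ Finset.Icc 1 h₀, frobSq
      (avgLagProd S.T h (fun t (e : Fin S.p × Fin S.q) => S.What ω t e.1 e.2)
        (fun t (e : Fin S.p × Fin S.q) => S.What ω t e.1 e.2) - S.lagCov h) ≤
      (√(residConst h₀ K c) * x * η) ^ 2 := by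
    refine hres.trans_eq ?_
    rw [hxη, mul_assoc, mul_pow (√_), Real.sq_sqrt hres0]
  have hpop : ∑ h ∈ Finset.Icc 1 h₀, frobSq (S.lagCov h) ≤ (h₀ * ((1 + D) * L) * x) ^ 2 := by
    calc _ ≤ ∑ h ∈ Finset.Icc 1 h₀, ((1 + D) * (L * x)) ^ 2 := by
          refine Finset.sum_le_sum fun h hh => ?_
          obtain ⟨h1, h2⟩ := Finset.mem_Icc.1 hh
          refine (frobSq_lagCov_le hγ hM hS h1 (by omega)).trans ?_
          gcongr
      _ = h₀ * ((1 + D) * (L * x)) ^ 2 := by simp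
      -- Using h₀ ≤ h₀² makes the bound a perfect square and avoids √h₀ in the constant.
      _ ≤ (h₀ : ℝ) ^ 2 * ((1 + D) * (L * x)) ^ 2 := by
        refine mul_le_mul_of_nonneg_right ?_ (sq_nonneg _)
        exact_mod_cast Nat.le_self_pow two_ne_zero h₀
      _ = _ := by ring
  constructor
  · refine subspaceDist_le_of_loadedCov hk hp S.R S.C
      (fun h hh => avgLagCov_columns hγ hM hS (Finset.mem_Icc.1 hh).1) hcF hF₁ hQ₁ hpos₁ hQ₁' hx
      hη0 hη1 hcs (Real.sqrt_nonneg _) (by positivity) hsig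
      (le_trans (le_of_eq (Finset.sum_congr rfl fun h _ => ?_)) hpop)
      (le_trans (le_of_eq (Finset.sum_congr rfl fun h _ => ?_)) herr) hη
    · exact sum_frobSq_columns (S.lagCov h)
    · exact sum_frobSq_columns (avgLagProd S.T h
        (fun t (e : Fin S.p × Fin S.q) => S.What ω t e.1 e.2)
        (fun t (e : Fin S.p × Fin S.q) => S.What ω t e.1 e.2) - S.lagCov h)
  · refine subspaceDist_le_of_loadedCov hr hq S.C S.R
      (fun h hh => avgLagCov_rows hγ hM hS (Finset.mem_Icc.1 hh).1) hcF hF₂ hQ₂ hpos₂ hQ₂' hx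
      hη0 hη1 hcs (Real.sqrt_nonneg _) (by positivity) (hsig.trans_eq (by ring))
      (le_trans (le_of_eq (Finset.sum_congr rfl fun h _ => ?_)) hpop)
      (le_trans (le_of_eq (Finset.sum_congr rfl fun h _ => ?_)) herr) hη
    · exact sum_frobSq_rows (S.lagCov h)
    · exact sum_frobSq_rows (avgLagProd S.T h
        (fun t (e : Fin S.p × Fin S.q) => S.What ω t e.1 e.2)
        (fun t (e : Fin S.p × Fin S.q) => S.What ω t e.1 e.2) - S.lagCov h)

end Model

/-! ### From asymptotic conditions to constants valid for large n. -/

theorem nthEig_nonneg_of_posDef {a : ℕ} {M : Matrix (Fin a) (Fin a) ℝ} (hM : M.PosDef) {j : ℕ}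
    (hj : j < a) : 0 ≤ nthEig M j := by
  refine le_nthEig hM.isHermitian (Q := 1) (by simp) le_rfl (fun z => ?_) hj
  have := hM.posSemidef.dotProduct_mulVec_nonneg z
  simpa using this

theorem exists_eventually_le_mul_of_isBigO {f g : ℕ → ℝ} (h : f =O[atTop] g) (hg : ∀ n, 0 ≤ g n) :
    ∃ c, 0 < c ∧ ∀ᶠ n in atTop, f n ≤ c * g n := by
  obtain ⟨c, hc, hb⟩ := h.exists_pos
  refine ⟨c, hc, hb.bound.mono fun n hn => ?_⟩
  rw [Real.norm_of_nonneg (hg n)] at hn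
  exact (le_abs_self _).trans hn

/-- If `Z` is at most a multiple of `a` on the events that a random variable with bounded means is
small, then `Z = O_p(a)`. -/
theorem isBigOInProb_of_meanLe {Ω : ℕ → Type*} [∀ n, MeasurableSpace (Ω n)]
    {μ : ∀ n, Measure (Ω n)} [∀ n, IsProbabilityMeasure (μ n)] {Z U : ∀ n, Ω n → ℝ} {a : ℕ → ℝ}
    {C : ℝ} (hU0 : ∀ n ω, 0 ≤ U n ω) (hU : ∀ᶠ n in atTop, MeanLe (μ n) (U n) C)
    (hZ : ∀ K : ℝ, ∃ B : ℝ, ∀ᶠ n in atTop, ∀ ω, U n ω ≤ K → |Z n ω| ≤ B * a n) :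
    IsBigOInProb μ Z a := by
  intro ε hε
  -- This is the threshold of Markov's inequality; the maximum with 1 makes it positive.
  obtain ⟨B, hB⟩ := hZ (max C 1 / ε)
  refine ⟨B, ?_⟩
  filter_upwards [hU, hB] with n hn hBn
  refine (measure_mono fun ω hω => ?_).trans
    ((hn.mono (le_max_left C 1)).measure_lt_le (hU0 n) hε (by positivity))
  by_contra h
  exact absurd (hBn ω (not_lt.1 h)) (not_le.2 hω)

section Asymptotics

variable {k r m : ℕ} {Ω : ℕ → Type*} [∀ n, MeasurableSpace (Ω n)]
  {S : ∀ n, Model k r m (Ω n)}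

theorem Condition2.exists_momentsLe {γ : ℝ} (h : Condition2 S γ) :
    ∃ D, 0 ≤ D ∧ ∀ n, (S n).MomentsLe (2 * γ) D := by
  obtain ⟨B, hB⟩ := h
  refine ⟨max B 0, le_max_right _ _, fun n t ht => ?_⟩
  obtain ⟨h1, h2, h3⟩ := hB n t ht
  exact ⟨fun i j => (h1 i j).mono (le_max_left _ _), fun i j => (h2 i j).mono (le_max_left _ _),
    fun i j => (h3 i j).mono (le_max_left _ _)⟩

theorem Condition4.exists_limit (hm : 1 ≤ m) (h : Condition4 S) :
    ∃ P : ℕ → Matrix (Fin m) (Fin m) ℝ, (∀ n, (P n).IsHermitian) ∧ ∃ c : ℝ, 0 < c ∧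
      ∀ᶠ n in atTop, 4 * (c * (S n).q) ≤ nthEig (P n) (m - 1) ∧
        frobSq (((S n).T : ℝ)⁻¹ • ∑ t ∈ (S n).times, (S n).P t - P n) ≤ c ^ 2 := by
  obtain ⟨-, P, hP, hlim, hΘ⟩ := h
  obtain ⟨b, hb, hbn⟩ := exists_eventually_le_mul_of_isBigO hΘ.2
    fun n => nthEig_nonneg_of_posDef (hP n) (by omega)
  -- Here q ≤ bλ_min(P), so 4cq ≤ λ_min(P) for c = 1/(4b).
  refine ⟨P, fun n => (hP n).isHermitian, (4 * b)⁻¹, by positivity, ?_⟩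
  have h0 : Tendsto (fun n => frobSq (((S n).T : ℝ)⁻¹ • ∑ t ∈ (S n).times, (S n).P t - P n))
      atTop (𝓝 0) := by
    have : Tendsto (fun n => ∑ l : Fin m, ∑ l' : Fin m,
        ((((S n).T : ℝ)⁻¹ • ∑ t ∈ (S n).times, (S n).P t) l l' - P n l l') ^ 2) atTop
        (𝓝 (∑ l : Fin m, ∑ l' : Fin m, (0 : ℝ) ^ 2)) :=
      tendsto_finsetSum _ fun l _ => tendsto_finsetSum _ fun l' _ => (hlim l l').pow 2
    simpa [frobSq] using this
  filter_upwards [hbn, h0.eventually_le_const (by positivity : (0 : ℝ) < (4 * b)⁻¹ ^ 2)]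
    with n hn hn'
  refine ⟨?_, hn'⟩
  calc _ = b⁻¹ * ((S n).q : ℝ) := by field_simp
    _ ≤ b⁻¹ * (b * nthEig (P n) (m - 1)) := by gcongr
    _ = _ := by field_simp

/-- The strength `p ^ (1 - δ₁) q ^ (1 - δ₂)` of the factors. -/
def strength (S : ∀ n, Model k r m (Ω n)) (δ₁ δ₂ : ℝ) (n : ℕ) : ℝ :=
  ((S n).p : ℝ) ^ (1 - δ₁) * ((S n).q : ℝ) ^ (1 - δ₂)

theorem Condition6.exists_bounds {δ₁ δ₂ : ℝ} (h : Condition6 S δ₁ δ₂) {cF : ℝ} (hcF : 0 < cF) :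
    ∃ cs L : ℝ, 0 < cs ∧ 0 < L ∧ ∀ᶠ n in atTop,
      cs * strength S δ₁ δ₂ n ^ 2 ≤ cF * (singVal (S n).R (k - 1) ^ 2) ^ 2 *
        (singVal (S n).C (r - 1) ^ 2) ^ 2 ∧
      (k * frobSq (S n).R) * (r * frobSq (S n).C) ≤ L * strength S δ₁ δ₂ n := by
  obtain ⟨-, -, -, -, h1, h2, h3, h4⟩ := h
  have hp : ∀ n, 0 ≤ ((S n).p : ℝ) ^ (1 - δ₁) := fun n => by positivity
  have hq : ∀ n, 0 ≤ ((S n).q : ℝ) ^ (1 - δ₂) := fun n => by positivity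
  obtain ⟨c1, hc1, e1⟩ := exists_eventually_le_mul_of_isBigO h1.1 hp
  obtain ⟨c2, hc2, e2⟩ := exists_eventually_le_mul_of_isBigO h2.2 fun n => sq_nonneg _
  obtain ⟨c3, hc3, e3⟩ := exists_eventually_le_mul_of_isBigO h3.1 hq
  obtain ⟨c4, hc4, e4⟩ := exists_eventually_le_mul_of_isBigO h4.2 fun n => sq_nonneg _
  -- The factors k² and r² come from the row sums of absolute loadings and from the passage to the
  -- spectral norm; the `+ 1` keeps `L` positive even if `k` or `r` is zero.
  refine ⟨cF / (c2 * c4) ^ 2, (k * k * c1) * (r * r * c3) + 1, by positivity, by positivity, ?_⟩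
  filter_upwards [e1, e2, e3, e4] with n e1 e2 e3 e4
  have hpn := hp n
  have hqn := hq n
  constructor
  · calc cF / (c2 * c4) ^ 2 * strength S δ₁ δ₂ n ^ 2
        ≤ cF / (c2 * c4) ^ 2 * ((c2 * singVal (S n).R (k - 1) ^ 2) *
            (c4 * singVal (S n).C (r - 1) ^ 2)) ^ 2 := by
          unfold strength; gcongr
      _ = _ := by field_simp
  · have f1 := frobSq_le_specNorm (S n).R
    have f3 := frobSq_le_specNorm (S n).C
    have g3 := frobSq_nonneg (S n).C
    calc _ ≤ (k * (k * (c1 * ((S n).p : ℝ) ^ (1 - δ₁)))) *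
          (r * (r * (c3 * ((S n).q : ℝ) ^ (1 - δ₂)))) := by
          refine mul_le_mul ?_ ?_ (by positivity) (by positivity)
          · exact mul_le_mul_of_nonneg_left (f1.trans (by gcongr)) (by positivity)
          · exact mul_le_mul_of_nonneg_left (f3.trans (by gcongr)) (by positivity)
      _ = ((k * k * c1) * (r * r * c3)) * strength S δ₁ δ₂ n := by unfold strength; ring
      _ ≤ _ := by
        refine mul_le_mul_of_nonneg_right (by linarith) ?_
        unfold strength; positivity

theorem strength_le {δ₁ δ₂ : ℝ} (h1 : 0 ≤ δ₁) (h2 : 0 ≤ δ₂) {n : ℕ} (hp : 1 ≤ (S n).p)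
    (hq : 1 ≤ (S n).q) : strength S δ₁ δ₂ n ≤ (S n).p * (S n).q := by
  have hp1 : (1 : ℝ) ≤ (S n).p := by exact_mod_cast hp
  have hq1 : (1 : ℝ) ≤ (S n).q := by exact_mod_cast hq
  refine mul_le_mul ?_ ?_ (by positivity) (by positivity)
  · exact (Real.rpow_le_rpow_of_exponent_le hp1 (by linarith)).trans_eq (Real.rpow_one _)
  · exact (Real.rpow_le_rpow_of_exponent_le hq1 (by linarith)).trans_eq (Real.rpow_one _)

/-- The noise level pq T^(-1/2) relative to the factor strength is the rate: this identity is the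
origin of p^δ₁ q^δ₂ T^(-1/2). -/
theorem sq_div_eq_strength_mul_rate_sq {δ₁ δ₂ : ℝ} {n : ℕ} (hp : 1 ≤ (S n).p)
    (hq : 1 ≤ (S n).q) :
    ((S n).p * (S n).q : ℝ) ^ 2 / (S n).T = (strength S δ₁ δ₂ n *
      (((S n).p : ℝ) ^ δ₁ * ((S n).q : ℝ) ^ δ₂ * ((S n).T : ℝ) ^ (-(1 / 2 : ℝ)))) ^ 2 := by
  have hp0 : (0 : ℝ) < (S n).p := by exact_mod_cast hp
  have hq0 : (0 : ℝ) < (S n).q := by exact_mod_cast hq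
  have e1 : ((S n).p : ℝ) ^ (1 - δ₁) * ((S n).p : ℝ) ^ δ₁ = (S n).p := by
    rw [← Real.rpow_add hp0, sub_add_cancel, Real.rpow_one]
  have e2 : ((S n).q : ℝ) ^ (1 - δ₂) * ((S n).q : ℝ) ^ δ₂ = (S n).q := by
    rw [← Real.rpow_add hq0, sub_add_cancel, Real.rpow_one]
  have e3 : (((S n).T : ℝ) ^ (-(1 / 2 : ℝ))) ^ 2 = ((S n).T : ℝ)⁻¹ := by
    rw [← Real.rpow_natCast, ← Real.rpow_mul (Nat.cast_nonneg _), ← Real.rpow_neg_one]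
    norm_num
  calc _ = ((((S n).p : ℝ) ^ (1 - δ₁) * ((S n).p : ℝ) ^ δ₁) *
        (((S n).q : ℝ) ^ (1 - δ₂) * ((S n).q : ℝ) ^ δ₂)) ^ 2 *
          (((S n).T : ℝ) ^ (-(1 / 2 : ℝ))) ^ 2 := by rw [e1, e2, e3]; ring
    _ = _ := by unfold strength; ring

end Asymptotics

end MatFactor

end

theorem theorem5 {k r m h₀ : ℕ} (hk : 1 ≤ k) (hr : 1 ≤ r) (hm : 1 ≤ m) (γ δ₁ δ₂ : ℝ)
    {Ω : ℕ → Type*} [∀ n, MeasurableSpace (Ω n)] (S : ∀ n, MatFactor.Model k r m (Ω n))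
    (hp : Tendsto (fun n => (S n).p) atTop atTop)
    (hq : Tendsto (fun n => (S n).q) atTop atTop)
    (hT : Tendsto (fun n => (S n).T) atTop atTop)
    (hS : ∀ n, (S n).Standing)
    (h1 : MatFactor.Condition1 S γ)
    (h2 : MatFactor.Condition2 S γ)
    (h3 : MatFactor.Condition3 S h₀)
    (h4 : MatFactor.Condition4 S)
    (h5 : MatFactor.Condition5 S)
    (h6 : MatFactor.Condition6 S δ₁ δ₂)
    (h7 : MatFactor.Condition7 S h₀)
    (hrate : Tendsto
      (fun n => ((S n).p : ℝ) ^ δ₁ * ((S n).q : ℝ) ^ δ₂ * ((S n).T : ℝ) ^ (-(1 / 2 : ℝ)))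
      atTop (𝓝 0))
    (Q₁ : ∀ n, Matrix (Fin (S n).p) (Fin k) ℝ) (Q₂ : ∀ n, Matrix (Fin (S n).q) (Fin r) ℝ)
    (Q₁hat : ∀ n, Ω n → Matrix (Fin (S n).p) (Fin k) ℝ)
    (Q₂hat : ∀ n, Ω n → Matrix (Fin (S n).q) (Fin r) ℝ)
    (hQ₁ : ∀ᶠ n in atTop, MatFactor.IsLeadingEigenvectors ((S n).M₁ h₀) (Q₁ n))
    (hQ₂ : ∀ᶠ n in atTop, MatFactor.IsLeadingEigenvectors ((S n).M₂ h₀) (Q₂ n))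
    (hQ₁hat : ∀ᶠ n in atTop, ∀ ω,
      MatFactor.IsLeadingEigenvectors ((S n).M₁hat h₀ ω) (Q₁hat n ω))
    (hQ₂hat : ∀ᶠ n in atTop, ∀ ω,
      MatFactor.IsLeadingEigenvectors ((S n).M₂hat h₀ ω) (Q₂hat n ω)) :
    MatFactor.IsBigOInProb (fun n => (S n).μ)
        (fun n ω => MatFactor.subspaceDist (Q₁hat n ω) (Q₁ n))
        (fun n => ((S n).p : ℝ) ^ δ₁ * ((S n).q : ℝ) ^ δ₂ * ((S n).T : ℝ) ^ (-(1 / 2 : ℝ))) ∧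
      MatFactor.IsBigOInProb (fun n => (S n).μ)
        (fun n ω => MatFactor.subspaceDist (Q₂hat n ω) (Q₂ n))
        (fun n => ((S n).p : ℝ) ^ δ₁ * ((S n).q : ℝ) ^ δ₂ * ((S n).T : ℝ) ^ (-(1 / 2 : ℝ))) := by
  obtain ⟨hγ, B, hB⟩ := h1
  obtain ⟨D, hD, hM⟩ := h2.exists_momentsLe
  obtain ⟨-, cF, hcF, hF⟩ := h3
  obtain ⟨P, hPh, c, hc, hP⟩ := h4.exists_limit hm
  have hδ₁ : 0 ≤ δ₁ := h6.1
  have hδ₂ : 0 ≤ δ₂ := h6.2.2.1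
  obtain ⟨cs, L, hcs, hL, hsL⟩ := h6.exists_bounds hcF
  set η : ℕ → ℝ := fun n =>
    ((S n).p : ℝ) ^ δ₁ * ((S n).q : ℝ) ^ δ₂ * ((S n).T : ℝ) ^ (-(1 / 2 : ℝ)) with hη
  have hη0 : ∀ n, 0 ≤ η n := fun n => by simp only [hη]; positivity
  -- The total squared scale is at most 2(pq + Lx), and x ≤ pq because δ₁, δ₂ ≥ 0; hence V = 2(1 +
  -- L).
  have hU : ∀ᶠ n in atTop, MatFactor.MeanLe (S n).μ ((S n).totalErr h₀)
      (MatFactor.Model.totalConst k r m h₀ D B (2 * (1 + L))) := by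
    filter_upwards [hp.eventually_ge_atTop 1, hq.eventually_ge_atTop 1,
      hT.eventually_ge_atTop (2 * h₀ + 1), hsL] with n hpn hqn hTn hsLn
    refine MatFactor.Model.meanLe_totalErr hγ hD (hM n) (hS n) hpn hqn (by omega) (by omega)
      (hB n).1 (hB n).2 ?_
    rw [MatFactor.Model.scaleSq, Fintype.sum_prod_type]
    refine (S n).sum_scale_sq_le.trans ?_
    have := hsLn.2.trans
      (mul_le_mul_of_nonneg_left (MatFactor.strength_le (S := S) hδ₁ hδ₂ hpn hqn) hL.le)
    linarith
  -- K is fixed before n, so "large n" may depend on K. This allows K ≤ c²T, and by η → 0 also that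
  -- the perturbation is at most half of the eigenvalue bound.
  have key : ∀ K : ℝ, ∃ B' : ℝ, ∀ᶠ n in atTop, ∀ ω, (S n).totalErr h₀ ω ≤ K →
      |MatFactor.subspaceDist (Q₁hat n ω) (Q₁ n)| ≤ B' * η n ∧
        |MatFactor.subspaceDist (Q₂hat n ω) (Q₂ n)| ≤ B' * η n := by
    intro K
    set κ := √(MatFactor.Model.residConst h₀ K c) ^ 2 +
      2 * √(MatFactor.Model.residConst h₀ K c) * (h₀ * ((1 + D) * L)) with hκ
    refine ⟨2 / cs * κ, ?_⟩
    have hη1 : ∀ᶠ n in atTop, η n ≤ 1 := hrate.eventually_le_const one_pos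
    have hη2 : ∀ᶠ n in atTop, κ * η n ≤ cs / 2 := by
      have : Tendsto (fun n => κ * η n) atTop (𝓝 0) := by simpa using hrate.const_mul κ
      exact this.eventually_le_const (by positivity)
    have hKT : ∀ᶠ n in atTop, K ≤ c ^ 2 * ((S n).T : ℝ) := by
      have : Tendsto (fun n => c ^ 2 * ((S n).T : ℝ)) atTop atTop :=
        (tendsto_natCast_atTop_atTop.comp hT).const_mul_atTop (by positivity)
      exact this.eventually_ge_atTop K
    filter_upwards [hp.eventually_ge_atTop k, hq.eventually_ge_atTop r,
      hT.eventually_ge_atTop (2 * h₀ + 1), hsL, hP, hF, h7, hQ₁, hQ₂, hQ₁hat, hQ₂hat, hη1, hη2, hKT]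
      with n hpn hqn hTn hsLn hPn hFn h7n hQ₁n hQ₂n hQ₁n' hQ₂n' hη1n hη2n hKTn ω hω
    have hp0 : 0 < (S n).p := hk.trans hpn
    have hq0 : 0 < (S n).q := hr.trans hqn
    have hx : 0 < MatFactor.strength S δ₁ δ₂ n := by unfold MatFactor.strength; positivity
    have := MatFactor.Model.subspaceDist_le_of_totalErr_le hk hr hγ hD (hM n) (hS n) hpn hqn
      (by omega) (by omega) (hPh n) hc hPn.1 hPn.2 hKTn hcF.le hFn.1 hFn.2 h7n.1.1 h7n.2.1
      hQ₁n hQ₂n (hQ₁n' ω) (hQ₂n' ω) hx (hη0 n) hη1n hcs hsLn.1 hsLn.2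
      (MatFactor.sq_div_eq_strength_mul_rate_sq hp0 hq0) hη2n hω
    rwa [abs_of_nonneg (a := MatFactor.subspaceDist _ (Q₁ n)) (Real.sqrt_nonneg _),
      abs_of_nonneg (a := MatFactor.subspaceDist _ (Q₂ n)) (Real.sqrt_nonneg _)]
  exact ⟨MatFactor.isBigOInProb_of_meanLe (fun n ω => (S n).totalErr_nonneg h₀ ω) hU fun K =>
      (key K).imp fun B' h => h.mono fun n hn ω hω => (hn ω hω).1,
    MatFactor.isBigOInProb_of_meanLe (fun n ω => (S n).totalErr_nonneg h₀ ω) hU fun K =>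
      (key K).imp fun B' h => h.mono fun n hn ω hω => (hn ω hω).2⟩
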